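/- Let $d\ge 1$ and let $\phi\in C_0^\infty(\mathbb R)$ be real-valued, supported in the open interval $(0,1)$, not identically zero, with $|\phi(t)|<1$ for all $t$; let $b(t)=\phi(t-\lfloor t\rfloor)$ be its $1$-periodisation. Let $(\tau_k)_{k\ge1}$, $(\delta_k)_{k\ge1}$ be real sequences and $(n_k)_{k\ge1}$ a sequence of positive integers with $\tau_1\ge 0$, $\delta_k>0$, $\tau_{k+1}>\tau_k+\delta_k$ and $\tau_k\to\infty$ (call these admissible), put $I_k=[\tau_k,\tau_k+\delta_k]$, and define $$a(t)=1+b\Big(\frac{n_k}{\delta_k}(t-\tau_k)\Big)\ \text{ for } t\in I_k,\ k\ge 1,\qquad a(t)=1\ \text{ otherwise.}$$ Consider the Cauchy problem $$u_{tt}-a(t)^2\Delta u=0\quad (t\ge0,\ x\in\mathbb R^d),\qquad u(0,\cdot)=u_0,\quad u_t(0,\cdot)=u_1,$$ with data $u_0,u_1\in\mathscr S(\mathbb R^d)$ (complex-valued) and solutions that are twice differentiable in $t\in[0,\infty)$ with values in $\mathscr S(\mathbb R^d)$, and let $\mathbb E(u;t)=\frac12\int_{\mathbb R^d}(|\nabla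 u|^2+|u_t|^2)\,dx$. (1) The number $c=\sup_{s\in\mathbb R}\frac{|b'(s)|}{1+b(s)}$ is finite and positive, and there is a constant $\kappa>0$, not depending on the sequences or on $k$, such that for all admissible $(\tau_k),(\delta_k),(n_k)$ there are data $u_{0,k},u_{1,k}\in\mathscr S(\mathbb R^d)$, $k\ge1$, with $\mathbb E(u_k;0)=1$, for which a solution $u_k$ exists and every solution $u_k$ satisfies $\mathbb E(u_k;\tau_k+\delta_k)>0$ and $$\log \mathbb E(u_k;\tau_k+\delta_k)\ \ge\ 2\kappa\, n_k-2c\sum_{\ell=1}^{k-1}n_\ell .$$ (2) For every $q>0$ there is $\sigma_0>1$ such that for every $\sigma\ge\sigma_0$ the sequences $\tau_k=\sigma^k$, $\delta_k=\sigma^{k-1}$, $n_k=\lceil\sigma^{qk}\rceil$ are admissible, and the corresponding coefficient $a$ is smooth, satisfies $m\le a(t)<2$ for all $t$ with some $m>0$, satisfies $$|a^{(\ell)}(t)|\le C_\ell\,(1+t)^{-(1-q)\ell}\qquad (t\ge0,\ \ell=0,1,2,\dots)$$ with some constants $C_\ell$, and admits no uniform energy bound: there is no constant $C$ such that $\mathbb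 E(u;t)\le C\,\mathbb E(u;0)$ for all $t\ge0$ and all solutions $u$ with data in $\mathscr S(\mathbb R^d)$. -/

import Mathlib

open Set Filter Topology
open scoped ContDiff SchwartzMap LineDeriv Laplacian

noncomputable section

/-- The 1-periodic function `b(t) = φ(t - ⌊t⌋)`. -/
def periodisation (φ : ℝ → ℝ) (t : ℝ) : ℝ := φ (t - (⌊t⌋ : ℝ))

/-- The profiles `φ`: real, smooth, supported in `(0,1)`, not identically zero, `|φ| < 1`. -/
structure IsProfile (φ : ℝ → ℝ) : Prop where
  smooth : ContDiff ℝ ∞ φ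
  support : tsupport φ ⊆ Ioo 0 1
  ne_zero : φ ≠ 0
  abs_lt_one : ∀ t, |φ t| < 1

/-- Admissible parameters `τ_k, δ_k, n_k`, indexed by `k = 1, 2, 3, …` (the value at `k = 0`
is never used). -/
structure IsAdmissible (τ δ : ℕ → ℝ) (n : ℕ → ℕ) : Prop where
  start_nonneg : 0 ≤ τ 1
  length_pos : ∀ k, 1 ≤ k → 0 < δ k
  count_pos : ∀ k, 1 ≤ k → 0 < n k
  separated : ∀ k, 1 ≤ k → τ k + δ k < τ (k + 1)
  tendsto : Tendsto τ atTop atTop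

open Classical in
/-- The coefficient `a(t)`: it equals `1 + b(n_k (t - τ_k) / δ_k)` if
`t ∈ [τ_k, τ_k + δ_k]` for some `k ≥ 1` (such a `k` is unique for admissible parameters),
and it equals `1` otherwise. -/
def coefficient (φ : ℝ → ℝ) (τ δ : ℕ → ℝ) (n : ℕ → ℕ) (t : ℝ) : ℝ :=
  if h : ∃ k, 1 ≤ k ∧ t ∈ Icc (τ k) (τ k + δ k) then
    1 + periodisation φ ((n h.choose : ℝ) / δ h.choose * (t - τ h.choose))
  else 1

/-- The space `ℝᵈ`. -/
abbrev Space (d : ℕ) : Type := EuclideanSpace ℝ (Fin d)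

/-- The energy `½ ∫ (|∇f|² + |g|²) dx` of a state with displacement `f` and velocity `g`. -/
def energy {d : ℕ} (f g : 𝓢(Space d, ℂ)) : ℝ :=
  (1 / 2) * ∫ x, ((∑ j, ‖(∂_{(EuclideanSpace.single j 1 : Space d)} f) x‖ ^ 2) + ‖g x‖ ^ 2)

/-- `u`, with time derivative `v = u_t`, solves `u_tt - a(t)² Δu = 0` for `t ≥ 0` with
`u(0) = u₀`, `u_t(0) = u₁`, as a twice differentiable curve in the Schwartz space. (For
Schwartz data and smooth positive `a` this is the unique classical solution.) -/
structure IsWaveSolution {d : ℕ} (a : ℝ → ℝ) (u₀ u₁ : 𝓢(Space d, ℂ))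
    (u v : ℝ → 𝓢(Space d, ℂ)) : Prop where
  init_pos : u 0 = u₀
  init_vel : v 0 = u₁
  deriv_pos : ∀ t, 0 ≤ t → HasDerivWithinAt u (v t) (Ici 0) t
  deriv_vel : ∀ t, 0 ≤ t → HasDerivWithinAt v ((a t ^ 2) • Δ (u t)) (Ici 0) t

/-- On the `k`-th interval the coefficient is given by the `k`-th rescaled oscillation. -/
theorem coefficient_of_mem {φ : ℝ → ℝ} {τ δ : ℕ → ℝ} {n : ℕ → ℕ} (h : IsAdmissible τ δ n)
    {k : ℕ} (hk : 1 ≤ k) {t : ℝ} (ht : t ∈ Icc (τ k) (τ k + δ k)) :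
    coefficient φ τ δ n t = 1 + periodisation φ ((n k : ℝ) / δ k * (t - τ k)) := by
  have hlt : ∀ i, 1 ≤ i → ∀ m, τ i + δ i < τ (i + 1 + m) := by
    intro i hi m
    induction m with
    | zero => exact h.separated i hi
    | succ m ih =>
      have h1 := h.separated (i + 1 + m) (by omega)
      have h2 := h.length_pos (i + 1 + m) (by omega)
      have h3 : τ (i + 1 + (m + 1)) = τ (i + 1 + m + 1) := rfl
      linarith
  have hdis : ∀ i j, 1 ≤ i → i < j → t ∈ Icc (τ i) (τ i + δ i) →
      t ∈ Icc (τ j) (τ j + δ j) → False := by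
    intro i j hi hij h1 h2
    obtain ⟨m, rfl⟩ := Nat.exists_eq_add_of_le (Nat.succ_le_of_lt hij)
    have h3 := hlt i hi m
    have h4 := h1.2
    have h5 := h2.1
    simp only [Nat.succ_eq_add_one] at h5
    linarith
  have hex : ∃ k, 1 ≤ k ∧ t ∈ Icc (τ k) (τ k + δ k) := ⟨k, hk, ht⟩
  have hc : hex.choose = k := by
    rcases lt_trichotomy hex.choose k with hl | he | hg
    · exact (hdis _ _ hex.choose_spec.1 hl hex.choose_spec.2 ht).elim
    · exact he
    · exact (hdis _ _ hk hg ht hex.choose_spec.2).elim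
  unfold coefficient
  rw [dif_pos hex, hc]

end

/-! The Fourier transform splits the equation into oscillators `w'' = -ρ² a(t)² w` with `ρ = 2π‖ξ‖`.
On `I_k`, after rescaling time by `n_k / δ_k`, this becomes Hill's equation `w'' = -l² (1 + b)² w`
over exactly `n_k` periods, with `l = ρ δ_k / n_k`. Its monodromy matrix has determinant `1`; if its
trace `D(-l²)` exceeds `2` in modulus, there is a real eigenvalue `μ` with `|μ| > 1`, and suitable
data grow geometrically with the number of periods (parametric resonance).

The heart of the matter is that every nonconstant profile has an unstable `l`
(`exists_two_lt_abs_hillDiscriminant`). Suppose `|D(-l²)| ≤ 2` for all `l`. The function `D` is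
entire, and an energy estimate bounds `D(z²)` by a constant times `exp(L Re z)` in the right
half-plane, with `L = ∫₀¹ (1 + φ)`. The Phragmén–Lindelöf principle for `T_n(D(z²)/2) exp(-nLz)`,
with `T_n` the Chebyshev polynomials, followed by `n → ∞`, gives `D(y²) ≤ 2 cosh(Ly)`
(`le_two_cosh_of_bounded`). The power series gives `D(y²) ≥ 2 + y² ∫₀¹ (1 + φ)²`
(`le_hillDiscriminant`). As `y → 0` this forces `∫ (1 + φ)² ≤ (∫ (1 + φ))²`, the equality case of
Cauchy–Schwarz, so `1 + φ` is constant.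

Growth is an open condition: one fixed vector grows at a uniform rate for all `l` near the unstable
one (`exists_uniform_growth`), so a bump function in frequency can carry it. The vector is
prescribed at time `τ_k` and the solution is followed back to time `0`. The energy `ρ² a² w² + v²`
has logarithmic derivative at most `2|a'|/a` in modulus, so an earlier interval `I_ℓ` costs at most
`exp(2 c n_ℓ)` and the gaps cost nothing (`energy_zero_le`). Gain against loss is the lower bound in
(1); uniqueness transfers it to every solution.

For (2) put `X = σ^q`. Then `n_k` is comparable to `X^k`, and for large `X` the geometric sum of the
earlier losses is absorbed by the gain, so the growth exponent is at least `κ X^k`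
(`growth_exponent_ge_geometric`). The symbol estimates hold since derivatives of order `ℓ` on `I_k`
have size `(n_k / δ_k)^ℓ`. -/

/-! ### Power series in the spectral parameter for `w'' = z A w` -/

/-- The terms of the power series (in the parameter `z`) of the solution of `w'' = z A w` with
`w t₀ = x`, `w' t₀ = y`, together with their time derivatives. -/
noncomputable def odeTerm (A : ℝ → ℝ) (t₀ x y : ℝ) : ℕ → (ℝ → ℝ) × (ℝ → ℝ)
  | 0 => (fun t => x + y * (t - t₀), fun _ => y)
  | k + 1 => (fun t => ∫ s in t₀..t, ∫ r in t₀..s, A r * (odeTerm A t₀ x y k).1 r,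
      fun s => ∫ r in t₀..s, A r * (odeTerm A t₀ x y k).1 r)

/-- The second time derivatives of the terms `odeTerm`. -/
noncomputable def odeTermDeriv (A : ℝ → ℝ) (t₀ x y : ℝ) : ℕ → ℝ → ℝ
  | 0 => fun _ => 0
  | k + 1 => fun t => A t * (odeTerm A t₀ x y k).1 t

section OdeTerm

variable {A : ℝ → ℝ} {t₀ x y : ℝ}

theorem continuous_odeTerm_fst (hA : Continuous A) (k : ℕ) :
    Continuous (odeTerm A t₀ x y k).1 := by
  induction k with
  | zero => simp only [odeTerm]; fun_prop
  | succ k ih =>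
    have h1 : Continuous fun s => ∫ r in t₀..s, A r * (odeTerm A t₀ x y k).1 r :=
      intervalIntegral.continuous_primitive (fun a b => (hA.mul ih).intervalIntegrable a b) t₀
    exact intervalIntegral.continuous_primitive (fun a b => h1.intervalIntegrable a b) t₀

theorem hasDerivAt_odeTerm_snd (hA : Continuous A) (k : ℕ) (t : ℝ) :
    HasDerivAt (odeTerm A t₀ x y k).2 (odeTermDeriv A t₀ x y k t) t := by
  cases k with
  | zero => simpa [odeTerm, odeTermDeriv] using hasDerivAt_const t y
  | succ k =>
    have hc : Continuous fun r => A r * (odeTerm A t₀ x y k).1 r :=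
      hA.mul (continuous_odeTerm_fst hA k)
    exact hc.integral_hasStrictDerivAt t₀ t |>.hasDerivAt

theorem continuous_odeTerm_snd (hA : Continuous A) (k : ℕ) :
    Continuous (odeTerm A t₀ x y k).2 :=
  continuous_iff_continuousAt.2 fun t => (hasDerivAt_odeTerm_snd hA k t).continuousAt

theorem hasDerivAt_odeTerm_fst (hA : Continuous A) (k : ℕ) (t : ℝ) :
    HasDerivAt (odeTerm A t₀ x y k).1 ((odeTerm A t₀ x y k).2 t) t := by
  cases k with
  | zero =>
    simp only [odeTerm]
    simpa using (((hasDerivAt_id t).sub_const t₀).const_mul y).const_add x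
  | succ k =>
    exact (continuous_odeTerm_snd (t₀ := t₀) (x := x) (y := y) hA (k + 1)).integral_hasStrictDerivAt
      t₀ t |>.hasDerivAt

theorem abs_integral_le_of_abs_le_pow {f : ℝ → ℝ} (hf : Continuous f) {C T : ℝ} {k : ℕ}
    (h : ∀ s, |s - t₀| ≤ T → |f s| ≤ C * |s - t₀| ^ k) {t : ℝ} (ht : |t - t₀| ≤ T) :
    |∫ s in t₀..t, f s| ≤ C * (|t - t₀| ^ (k + 1) / (k + 1)) := by
  have h1 : |∫ s in t₀..t, f s| ≤ ∫ s in Set.uIoc t₀ t, ‖f s‖ := by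
    rw [← Real.norm_eq_abs]
    exact intervalIntegral.norm_integral_le_integral_norm_uIoc
  refine h1.trans ?_
  rw [← integral_pow_abs_sub_uIoc, ← MeasureTheory.integral_const_mul]
  refine MeasureTheory.setIntegral_mono_on ?_ ?_ measurableSet_uIoc fun s hs => ?_
  · exact (hf.norm.intervalIntegrable t₀ t).def'
  · exact (Continuous.intervalIntegrable (by fun_prop) t₀ t).def'
  · refine h s (le_trans ?_ ht)
    have := Set.abs_sub_left_of_mem_uIcc (uIoc_subset_uIcc hs)
    simpa [abs_sub_comm] using this

/-- Each step integrates twice, but only the inner integration is exploited for the factorial; the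
outer one is bounded by the length `T`. A single `k!` already makes the series converge for every
`z`. -/
theorem abs_odeTerm_le (hA : Continuous A) {K T B : ℝ} (hK : ∀ t, |A t| ≤ K) (hT : 0 ≤ T)
    (hB : |x| + |y| * T ≤ B) (k : ℕ) {t : ℝ} (ht : |t - t₀| ≤ T) :
    |(odeTerm A t₀ x y k).1 t| ≤ B * (T * K) ^ k / k.factorial * |t - t₀| ^ k ∧
    |(odeTerm A t₀ x y (k + 1)).2 t| ≤
      K * (B * (T * K) ^ k / k.factorial) * (|t - t₀| ^ (k + 1) / (k + 1)) := by
  have hK0 : 0 ≤ K := (abs_nonneg _).trans (hK 0)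
  have hB0 : 0 ≤ B := le_trans (by positivity) hB
  have step : ∀ k : ℕ, (∀ s, |s - t₀| ≤ T → |(odeTerm A t₀ x y k).1 s| ≤
      B * (T * K) ^ k / k.factorial * |s - t₀| ^ k) → ∀ s, |s - t₀| ≤ T →
      |(odeTerm A t₀ x y (k + 1)).2 s| ≤
      K * (B * (T * K) ^ k / k.factorial) * (|s - t₀| ^ (k + 1) / (k + 1)) := by
    intro k ih s hs
    refine abs_integral_le_of_abs_le_pow (hA.mul (continuous_odeTerm_fst hA k)) ?_ hs
    intro r hr
    rw [Pi.mul_apply, abs_mul, mul_assoc]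
    exact mul_le_mul (hK r) (ih r hr) (abs_nonneg _) hK0
  have main : ∀ k : ℕ, ∀ s, |s - t₀| ≤ T → |(odeTerm A t₀ x y k).1 s| ≤
      B * (T * K) ^ k / k.factorial * |s - t₀| ^ k := by
    intro k
    induction k with
    | zero =>
      intro s hs
      simp only [odeTerm, pow_zero, Nat.factorial_zero, Nat.cast_one, div_one, mul_one]
      refine (abs_add_le _ _).trans (le_trans ?_ hB)
      rw [abs_mul]
      gcongr
    | succ k ih =>
      intro s hs
      have h1 := abs_integral_le_of_abs_le_pow (t₀ := t₀) (k := 0) (T := |s - t₀|)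
        (C := K * (B * (T * K) ^ k / k.factorial) * (|s - t₀| ^ (k + 1) / (k + 1)))
        (continuous_odeTerm_snd (t₀ := t₀) (x := x) (y := y) hA (k + 1)) (t := s) (fun r hr => by
          refine (step k ih r (hr.trans hs)).trans ?_
          rw [pow_zero, mul_one]
          gcongr) le_rfl
      refine h1.trans ?_
      have e1 : K * (B * (T * K) ^ k / k.factorial) * (|s - t₀| ^ (k + 1) / (k + 1)) *
          (|s - t₀| ^ (0 + 1) / ((0 : ℕ) + 1)) =
          (B * (T * K) ^ k * K / (k + 1).factorial * |s - t₀| ^ (k + 1)) * |s - t₀| := by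
        rw [Nat.factorial_succ]; push_cast; field_simp; ring
      have e2 : B * (T * K) ^ (k + 1) / (k + 1).factorial * |s - t₀| ^ (k + 1) =
          (B * (T * K) ^ k * K / (k + 1).factorial * |s - t₀| ^ (k + 1)) * T := by
        ring
      rw [e1, e2]
      gcongr
  exact ⟨main k t ht, step k (main k) t ht⟩

/-- One majorant for the terms and their first two time derivatives, uniform on a time interval. It
serves both the scalar series and the Schwartz-valued series. -/
theorem exists_odeTerm_bound (hA : Continuous A) {K : ℝ} (hK : ∀ t, |A t| ≤ K) (x y t₀ T : ℝ) :
    ∃ C M : ℝ, 0 ≤ C ∧ 0 ≤ M ∧ ∀ k t, |t - t₀| ≤ T →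
      |(odeTerm A t₀ x y k).1 t| ≤ C * (M ^ k / k.factorial) ∧
      |(odeTerm A t₀ x y k).2 t| ≤ C * (M ^ k / k.factorial) ∧
      |odeTermDeriv A t₀ x y k t| ≤ C * (M ^ k / k.factorial) := by
  rcases lt_or_ge T 0 with hT | hT
  · exact ⟨0, 0, le_rfl, le_rfl, fun k t ht => absurd (abs_nonneg (t - t₀)) (by linarith)⟩
  have hK0 : 0 ≤ K := (abs_nonneg _).trans (hK 0)
  set B := |x| + |y| * T with hB
  have hB0 : 0 ≤ B := by positivity
  have hM : T * K * T ≤ 2 * (T * K * T + 1) := by nlinarith [mul_nonneg (mul_nonneg hT hK0) hT]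
  have hM1 : 1 ≤ 2 * (T * K * T + 1) := by nlinarith [mul_nonneg (mul_nonneg hT hK0) hT]
  -- The second derivative of term `k + 1` involves term `k`, so it lacks a factor `1 / (k + 1)`.
  -- The `2` in `M` pays for it through `k + 1 ≤ 2 ^ (k + 1)`; the `+ 1` lets powers be raised.
  set M := 2 * (T * K * T + 1) with hMdef
  have hM0 : 0 ≤ M := by linarith
  have hTKT : 0 ≤ T * K * T := by positivity
  refine ⟨B + |y| + K * B * T + K * B, M, by positivity, hM0, fun k t ht => ?_⟩
  have hfac : ∀ k t, |t - t₀| ≤ T → |(odeTerm A t₀ x y k).1 t| ≤ B * ((T * K * T) ^ k / k.factorial)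
      := fun k t ht => by
    refine (abs_odeTerm_le hA hK hT hB.symm.le k ht).1.trans ?_
    calc B * (T * K) ^ k / k.factorial * |t - t₀| ^ k ≤ B * (T * K) ^ k / k.factorial * T ^ k := by
          gcongr
      _ = _ := by rw [mul_pow (T * K)]; ring
  refine ⟨?_, ?_, ?_⟩
  · refine (hfac k t ht).trans ?_
    gcongr
    have : 0 ≤ |y| + K * B * T + K * B := by positivity
    linarith
  · cases k with
    | zero =>
      simp only [odeTerm, pow_zero, Nat.factorial_zero, Nat.cast_one, div_one, mul_one]
      have : 0 ≤ B + K * B * T + K * B := by positivity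
      linarith
    | succ k =>
      refine (abs_odeTerm_le hA hK hT hB.symm.le k ht).2.trans ?_
      calc K * (B * (T * K) ^ k / k.factorial) * (|t - t₀| ^ (k + 1) / (k + 1))
          ≤ K * (B * (T * K) ^ k / k.factorial) * (T ^ (k + 1) / (k + 1)) := by gcongr
        _ = K * B * T * ((T * K * T) ^ k / (k + 1).factorial) := by
          rw [mul_pow (T * K), Nat.factorial_succ]; push_cast; field_simp; ring
        _ ≤ (B + |y| + K * B * T + K * B) * (M ^ (k + 1) / (k + 1).factorial) := by
          have h2 : (T * K * T) ^ k ≤ M ^ (k + 1) :=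
            (pow_le_pow_left₀ hTKT hM k).trans (pow_le_pow_right₀ hM1 (Nat.le_succ k))
          gcongr
          have : 0 ≤ B + |y| + K * B := by positivity
          linarith
  · cases k with
    | zero =>
      simp only [odeTermDeriv, abs_zero]
      positivity
    | succ k =>
      simp only [odeTermDeriv, abs_mul]
      calc |A t| * |(odeTerm A t₀ x y k).1 t| ≤ K * (B * ((T * K * T) ^ k / k.factorial)) :=
            mul_le_mul (hK t) (hfac k t ht) (abs_nonneg _) hK0
        _ = K * B * ((k + 1 : ℕ) * (T * K * T) ^ k / (k + 1).factorial) := by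
          rw [Nat.factorial_succ]; push_cast; field_simp
        _ ≤ (B + |y| + K * B * T + K * B) * (M ^ (k + 1) / (k + 1).factorial) := by
          have h2 : ((k + 1 : ℕ) : ℝ) * (T * K * T) ^ k ≤ M ^ (k + 1) := by
            have h3 : ((k + 1 : ℕ) : ℝ) ≤ 2 ^ (k + 1) := by
              exact_mod_cast (Nat.lt_two_pow_self (n := k + 1)).le
            have h4 : (T * K * T) ^ k ≤ (T * K * T + 1) ^ (k + 1) :=
              (pow_le_pow_left₀ hTKT (by linarith) k).trans
                (pow_le_pow_right₀ (by linarith) (Nat.le_succ k))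
            calc _ ≤ 2 ^ (k + 1) * (T * K * T + 1) ^ (k + 1) := by gcongr
              _ = _ := by rw [hMdef, mul_pow]
          gcongr
          have : 0 ≤ B + |y| + K * B * T := by positivity
          linarith

end OdeTerm

/-! ### The summed solution: derivatives, dependence on the parameter, uniqueness -/

/-- The solution of `w'' = z A w`, `w t₀ = x`, `w' t₀ = y`, as a power series in `z`. -/
noncomputable def odeSol {𝕜 : Type*} [RCLike 𝕜] (A : ℝ → ℝ) (t₀ x y : ℝ) (z : 𝕜) (t : ℝ) : 𝕜 :=
  ∑' k, (((odeTerm A t₀ x y k).1 t : ℝ) : 𝕜) * z ^ k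

/-- The time derivative of `odeSol`. -/
noncomputable def odeSolDeriv {𝕜 : Type*} [RCLike 𝕜] (A : ℝ → ℝ) (t₀ x y : ℝ) (z : 𝕜) (t : ℝ) :
    𝕜 :=
  ∑' k, (((odeTerm A t₀ x y k).2 t : ℝ) : 𝕜) * z ^ k

section OdeSol

variable {𝕜 : Type*} [RCLike 𝕜] {A : ℝ → ℝ} {t₀ x y : ℝ}

theorem norm_ofReal_mul_pow_le {c C M R : ℝ} {z : 𝕜} {k : ℕ} (hc : |c| ≤ C * (M ^ k / k.factorial))
    (hz : ‖z‖ ≤ R) : ‖((c : ℝ) : 𝕜) * z ^ k‖ ≤ C * ((M * R) ^ k / k.factorial) := by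
  rw [norm_mul, norm_pow, RCLike.norm_ofReal, mul_pow, mul_div_right_comm, ← mul_assoc]
  have h0 : 0 ≤ C * (M ^ k / k.factorial) := (abs_nonneg c).trans hc
  exact mul_le_mul hc (pow_le_pow_left₀ (norm_nonneg z) hz k) (by positivity) h0

theorem summable_const_mul_pow_div_factorial (C M : ℝ) :
    Summable fun k : ℕ => C * (M ^ k / k.factorial) :=
  (Real.summable_pow_div_factorial M).mul_left C

theorem summable_odeTerm_fst (hA : Continuous A) {K : ℝ} (hK : ∀ t, |A t| ≤ K) (z : 𝕜) (t : ℝ) :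
    Summable fun k => (((odeTerm A t₀ x y k).1 t : ℝ) : 𝕜) * z ^ k := by
  obtain ⟨C, M, -, -, h⟩ := exists_odeTerm_bound hA hK x y t₀ |t - t₀|
  exact .of_norm_bounded (summable_const_mul_pow_div_factorial C (M * ‖z‖))
    fun k => norm_ofReal_mul_pow_le (h k t le_rfl).1 le_rfl

theorem summable_odeTerm_snd (hA : Continuous A) {K : ℝ} (hK : ∀ t, |A t| ≤ K) (z : 𝕜) (t : ℝ) :
    Summable fun k => (((odeTerm A t₀ x y k).2 t : ℝ) : 𝕜) * z ^ k := by
  obtain ⟨C, M, -, -, h⟩ := exists_odeTerm_bound hA hK x y t₀ |t - t₀|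
  exact .of_norm_bounded (summable_const_mul_pow_div_factorial C (M * ‖z‖))
    fun k => norm_ofReal_mul_pow_le (h k t le_rfl).2.1 le_rfl

theorem summable_odeTermDeriv (hA : Continuous A) {K : ℝ} (hK : ∀ t, |A t| ≤ K) (z : 𝕜) (t : ℝ) :
    Summable fun k => ((odeTermDeriv A t₀ x y k t : ℝ) : 𝕜) * z ^ k := by
  obtain ⟨C, M, -, -, h⟩ := exists_odeTerm_bound hA hK x y t₀ |t - t₀|
  exact .of_norm_bounded (summable_const_mul_pow_div_factorial C (M * ‖z‖))
    fun k => norm_ofReal_mul_pow_le (h k t le_rfl).2.2 le_rfl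

theorem hasDerivAt_ofReal_mul_const {f : ℝ → ℝ} {f' t : ℝ} (hf : HasDerivAt f f' t) (c : 𝕜) :
    HasDerivAt (fun s => ((f s : ℝ) : 𝕜) * c) ((f' : 𝕜) * c) t := by
  have := (RCLike.ofRealCLM (K := 𝕜)).hasFDerivAt.comp_hasDerivAt t hf
  exact HasDerivAt.mul_const this c

theorem hasDerivAt_odeSol (hA : Continuous A) {K : ℝ} (hK : ∀ t, |A t| ≤ K) (z : 𝕜) (t : ℝ) :
    HasDerivAt (odeSol A t₀ x y z) (odeSolDeriv A t₀ x y z t) t := by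
  obtain ⟨C, M, -, -, h⟩ := exists_odeTerm_bound hA hK x y t₀ (|t - t₀| + 1)
  have ht : t ∈ Metric.ball t₀ (|t - t₀| + 1) := by
    rw [Metric.mem_ball, Real.dist_eq]; linarith
  refine hasDerivAt_tsum_of_isPreconnected (summable_const_mul_pow_div_factorial C (M * ‖z‖))
    Metric.isOpen_ball (convex_ball t₀ (|t - t₀| + 1)).isPreconnected
    (fun k s _ => hasDerivAt_ofReal_mul_const (hasDerivAt_odeTerm_fst hA k s) (z ^ k))
    (fun k s hs => norm_ofReal_mul_pow_le (h k s ?_).2.1 le_rfl) ht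
    (summable_odeTerm_fst hA hK z t) ht
  rw [Metric.mem_ball, Real.dist_eq] at hs
  exact hs.le

theorem hasDerivAt_odeSolDeriv (hA : Continuous A) {K : ℝ} (hK : ∀ t, |A t| ≤ K) (z : 𝕜) (t : ℝ) :
    HasDerivAt (odeSolDeriv A t₀ x y z) (z * ((A t : ℝ) : 𝕜) * odeSol A t₀ x y z t) t := by
  obtain ⟨C, M, -, -, h⟩ := exists_odeTerm_bound hA hK x y t₀ (|t - t₀| + 1)
  have ht : t ∈ Metric.ball t₀ (|t - t₀| + 1) := by
    rw [Metric.mem_ball, Real.dist_eq]; linarith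
  have key : z * ((A t : ℝ) : 𝕜) * odeSol A t₀ x y z t =
      ∑' k, ((odeTermDeriv A t₀ x y k t : ℝ) : 𝕜) * z ^ k := by
    rw [(summable_odeTermDeriv hA hK z t).tsum_eq_zero_add, odeSol, ← tsum_mul_left]
    simp only [odeTermDeriv, RCLike.ofReal_zero, zero_mul, zero_add, RCLike.ofReal_mul, pow_succ]
    exact tsum_congr fun k => by ring
  rw [key]
  refine hasDerivAt_tsum_of_isPreconnected (summable_const_mul_pow_div_factorial C (M * ‖z‖))
    Metric.isOpen_ball (convex_ball t₀ (|t - t₀| + 1)).isPreconnected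
    (fun k s _ => hasDerivAt_ofReal_mul_const (hasDerivAt_odeTerm_snd hA k s) (z ^ k))
    (fun k s hs => norm_ofReal_mul_pow_le (h k s ?_).2.2 le_rfl) ht
    (summable_odeTerm_snd hA hK z t) ht
  rw [Metric.mem_ball, Real.dist_eq] at hs
  exact hs.le

theorem odeTerm_fst_self (k : ℕ) : (odeTerm A t₀ x y (k + 1)).1 t₀ = 0 := by simp [odeTerm]

theorem odeTerm_snd_self (k : ℕ) : (odeTerm A t₀ x y (k + 1)).2 t₀ = 0 := by simp [odeTerm]

theorem odeSol_self (z : 𝕜) : odeSol A t₀ x y z t₀ = (x : 𝕜) := by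
  rw [odeSol, tsum_eq_single 0]
  · simp [odeTerm]
  · rintro (_ | k) hk
    · exact absurd rfl hk
    · simp [odeTerm_fst_self]

theorem odeSolDeriv_self (z : 𝕜) : odeSolDeriv A t₀ x y z t₀ = (y : 𝕜) := by
  rw [odeSolDeriv, tsum_eq_single 0]
  · simp [odeTerm]
  · rintro (_ | k) hk
    · exact absurd rfl hk
    · simp [odeTerm_snd_self]

theorem ofReal_odeSol (z t : ℝ) :
    ((odeSol A t₀ x y z t : ℝ) : 𝕜) = odeSol A t₀ x y (z : 𝕜) t := by
  simp only [odeSol, RCLike.ofReal_tsum]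
  simp

theorem ofReal_odeSolDeriv (z t : ℝ) :
    ((odeSolDeriv A t₀ x y z t : ℝ) : 𝕜) = odeSolDeriv A t₀ x y (z : 𝕜) t := by
  simp only [odeSolDeriv, RCLike.ofReal_tsum]
  simp

/-- The terms are monomials in `z` with a summable majorant on every ball, so the sum is entire.
This is what makes Phragmén–Lindelöf applicable to the discriminant. -/
theorem differentiable_odeSol (hA : Continuous A) {K : ℝ} (hK : ∀ t, |A t| ≤ K) (t : ℝ) :
    Differentiable ℂ fun z : ℂ => odeSol A t₀ x y z t := by
  intro z
  obtain ⟨C, M, -, -, h⟩ := exists_odeTerm_bound hA hK x y t₀ |t - t₀|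
  refine (Complex.differentiableOn_tsum_of_summable_norm (U := Metric.ball 0 (‖z‖ + 1))
    (summable_const_mul_pow_div_factorial C (M * (‖z‖ + 1)))
    (fun k => by fun_prop) Metric.isOpen_ball
    (fun k w hw => norm_ofReal_mul_pow_le (h k t le_rfl).1 ?_)).differentiableAt
    (Metric.isOpen_ball.mem_nhds ?_)
  · exact (mem_ball_zero_iff.1 hw).le
  · rw [mem_ball_zero_iff]; linarith

theorem differentiable_odeSolDeriv (hA : Continuous A) {K : ℝ} (hK : ∀ t, |A t| ≤ K) (t : ℝ) :
    Differentiable ℂ fun z : ℂ => odeSolDeriv A t₀ x y z t := by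
  intro z
  obtain ⟨C, M, -, -, h⟩ := exists_odeTerm_bound hA hK x y t₀ |t - t₀|
  refine (Complex.differentiableOn_tsum_of_summable_norm (U := Metric.ball 0 (‖z‖ + 1))
    (summable_const_mul_pow_div_factorial C (M * (‖z‖ + 1)))
    (fun k => by fun_prop) Metric.isOpen_ball
    (fun k w hw => norm_ofReal_mul_pow_le (h k t le_rfl).2.1 ?_)).differentiableAt
    (Metric.isOpen_ball.mem_nhds ?_)
  · exact (mem_ball_zero_iff.1 hw).le
  · rw [mem_ball_zero_iff]; linarith

theorem continuous_odeSol_param (hA : Continuous A) {K : ℝ} (hK : ∀ t, |A t| ≤ K) (t : ℝ) :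
    Continuous fun z : ℝ => odeSol A t₀ x y z t := by
  have h : (fun z : ℝ => odeSol A t₀ x y z t) =
      fun z : ℝ => (odeSol A t₀ x y (z : ℂ) t).re := by
    ext z
    have := ofReal_odeSol (𝕜 := ℂ) (A := A) (t₀ := t₀) (x := x) (y := y) z t
    exact (congrArg Complex.re this)
  rw [h]
  exact Complex.continuous_re.comp ((differentiable_odeSol hA hK t).continuous.comp
    Complex.continuous_ofReal)

theorem continuous_odeSolDeriv_param (hA : Continuous A) {K : ℝ} (hK : ∀ t, |A t| ≤ K) (t : ℝ) :
    Continuous fun z : ℝ => odeSolDeriv A t₀ x y z t := by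
  have h : (fun z : ℝ => odeSolDeriv A t₀ x y z t) =
      fun z : ℝ => (odeSolDeriv A t₀ x y (z : ℂ) t).re := by
    ext z
    have := ofReal_odeSolDeriv (𝕜 := ℂ) (A := A) (t₀ := t₀) (x := x) (y := y) z t
    exact (congrArg Complex.re this)
  rw [h]
  exact Complex.continuous_re.comp ((differentiable_odeSolDeriv hA hK t).continuous.comp
    Complex.continuous_ofReal)

/-- Uniqueness for the linear equation `w'' = c(t) w` with bounded coefficient. -/
theorem second_order_ode_unique {F : Type*} [NormedAddCommGroup F] [NormedSpace ℝ F]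
    {c : ℝ → ℝ} {K : ℝ} (hK : ∀ t, |c t| ≤ K) {a b : ℝ} {w₁ v₁ w₂ v₂ : ℝ → F}
    (hw₁ : ∀ t ∈ Icc a b, HasDerivWithinAt w₁ (v₁ t) (Icc a b) t)
    (hv₁ : ∀ t ∈ Icc a b, HasDerivWithinAt v₁ (c t • w₁ t) (Icc a b) t)
    (hw₂ : ∀ t ∈ Icc a b, HasDerivWithinAt w₂ (v₂ t) (Icc a b) t)
    (hv₂ : ∀ t ∈ Icc a b, HasDerivWithinAt v₂ (c t • w₂ t) (Icc a b) t)
    (h0 : w₁ a = w₂ a) (h1 : v₁ a = v₂ a) {t : ℝ} (ht : t ∈ Icc a b) :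
    w₁ t = w₂ t ∧ v₁ t = v₂ t := by
  have hL : ∀ t, LipschitzWith (max 1 K).toNNReal fun p : F × F => (p.2, c t • p.1) := by
    intro t
    refine LipschitzWith.of_dist_le_mul fun p q => ?_
    rw [Real.coe_toNNReal _ (le_trans zero_le_one (le_max_left 1 K)), Prod.dist_eq, Prod.dist_eq]
    have hd1 : dist p.1 q.1 ≤ max (dist p.1 q.1) (dist p.2 q.2) := le_max_left _ _
    have hd2 : dist p.2 q.2 ≤ max (dist p.1 q.1) (dist p.2 q.2) := le_max_right _ _
    have hd0 : 0 ≤ max (dist p.1 q.1) (dist p.2 q.2) := dist_nonneg.trans hd1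
    refine max_le ?_ ?_
    · exact hd2.trans (le_mul_of_one_le_left hd0 (le_max_left 1 K))
    · rw [dist_smul₀, Real.norm_eq_abs]
      exact mul_le_mul ((hK t).trans (le_max_right 1 K)) hd1 dist_nonneg
        (le_trans zero_le_one (le_max_left 1 K))
  have hIci : ∀ {w : ℝ → F} {w' : F} {s : ℝ}, s ∈ Ico a b →
      HasDerivWithinAt w w' (Icc a b) s → HasDerivWithinAt w w' (Ici s) s := fun hs h =>
    h.mono_of_mem_nhdsWithin (mem_of_superset (Icc_mem_nhdsGE hs.2) (Icc_subset_Icc_left hs.1))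
  have key := ODE_solution_unique (v := fun t (p : F × F) => (p.2, c t • p.1))
    (f := fun t => (w₁ t, v₁ t)) (g := fun t => (w₂ t, v₂ t)) hL
    (fun s hs => ((hw₁ s hs).continuousWithinAt.prodMk (hv₁ s hs).continuousWithinAt))
    (fun s hs => (hIci hs (hw₁ s (Ico_subset_Icc_self hs))).prodMk
      (hIci hs (hv₁ s (Ico_subset_Icc_self hs))))
    (fun s hs => ((hw₂ s hs).continuousWithinAt.prodMk (hv₂ s hs).continuousWithinAt))
    (fun s hs => (hIci hs (hw₂ s (Ico_subset_Icc_self hs))).prodMk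
      (hIci hs (hv₂ s (Ico_subset_Icc_self hs))))
    (by simp [h0, h1]) ht
  exact Prod.mk_inj.1 key

end OdeSol

/-! ### The Hill discriminant and existence of an instability interval -/

/-- Energy estimate for `w'' = z² a² w` with a complex parameter `z` in the right half-plane. -/
theorem complex_energy_le {a a' : ℝ → ℝ} (ha : ∀ t, HasDerivAt a (a' t) t) (hpos : ∀ t, 0 < a t)
    {c : ℝ} (hc : ∀ t, |a' t| ≤ c * a t) {z : ℂ} (hz : 0 ≤ z.re) {w v : ℝ → ℂ}
    (hw : ∀ t, HasDerivAt w (v t) t)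
    (hv : ∀ t, HasDerivAt v (z ^ 2 * ((a t ^ 2 : ℝ) : ℂ) * w t) t) {T : ℝ} (hT : 0 ≤ T) :
    ‖v T‖ ^ 2 + ‖z‖ ^ 2 * a T ^ 2 * ‖w T‖ ^ 2 ≤
      (‖v 0‖ ^ 2 + ‖z‖ ^ 2 * a 0 ^ 2 * ‖w 0‖ ^ 2) *
        Real.exp (2 * (z.re * ∫ s in (0 : ℝ)..T, a s) + 2 * c * T) := by
  have hac : Continuous a := continuous_iff_continuousAt.2 fun t => (ha t).continuousAt
  set E : ℝ → ℝ := fun t => ‖v t‖ ^ 2 + ‖z‖ ^ 2 * a t ^ 2 * ‖w t‖ ^ 2 with hE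
  set P : ℝ → ℝ := fun t => 2 * (z.re * ∫ s in (0 : ℝ)..t, a s) + 2 * c * t with hP
  have hPd : ∀ t, HasDerivAt P (2 * (z.re * a t) + 2 * c) t := fun t => by
    have h1 := ((hac.integral_hasStrictDerivAt 0 t).hasDerivAt.const_mul z.re).const_mul 2
    have h2 := (hasDerivAt_id t).const_mul (2 * c)
    have h3 := h1.add h2
    rw [mul_one] at h3
    exact h3
  set E' : ℝ → ℝ := fun t => 2 * inner ℝ (v t) (z ^ 2 * ((a t ^ 2 : ℝ) : ℂ) * w t) +
    (‖z‖ ^ 2 * (2 * a t * a' t) * ‖w t‖ ^ 2 + ‖z‖ ^ 2 * a t ^ 2 * (2 * inner ℝ (w t) (v t))) with hE'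
  have hEd : ∀ t, HasDerivAt E (E' t) t := fun t => by
    have h1 := (hv t).norm_sq
    have h2 := (hw t).norm_sq
    have h3 := (((ha t).pow 2).const_mul (‖z‖ ^ 2)).mul h2
    have h4 := h1.add h3
    refine HasDerivAt.congr_deriv (f := E) h4 ?_
    norm_num [E']
  have hle : ∀ t, E' t ≤ (2 * (z.re * a t) + 2 * c) * E t := fun t => by
    -- The two cross terms combine through `z² + |z|² = 2 (Re z) z`. Hence the growth rate involves
    -- `Re z` rather than `|z|`, which gives the sharp type `∫ a`.
    have hcross : inner ℝ (v t) (z ^ 2 * ((a t ^ 2 : ℝ) : ℂ) * w t) +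
        ‖z‖ ^ 2 * a t ^ 2 * inner ℝ (w t) (v t) ≤
        2 * z.re * a t ^ 2 * (‖z‖ * ‖v t‖ * ‖w t‖) := by
      have e1 : inner ℝ (v t) (z ^ 2 * ((a t ^ 2 : ℝ) : ℂ) * w t) +
          ‖z‖ ^ 2 * a t ^ 2 * inner ℝ (w t) (v t) =
          2 * z.re * a t ^ 2 * (z * (starRingEnd ℂ (v t)) * w t).re := by
        rw [Complex.inner, Complex.inner, ← Complex.normSq_eq_norm_sq, Complex.normSq_apply]
        simp [Complex.mul_re, Complex.mul_im, pow_two]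
        ring
      rw [e1]
      have h5 : (z * (starRingEnd ℂ (v t)) * w t).re ≤ ‖z‖ * ‖v t‖ * ‖w t‖ := by
        refine (Complex.re_le_norm _).trans_eq ?_
        rw [norm_mul, norm_mul, RCLike.norm_conj]
      have : 0 ≤ 2 * z.re * a t ^ 2 := by positivity
      exact mul_le_mul_of_nonneg_left h5 this
    have h6 : 2 * (a t * ‖z‖ * ‖w t‖) * ‖v t‖ ≤ (a t * ‖z‖ * ‖w t‖) ^ 2 + ‖v t‖ ^ 2 :=
      two_mul_le_add_sq _ _
    have h7 : 0 ≤ z.re * a t := mul_nonneg hz (hpos t).le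
    have h8 : a t * a' t ≤ c * a t ^ 2 := by
      have := mul_le_mul_of_nonneg_left ((le_abs_self _).trans (hc t)) (hpos t).le
      linarith [this]
    have h9 : 0 ≤ ‖z‖ ^ 2 * ‖w t‖ ^ 2 := by positivity
    have hc0 : 0 ≤ c := by
      have := (abs_nonneg _).trans (hc t)
      exact nonneg_of_mul_nonneg_left this (hpos t)
    have h10 : 0 ≤ c * ‖v t‖ ^ 2 := by positivity
    have h11 := mul_le_mul_of_nonneg_left h6 h7
    have h12 := mul_le_mul_of_nonneg_left h8 h9
    simp only [hE', hE]
    nlinarith [hcross, h11, h12, h10]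
  have hanti : Antitone fun t => E t * Real.exp (-P t) := by
    refine antitone_of_hasDerivAt_nonpos (f' := fun t =>
      E' t * Real.exp (-P t) + E t * (Real.exp (-P t) * -(2 * (z.re * a t) + 2 * c)))
      (fun t => (hEd t).mul (hPd t).neg.exp) fun t => ?_
    have := mul_le_mul_of_nonneg_right (hle t) (Real.exp_pos (-P t)).le
    simp only [Pi.zero_apply]
    linarith
  have h := hanti hT
  have hP0 : P 0 = 0 := by simp [hP]
  simp only [hP0, neg_zero, Real.exp_zero, mul_one] at h
  have h2 := mul_le_mul_of_nonneg_right h (Real.exp_pos (P T)).le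
  rwa [mul_assoc, ← Real.exp_add, neg_add_cancel, Real.exp_zero, mul_one] at h2

/-- The Hill discriminant (trace of the monodromy over `[0, 1]`) of `w'' = z A w`. -/
noncomputable def hillDiscriminant {𝕜 : Type*} [RCLike 𝕜] (A : ℝ → ℝ) (z : 𝕜) : 𝕜 :=
  odeSol A 0 1 0 z 1 + odeSolDeriv A 0 0 1 z 1

theorem hillDiscriminant_zero {𝕜 : Type*} [RCLike 𝕜] (A : ℝ → ℝ) :
    hillDiscriminant A (0 : 𝕜) = 2 := by
  rw [hillDiscriminant, odeSol, odeSolDeriv, tsum_eq_single 0, tsum_eq_single 0]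
  · simp [odeTerm]; norm_num
  · intro k hk; simp [hk]
  · intro k hk; simp [hk]

theorem ofReal_hillDiscriminant {𝕜 : Type*} [RCLike 𝕜] (A : ℝ → ℝ) (z : ℝ) :
    ((hillDiscriminant A z : ℝ) : 𝕜) = hillDiscriminant A (z : 𝕜) := by
  simp [hillDiscriminant, ofReal_odeSol, ofReal_odeSolDeriv]

/-- The two fundamental solutions start with energies `‖z‖²` and `1`. The position part of the first
estimate (after division by `‖z‖²`) and the velocity part of the second bound the two summands of
the trace. -/
theorem norm_hillDiscriminant_sq_le {a a' : ℝ → ℝ} (ha : ∀ t, HasDerivAt a (a' t) t)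
    (hpos : ∀ t, 0 < a t) {K : ℝ} (hK : ∀ t, |a t ^ 2| ≤ K) {c : ℝ} (hc : ∀ t, |a' t| ≤ c * a t)
    (ha0 : a 0 = 1) (ha1 : a 1 = 1) {z : ℂ} (hz : 0 ≤ z.re) :
    ‖hillDiscriminant (fun t => a t ^ 2) (z ^ 2)‖ ≤
      2 * (Real.exp c * Real.exp (z.re * ∫ s in (0 : ℝ)..1, a s)) := by
  have hac : Continuous a := continuous_iff_continuousAt.2 fun t => (ha t).continuousAt
  have hA : Continuous fun t => a t ^ 2 := hac.pow 2
  have hc0 : 0 ≤ c := by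
    have := (abs_nonneg _).trans (hc 0)
    exact nonneg_of_mul_nonneg_left this (hpos 0)
  have hL0 : 0 ≤ ∫ s in (0 : ℝ)..1, a s :=
    intervalIntegral.integral_nonneg zero_le_one fun s _ => (hpos s).le
  set L := ∫ s in (0 : ℝ)..1, a s
  rw [← Real.exp_add]
  rcases eq_or_ne z 0 with rfl | hz0
  · simp [hillDiscriminant_zero, hc0]
  have hzn : 0 < ‖z‖ := norm_pos_iff.2 hz0
  have hexp : Real.exp (2 * (z.re * L) + 2 * c * 1) = Real.exp (c + z.re * L) ^ 2 := by
    rw [← Real.exp_nat_mul]; congr 1; push_cast; ring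
  have e1 := complex_energy_le ha hpos hc hz
    (fun t => hasDerivAt_odeSol (t₀ := 0) (x := 1) (y := 0) hA hK (z ^ 2) t)
    (fun t => hasDerivAt_odeSolDeriv hA hK (z ^ 2) t) zero_le_one
  have e2 := complex_energy_le ha hpos hc hz
    (fun t => hasDerivAt_odeSol (t₀ := 0) (x := 0) (y := 1) hA hK (z ^ 2) t)
    (fun t => hasDerivAt_odeSolDeriv hA hK (z ^ 2) t) zero_le_one
  rw [odeSol_self, odeSolDeriv_self, ha0, ha1, hexp] at e1 e2
  simp only [RCLike.ofReal_zero, RCLike.ofReal_one, norm_zero, norm_one, one_pow, mul_one,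
    ne_eq, OfNat.ofNat_ne_zero, not_false_eq_true, zero_pow, zero_add, mul_zero, add_zero,
    one_mul] at e1 e2
  have h1 : ‖odeSol (fun t => a t ^ 2) 0 1 0 (z ^ 2) 1‖ ≤ Real.exp (c + z.re * L) := by
    have h : ‖z‖ ^ 2 * ‖odeSol (fun t => a t ^ 2) 0 1 0 (z ^ 2) 1‖ ^ 2 ≤
        ‖z‖ ^ 2 * Real.exp (c + z.re * L) ^ 2 := le_trans (by
      have := sq_nonneg ‖odeSolDeriv (fun t => a t ^ 2) 0 1 0 (z ^ 2) 1‖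
      linarith) e1
    have h' := le_of_mul_le_mul_left h (by positivity)
    exact (sq_le_sq₀ (norm_nonneg _) (Real.exp_pos _).le).1 h'
  have h2 : ‖odeSolDeriv (fun t => a t ^ 2) 0 0 1 (z ^ 2) 1‖ ≤ Real.exp (c + z.re * L) := by
    refine (sq_le_sq₀ (norm_nonneg _) (Real.exp_pos _).le).1 (le_trans ?_ e2)
    have : 0 ≤ ‖z‖ ^ 2 * ‖odeSol (fun t => a t ^ 2) 0 0 1 (z ^ 2) 1‖ ^ 2 := by positivity
    linarith
  rw [hillDiscriminant]
  exact (norm_add_le _ _).trans (by linarith)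

/-- A crude bound suffices: it only has to show that `T_n(F(z²)/2) exp(-nLz)` is bounded in the
half-plane for each `n`. The sharp bound `1` is needed only on the imaginary axis. -/
theorem norm_chebyshev_T_eval_le {B : ℝ} (hB : 1 ≤ B) {w : ℂ} (hw : ‖w‖ ≤ B) (n : ℕ) :
    ‖(Polynomial.Chebyshev.T ℂ n).eval w‖ ≤ (3 * B) ^ n := by
  induction n using Nat.twoStepInduction with
  | zero => simp
  | one => simp; linarith
  | more n h0 h1 =>
    have hrec : (Polynomial.Chebyshev.T ℂ ((n + 1 + 1 : ℕ) : ℤ)).eval w =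
        2 * w * (Polynomial.Chebyshev.T ℂ ((n + 1 : ℕ) : ℤ)).eval w -
          (Polynomial.Chebyshev.T ℂ ((n : ℕ) : ℤ)).eval w := by
      have := Polynomial.Chebyshev.T_add_two ℂ (n : ℤ)
      push_cast
      rw [show (n : ℤ) + 1 + 1 = n + 2 by ring, this]
      simp
    rw [hrec]
    have h2 : ‖2 * w * (Polynomial.Chebyshev.T ℂ ((n + 1 : ℕ) : ℤ)).eval w‖ ≤
        2 * B * (3 * B) ^ (n + 1) := by
      rw [norm_mul, norm_mul, Complex.norm_ofNat]
      gcongr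
    have h3 : (3 * B) ^ n ≤ B * (3 * B) ^ (n + 1) := by
      rw [pow_succ]
      have : 0 ≤ (3 * B) ^ n := by positivity
      nlinarith [mul_le_mul hB hB zero_le_one (by linarith : (0 : ℝ) ≤ B)]
    calc _ ≤ 2 * B * (3 * B) ^ (n + 1) + (3 * B) ^ n := (norm_sub_le _ _).trans (add_le_add h2 h0)
      _ ≤ 2 * B * (3 * B) ^ (n + 1) + B * (3 * B) ^ (n + 1) := by gcongr
      _ = _ := by ring

/-- An entire function of `z²` which is bounded by `2` on the imaginary axis and is of exponential
type `L` in the right half-plane grows at most like `2 cosh (L y)` on the positive real axis. -/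
theorem le_two_cosh_of_bounded {F : ℂ → ℂ} {f : ℝ → ℝ} (hF : Differentiable ℂ F)
    (hFf : ∀ x : ℝ, F x = f x) {K L : ℝ} (hK : 1 ≤ K) (hL : 0 ≤ L)
    (hgrow : ∀ z : ℂ, 0 ≤ z.re → ‖F (z ^ 2)‖ ≤ 2 * (K * Real.exp (z.re * L)))
    (hb : ∀ x : ℝ, |f (-x ^ 2)| ≤ 2) {y : ℝ} (hy : 0 ≤ y) (h2 : 2 ≤ f (y ^ 2)) :
    f (y ^ 2) ≤ 2 * Real.cosh (y * L) := by
  -- Phragmén–Lindelöf for `F(z²)` itself would give only `2 exp(yL)`, too weak for a comparison at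
  -- second order in `y`. Chebyshev polynomials preserve `[-1, 1]` and turn `cosh θ` into `cosh nθ`,
  -- so the constant disappears as `n → ∞`.
  have key : ∀ n : ℕ, |(Polynomial.Chebyshev.T ℝ n).eval (f (y ^ 2) / 2)| ≤
      Real.exp (n * (y * L)) := by
    intro n
    set g : ℂ → ℂ := fun z => (Polynomial.Chebyshev.T ℂ n).eval (F (z ^ 2) / 2) *
      Complex.exp (-(n * L : ℝ) * z) with hg
    have hgd : Differentiable ℂ g := by
      refine Differentiable.mul ?_ (by fun_prop)
      exact (Polynomial.differentiable _).comp
        ((hF.comp (differentiable_id.pow 2)).div_const 2)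
    have hgb : ∀ z : ℂ, 0 ≤ z.re → ‖g z‖ ≤ (3 * K) ^ n := by
      intro z hz
      have h1 : ‖F (z ^ 2) / 2‖ ≤ K * Real.exp (z.re * L) := by
        rw [norm_div, Complex.norm_ofNat]
        linarith [hgrow z hz]
      have h3 : 1 ≤ K * Real.exp (z.re * L) := one_le_mul_of_one_le_of_one_le hK
        (Real.one_le_exp (mul_nonneg hz hL))
      have h4 := norm_chebyshev_T_eval_le h3 h1 n
      have h5 : ‖Complex.exp (-(n * L : ℝ) * z)‖ = Real.exp (-(n * (z.re * L))) := by
        rw [Complex.norm_exp]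
        congr 1
        simp
        ring
      rw [hg, norm_mul, h5]
      refine (mul_le_mul_of_nonneg_right h4 (Real.exp_pos _).le).trans_eq ?_
      rw [← mul_assoc, mul_pow (3 * K), ← Real.exp_nat_mul, mul_assoc, ← Real.exp_add,
        add_neg_cancel, Real.exp_zero, mul_one]
    have hPL := PhragmenLindelof.right_half_plane_of_bounded_on_real (f := g) (C := 1)
      (z := (y : ℂ)) hgd.diffContOnCl ⟨1, by norm_num, 0, ?_⟩ ?_ ?_ (by simpa using hy)
    · have hval : g y = (((Polynomial.Chebyshev.T ℝ n).eval (f (y ^ 2) / 2) *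
          Real.exp (-(n * (y * L))) : ℝ) : ℂ) := by
        have e1 : F ((y : ℂ) ^ 2) / 2 = ((f (y ^ 2) / 2 : ℝ) : ℂ) := by
          rw [← Complex.ofReal_pow, hFf]; push_cast; rfl
        simp only [hg, e1]
        rw [← Polynomial.Chebyshev.complex_ofReal_eval_T]
        push_cast
        congr 2
        ring
      rw [hval, Complex.norm_real, Real.norm_eq_abs, abs_mul, Real.abs_exp, Real.exp_neg,
        ← div_eq_mul_inv, div_le_one (Real.exp_pos _)] at hPL
      exact hPL
    · refine Asymptotics.IsBigO.of_bound ((3 * K) ^ n) ?_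
      refine Filter.eventually_inf_principal.2 (Filter.Eventually.of_forall fun z hz => ?_)
      simpa using hgb z (le_of_lt hz)
    · refine Filter.isBoundedUnder_of_eventually_le (a := (3 * K) ^ n) ?_
      filter_upwards [eventually_ge_atTop 0] with x hx
      exact hgb x (by simpa using hx)
    · intro x
      have e1 : F (((x : ℂ) * Complex.I) ^ 2) / 2 = ((f (-x ^ 2) / 2 : ℝ) : ℂ) := by
        rw [mul_pow, Complex.I_sq, show (x : ℂ) ^ 2 * -1 = ((-x ^ 2 : ℝ) : ℂ) by push_cast; ring,
          hFf]
        push_cast; rfl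
      simp only [hg, e1]
      rw [← Polynomial.Chebyshev.complex_ofReal_eval_T, norm_mul, Complex.norm_real,
        Complex.norm_exp, Real.norm_eq_abs]
      have e2 : (-((n * L : ℝ) : ℂ) * (x * Complex.I)).re = 0 := by simp
      rw [e2, Real.exp_zero, mul_one]
      refine Polynomial.Chebyshev.abs_eval_T_real_le_one n ?_
      rw [abs_div, abs_two]
      linarith [hb x]
  obtain ⟨θ, hθ0, hθ⟩ : ∃ θ, 0 ≤ θ ∧ Real.cosh θ = f (y ^ 2) / 2 :=
    ⟨Real.arcosh (f (y ^ 2) / 2), Real.arcosh_nonneg (by linarith),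
      Real.cosh_arcosh (by linarith)⟩
  have hθL : θ ≤ y * L := by
    by_contra! hlt
    -- With `n (θ - yL) > log 2`, the bound `exp(nθ) / 2 ≤ cosh(nθ) ≤ exp(nyL)` is violated.
    obtain ⟨n, hn⟩ := exists_nat_gt (Real.log 2 / (θ - y * L))
    rw [div_lt_iff₀ (by linarith)] at hn
    have h3 := key n
    rw [← hθ] at h3
    have hT := Polynomial.Chebyshev.T_real_cosh θ n
    rw [hT, abs_of_pos (Real.cosh_pos _), Real.cosh_eq] at h3
    have h4 : Real.exp (n * θ) ≤ 2 * Real.exp (n * (y * L)) := by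
      have := Real.exp_pos (-((n : ℤ) * θ))
      push_cast at h3 this
      linarith
    have h5 : Real.exp (Real.log 2 + n * (y * L)) < Real.exp (n * θ) :=
      Real.exp_lt_exp.2 (by linarith)
    rw [Real.exp_add, Real.exp_log (by norm_num)] at h5
    linarith
  have : Real.cosh θ ≤ Real.cosh (y * L) := by
    rw [Real.cosh_le_cosh, abs_of_nonneg hθ0, abs_of_nonneg (mul_nonneg hy hL)]
    exact hθL
  linarith

theorem odeTerm_nonneg {A : ℝ → ℝ} (hA0 : ∀ t, 0 ≤ A t) {x y : ℝ} (hx : 0 ≤ x)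
    (hy : 0 ≤ y) (k : ℕ) {t : ℝ} (ht : 0 ≤ t) :
    0 ≤ (odeTerm A 0 x y k).1 t ∧ 0 ≤ (odeTerm A 0 x y k).2 t := by
  induction k generalizing t with
  | zero => simp only [odeTerm]; exact ⟨by nlinarith [mul_nonneg hy ht], hy⟩
  | succ k ih =>
    have h : ∀ s, 0 ≤ s → 0 ≤ (odeTerm A 0 x y (k + 1)).2 s := fun s hs =>
      intervalIntegral.integral_nonneg hs fun r hr => mul_nonneg (hA0 r) (ih hr.1).1
    exact ⟨intervalIntegral.integral_nonneg ht fun r hr => h r hr.1, h t ht⟩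

/-- For `ζ ≥ 0` all terms of the series are nonnegative, so it may be cut after the linear term. The
two linear coefficients add up to `∫ A` because their integrands form the derivative of `t ∫₀ᵗ A`.
-/
theorem le_hillDiscriminant {A : ℝ → ℝ} (hA : Continuous A) (hA0 : ∀ t, 0 ≤ A t) {K : ℝ}
    (hK : ∀ t, |A t| ≤ K) {ζ : ℝ} (hζ : 0 ≤ ζ) :
    2 + ζ * ∫ s in (0 : ℝ)..1, A s ≤ hillDiscriminant A ζ := by
  have s1 := summable_odeTerm_fst (𝕜 := ℝ) (t₀ := 0) (x := 1) (y := 0) hA hK ζ 1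
  have s2 := summable_odeTerm_snd (𝕜 := ℝ) (t₀ := 0) (x := 0) (y := 1) hA hK ζ 1
  have h1 := s1.sum_le_tsum (Finset.range 2) fun k _ =>
    mul_nonneg (odeTerm_nonneg hA0 zero_le_one le_rfl k zero_le_one).1 (pow_nonneg hζ k)
  have h2 := s2.sum_le_tsum (Finset.range 2) fun k _ =>
    mul_nonneg (odeTerm_nonneg hA0 le_rfl zero_le_one k zero_le_one).2 (pow_nonneg hζ k)
  have hP : Continuous fun s => ∫ r in (0 : ℝ)..s, A r :=
    intervalIntegral.continuous_primitive (fun a b => hA.intervalIntegrable a b) 0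
  have h3 : (∫ s in (0 : ℝ)..1, ∫ r in (0 : ℝ)..s, A r) + ∫ r in (0 : ℝ)..1, A r * r =
      ∫ s in (0 : ℝ)..1, A s := by
    rw [← intervalIntegral.integral_add (hP.intervalIntegrable 0 1)
      (Continuous.intervalIntegrable (by fun_prop) 0 1)]
    have h4 := intervalIntegral.integral_eq_sub_of_hasDerivAt (a := 0) (b := 1)
      (f := fun t => t * ∫ r in (0 : ℝ)..t, A r)
      (f' := fun t => 1 * (∫ r in (0 : ℝ)..t, A r) + t * A t)
      (fun t _ => (hasDerivAt_id t).mul (hA.integral_hasStrictDerivAt 0 t).hasDerivAt)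
      (Continuous.intervalIntegrable (by fun_prop) 0 1)
    simp only [one_mul, zero_mul, sub_zero] at h4
    rw [← h4]
    exact intervalIntegral.integral_congr fun t _ => by ring
  simp only [Finset.sum_range_succ, Finset.sum_range_zero, odeTerm, pow_zero, pow_one, mul_one,
    zero_mul, add_zero, zero_add, sub_zero, one_mul] at h1 h2
  rw [hillDiscriminant, odeSol, odeSolDeriv]
  simp only [RCLike.ofReal_real_eq_id, id] at h1 h2 ⊢
  calc 2 + ζ * ∫ s in (0 : ℝ)..1, A s
      = (1 + (∫ s in (0 : ℝ)..1, ∫ r in (0 : ℝ)..s, A r) * ζ) +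
        (1 + (∫ r in (0 : ℝ)..1, A r * r) * ζ) := by rw [← h3]; ring
    _ ≤ _ := add_le_add h1 h2

/-- The equation `w'' = -λ² a² w` with a nonconstant coefficient has an instability interval. -/
theorem exists_two_lt_abs_hillDiscriminant {a a' : ℝ → ℝ} (ha : ∀ t, HasDerivAt a (a' t) t)
    (hpos : ∀ t, 0 < a t) {K : ℝ} (hK : ∀ t, |a t ^ 2| ≤ K) {c : ℝ} (hc : ∀ t, |a' t| ≤ c * a t)
    (ha0 : a 0 = 1) (ha1 : a 1 = 1) (hne : ∃ t ∈ Icc (0 : ℝ) 1, a t ≠ 1) :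
    ∃ l : ℝ, 0 < l ∧ 2 < |hillDiscriminant (fun t => a t ^ 2) (-l ^ 2)| := by
  by_contra! hcon
  have hac : Continuous a := continuous_iff_continuousAt.2 fun t => (ha t).continuousAt
  have hA : Continuous fun t => a t ^ 2 := hac.pow 2
  have hc0 : 0 ≤ c := by
    have := (abs_nonneg _).trans (hc 0)
    exact nonneg_of_mul_nonneg_left this (hpos 0)
  have hL0 : 0 ≤ ∫ s in (0 : ℝ)..1, a s :=
    intervalIntegral.integral_nonneg zero_le_one fun s _ => (hpos s).le
  set L := ∫ s in (0 : ℝ)..1, a s with hL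
  set J := ∫ s in (0 : ℝ)..1, a s ^ 2 with hJ
  have hJ0 : 0 ≤ J := intervalIntegral.integral_nonneg zero_le_one fun s _ => sq_nonneg _
  have hb : ∀ x : ℝ, |hillDiscriminant (fun t => a t ^ 2) (-x ^ 2)| ≤ 2 := by
    intro x
    rcases eq_or_ne x 0 with rfl | hx
    · simp [hillDiscriminant_zero]
    · have := hcon |x| (abs_pos.2 hx)
      rwa [sq_abs] at this
  have hF : Differentiable ℂ fun z : ℂ => hillDiscriminant (fun t => a t ^ 2) z :=
    (differentiable_odeSol hA hK 1).add (differentiable_odeSolDeriv hA hK 1)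
  have hmain : ∀ y : ℝ, 0 ≤ y → 2 + y ^ 2 * J ≤ 2 * Real.cosh (y * L) := by
    intro y hy
    have h1 := le_hillDiscriminant hA (fun t => sq_nonneg (a t)) hK (sq_nonneg y)
    refine h1.trans (le_two_cosh_of_bounded hF
      (f := fun x : ℝ => hillDiscriminant (fun t => a t ^ 2) x)
      (fun x => (ofReal_hillDiscriminant (𝕜 := ℂ) (fun t => a t ^ 2) x).symm)
      (Real.one_le_exp hc0) hL0
      (fun z hz => norm_hillDiscriminant_sq_le ha hpos hK hc ha0 ha1 hz) hb hy ?_)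
    exact le_trans (by nlinarith [mul_nonneg (sq_nonneg y) hJ0]) h1
  -- Comparison of the `y²` coefficients in `2 + y² J ≤ 2 cosh(yL)`. The limit `y → 0` is replaced
  -- by an explicit `y`, small enough for `y L ≤ 1` and for the quartic remainder of `cosh` to stay
  -- below the gap `J - L²`.
  have hJL : J ≤ L ^ 2 := by
    by_contra! hlt
    set y : ℝ := min (1 / (1 + L)) ((J - L ^ 2) / (1 + L) ^ 4) with hy
    have hL1 : 0 < 1 + L := by linarith
    have hy0 : 0 < y := lt_min (by positivity) (div_pos (by linarith) (by positivity))
    have hyL : y * (1 + L) ≤ 1 := by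
      rw [← le_div_iff₀ hL1]; exact min_le_left _ _
    have hyJ : y * (1 + L) ^ 4 ≤ J - L ^ 2 := by
      rw [← le_div_iff₀ (by positivity)]; exact min_le_right _ _
    have h1 := hmain y hy0.le
    set u : ℝ := (y * L) ^ 2 / 2 with hu
    have hyL0 : 0 ≤ y * L := mul_nonneg hy0.le hL0
    have hyL1 : y * L ≤ 1 := by nlinarith
    have hu0 : 0 ≤ u := by positivity
    have hu1 : u ≤ 1 := by rw [hu]; nlinarith
    have h2 : Real.cosh (y * L) ≤ 1 + u + u ^ 2 := by
      have h3 := Real.cosh_le_exp_half_sq (y * L)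
      have h4 := Real.abs_exp_sub_one_sub_id_le (x := u) (by rwa [abs_of_nonneg hu0])
      have h5 := (abs_le.1 h4).2
      linarith
    have h6 : y ^ 2 * J ≤ y ^ 2 * (L ^ 2 + y ^ 2 * L ^ 4 / 2) := by
      have : 2 * (1 + u + u ^ 2) = 2 + y ^ 2 * (L ^ 2 + y ^ 2 * L ^ 4 / 2) := by rw [hu]; ring
      linarith
    have h7 := le_of_mul_le_mul_left h6 (by positivity)
    have h8 : y ^ 2 * L ^ 4 ≤ y * (1 + L) ^ 4 := by
      have hy1 : y ≤ 1 := by nlinarith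
      have : y ^ 2 ≤ y := by nlinarith
      have h9 : L ^ 4 ≤ (1 + L) ^ 4 := pow_le_pow_left₀ hL0 (by linarith) 4
      exact mul_le_mul this h9 (by positivity) hy0.le
    have h10 : 0 < y * (1 + L) ^ 4 := by positivity
    linarith
  -- The integral of the square is `J - L²`, the variance of `a` on the unit interval.
  have hvar : ∫ s in (0 : ℝ)..1, (a s - L) ^ 2 ≤ 0 := by
    have e1 : ∫ s in (0 : ℝ)..1, (a s - L) ^ 2 =
        ∫ s in (0 : ℝ)..1, (a s ^ 2 - 2 * L * a s + L ^ 2) :=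
      intervalIntegral.integral_congr fun s _ => by ring
    rw [e1, intervalIntegral.integral_add (Continuous.intervalIntegrable (by fun_prop) _ _)
      (Continuous.intervalIntegrable (by fun_prop) _ _),
      intervalIntegral.integral_sub (Continuous.intervalIntegrable (by fun_prop) _ _)
      (Continuous.intervalIntegrable (by fun_prop) _ _), intervalIntegral.integral_const_mul,
      intervalIntegral.integral_const, ← hL, ← hJ]
    simp only [sub_zero, one_smul]
    nlinarith
  have hconst : ∀ t ∈ Icc (0 : ℝ) 1, a t = L := by
    by_contra! ht
    obtain ⟨t, ht, hne⟩ := ht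
    refine absurd hvar (not_le.2 (intervalIntegral.integral_pos zero_lt_one
      (Continuous.continuousOn (by fun_prop)) (fun s _ => sq_nonneg _) ⟨t, ht, ?_⟩))
    have := sub_ne_zero.2 hne; positivity
  obtain ⟨t, ht, hne⟩ := hne
  exact hne (by rw [hconst t ht, ← hconst 0 (by simp), ha0])

/-! ### Monodromy and parametric resonance -/

theorem odeSol_eq_linear {A : ℝ → ℝ} (hA : Continuous A) {K : ℝ} (hK : ∀ t, |A t| ≤ K)
    (x y z : ℝ) {t : ℝ} (ht : 0 ≤ t) :
    odeSol A 0 x y z t = x * odeSol A 0 1 0 z t + y * odeSol A 0 0 1 z t ∧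
    odeSolDeriv A 0 x y z t = x * odeSolDeriv A 0 1 0 z t + y * odeSolDeriv A 0 0 1 z t := by
  have hd : ∀ x y s, HasDerivAt (odeSol A 0 x y z) (odeSolDeriv A 0 x y z s) s := fun x y s =>
    hasDerivAt_odeSol hA hK z s
  have hd' : ∀ x y s, HasDerivAt (odeSolDeriv A 0 x y z) (z * A s * odeSol A 0 x y z s) s :=
    fun x y s => hasDerivAt_odeSolDeriv hA hK z s
  refine second_order_ode_unique (c := fun t => z * A t) (K := |z| * K) (a := 0) (b := t)
    (w₁ := odeSol A 0 x y z) (v₁ := odeSolDeriv A 0 x y z)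
    (w₂ := fun t => x * odeSol A 0 1 0 z t + y * odeSol A 0 0 1 z t)
    (v₂ := fun t => x * odeSolDeriv A 0 1 0 z t + y * odeSolDeriv A 0 0 1 z t)
    (fun s => ?_) (fun s _ => (hd x y s).hasDerivWithinAt)
    (fun s _ => (hd' x y s).hasDerivWithinAt)
    (fun s _ => (((hd 1 0 s).const_mul x).add ((hd 0 1 s).const_mul y)).hasDerivWithinAt)
    (fun s _ => ((((hd' 1 0 s).const_mul x).add
      ((hd' 0 1 s).const_mul y)).congr_deriv ?_).hasDerivWithinAt) ?_ ?_ ⟨ht, le_rfl⟩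
  · rw [abs_mul]; exact mul_le_mul_of_nonneg_left (hK s) (abs_nonneg z)
  · rw [smul_eq_mul]; ring
  · simp [odeSol_self]
  · simp [odeSolDeriv_self]

theorem odeSol_wronskian {A : ℝ → ℝ} (hA : Continuous A) {K : ℝ} (hK : ∀ t, |A t| ≤ K)
    (z t : ℝ) :
    odeSol A 0 1 0 z t * odeSolDeriv A 0 0 1 z t - odeSolDeriv A 0 1 0 z t * odeSol A 0 0 1 z t
      = 1 := by
  have hd : ∀ x y s, HasDerivAt (odeSol A 0 x y z) (odeSolDeriv A 0 x y z s) s := fun x y s =>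
    hasDerivAt_odeSol hA hK z s
  have hd' : ∀ x y s, HasDerivAt (odeSolDeriv A 0 x y z) (z * A s * odeSol A 0 x y z s) s :=
    fun x y s => hasDerivAt_odeSolDeriv hA hK z s
  have h : ∀ s, HasDerivAt (fun t => odeSol A 0 1 0 z t * odeSolDeriv A 0 0 1 z t -
      odeSolDeriv A 0 1 0 z t * odeSol A 0 0 1 z t) 0 s := fun s =>
    (((hd 1 0 s).mul (hd' 0 1 s)).sub ((hd' 1 0 s).mul (hd 0 1 s))).congr_deriv (by ring)
  have := is_const_of_deriv_eq_zero (fun s => (h s).differentiableAt) (fun s => (h s).deriv) t 0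
  rw [this]
  simp [odeSol_self, odeSolDeriv_self]

/-- A linear recurrence with large coefficient and expanding initial step grows geometrically. -/
theorem pow_mul_norm_le_of_recurrence {X : ℕ → ℂ} {D : ℝ} {g : ℝ} (hg : 1 ≤ g)
    (hD : g + g⁻¹ ≤ |D|) (hrec : ∀ j, X (j + 2) = D * X (j + 1) - X j)
    (h0 : g * ‖X 0‖ ≤ ‖X 1‖) (n : ℕ) : g ^ n * ‖X 0‖ ≤ ‖X n‖ := by
  have hg0 : 0 < g := by linarith
  have hstep : ∀ j, g * ‖X j‖ ≤ ‖X (j + 1)‖ := by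
    intro j
    induction j with
    | zero => exact h0
    | succ j ih =>
      have h1 : |D| * ‖X (j + 1)‖ - ‖X j‖ ≤ ‖X (j + 1 + 1)‖ := by
        rw [hrec j]
        refine le_trans (le_of_eq ?_) (norm_sub_norm_le _ _)
        rw [norm_mul, Complex.norm_real, Real.norm_eq_abs]
      have h2 : ‖X j‖ ≤ g⁻¹ * ‖X (j + 1)‖ := by
        rw [inv_mul_eq_div, le_div_iff₀ hg0]; linarith
      have h3 := mul_le_mul_of_nonneg_right hD (norm_nonneg (X (j + 1)))
      linarith
  induction n with
  | zero => simp
  | succ n ih =>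
    calc g ^ (n + 1) * ‖X 0‖ = g * (g ^ n * ‖X 0‖) := by ring
      _ ≤ g * ‖X n‖ := by gcongr
      _ ≤ _ := hstep n

/-- Parametric resonance: near an unstable parameter `l₀`, a fixed initial vector grows
exponentially with the number of periods. -/
theorem exists_uniform_growth {A : ℝ → ℝ} (hA : Continuous A) {K : ℝ} (hK : ∀ t, |A t| ≤ K)
    {l₀ : ℝ} (hl₀ : 0 < l₀) (hD : 2 < |hillDiscriminant A (-l₀ ^ 2)|) :
    ∃ κ e₁ e₂ : ℝ, 0 < κ ∧ (e₁ ≠ 0 ∨ e₂ ≠ 0) ∧ ∀ᶠ l in 𝓝 l₀, 0 < l ∧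
      ∀ x y : ℕ → ℝ, x 0 = e₁ → y 0 = e₂ → ∀ n : ℕ,
        (∀ j < n, x (j + 1) = odeSol A 0 (x j) (y j) (-l ^ 2) 1) →
        (∀ j < n, y (j + 1) = odeSolDeriv A 0 (x j) (y j) (-l ^ 2) 1) →
        Real.exp (2 * κ * n) * (l ^ 2 * e₁ ^ 2 + e₂ ^ 2) ≤ l ^ 2 * x n ^ 2 + y n ^ 2 := by
  set D : ℝ → ℝ := fun l => hillDiscriminant A (-l ^ 2) with hDdef
  set C : ℝ → ℝ := fun l => odeSol A 0 1 0 (-l ^ 2) 1 with hC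
  set S : ℝ → ℝ := fun l => odeSol A 0 0 1 (-l ^ 2) 1 with hS
  set C' : ℝ → ℝ := fun l => odeSolDeriv A 0 1 0 (-l ^ 2) 1 with hC'
  set S' : ℝ → ℝ := fun l => odeSolDeriv A 0 0 1 (-l ^ 2) 1 with hS'
  have hsq : Continuous fun l : ℝ => -l ^ 2 := by fun_prop
  have cC : Continuous C := (continuous_odeSol_param hA hK 1).comp hsq
  have cS : Continuous S := (continuous_odeSol_param hA hK 1).comp hsq
  have cC' : Continuous C' := (continuous_odeSolDeriv_param hA hK 1).comp hsq
  have cS' : Continuous S' := (continuous_odeSolDeriv_param hA hK 1).comp hsq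
  have hDCS : ∀ l, D l = C l + S' l := fun l => rfl
  have cD : Continuous D := cC.add cS'
  have hdet : ∀ l, C l * S' l - C' l * S l = 1 := fun l => odeSol_wronskian hA hK _ 1
  -- The root of the characteristic polynomial with the larger modulus; the sign of the square root
  -- follows that of the trace.
  obtain ⟨μ, hμ, hμ1⟩ : ∃ μ : ℝ, μ ^ 2 - D l₀ * μ + 1 = 0 ∧ 1 < |μ| := by
    have hD2 : 2 < |D l₀| := hD
    have h4 : 0 ≤ D l₀ ^ 2 - 4 := by nlinarith [sq_abs (D l₀)]
    have hs := Real.sq_sqrt h4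
    have hs0 := Real.sqrt_nonneg (D l₀ ^ 2 - 4)
    rcases le_total 0 (D l₀) with h | h
    · rw [abs_of_nonneg h] at hD2
      refine ⟨(D l₀ + √(D l₀ ^ 2 - 4)) / 2, by nlinarith, ?_⟩
      rw [abs_of_nonneg (by linarith)]; linarith
    · rw [abs_of_nonpos h] at hD2
      refine ⟨(D l₀ - √(D l₀ ^ 2 - 4)) / 2, by nlinarith, ?_⟩
      rw [abs_of_nonpos (by linarith)]; linarith
  have hμ0 : μ ≠ 0 := fun h => by rw [h, abs_zero] at hμ1; linarith
  have hDμ : |D l₀| = |μ| + |μ|⁻¹ := by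
    have h1 : D l₀ = μ + μ⁻¹ := by field_simp; linarith
    rw [h1]
    rcases lt_or_gt_of_ne hμ0 with h | h
    · have : μ⁻¹ < 0 := inv_lt_zero.2 h
      rw [abs_of_neg h, abs_of_neg (by linarith), inv_neg]; ring
    · have : 0 < μ⁻¹ := inv_pos.2 h
      rw [abs_of_pos h, abs_of_pos (by linarith)]
  obtain ⟨e₁, e₂, hne, he1, he2⟩ : ∃ e₁ e₂ : ℝ, (e₁ ≠ 0 ∨ e₂ ≠ 0) ∧
      C l₀ * e₁ + S l₀ * e₂ = μ * e₁ ∧ C' l₀ * e₁ + S' l₀ * e₂ = μ * e₂ := by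
    have hdet0 : (!![C l₀ - μ, S l₀; C' l₀, S' l₀ - μ]).det = 0 := by
      rw [Matrix.det_fin_two_of]
      have := hdet l₀
      rw [hDCS] at hμ
      linarith
    obtain ⟨v, hv, hmv⟩ := Matrix.exists_mulVec_eq_zero_iff.2 hdet0
    refine ⟨v 0, v 1, ?_, ?_, ?_⟩
    · by_contra! h
      exact hv (by ext i; fin_cases i <;> simp [h.1, h.2])
    · have := congrFun hmv 0
      simp [Matrix.mulVec, dotProduct, Fin.sum_univ_two] at this
      linarith
    · have := congrFun hmv 1
      simp [Matrix.mulVec, dotProduct, Fin.sum_univ_two] at this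
      linarith
  -- Any rate strictly between `1` and `|μ|` works: the trace inequality and the growth of the first
  -- step are then strict at `l₀`, hence persist for nearby `l` with the same initial vector,
  -- although it is an eigenvector only at `l₀`.
  set g : ℝ := (1 + |μ|) / 2 with hg
  have hg1 : 1 < g := by rw [hg]; linarith
  have hgμ : g < |μ| := by rw [hg]; linarith
  have hgD : g + g⁻¹ < |D l₀| := by
    rw [hDμ]
    have h1 : |μ| + |μ|⁻¹ - (g + g⁻¹) = (|μ| - g) * (1 - (|μ| * g)⁻¹) := by
      field_simp; ring
    have h2 : (|μ| * g)⁻¹ < 1 := inv_lt_one_of_one_lt₀ (by nlinarith)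
    have h3 : 0 < (|μ| - g) * (1 - (|μ| * g)⁻¹) := mul_pos (by linarith) (by linarith)
    linarith
  have hexp : Real.exp (Real.log g) = g := Real.exp_log (by linarith)
  have hstart : g ^ 2 * (l₀ ^ 2 * e₁ ^ 2 + e₂ ^ 2) <
      l₀ ^ 2 * (C l₀ * e₁ + S l₀ * e₂) ^ 2 + (C' l₀ * e₁ + S' l₀ * e₂) ^ 2 := by
    rw [he1, he2]
    have hN : 0 < l₀ ^ 2 * e₁ ^ 2 + e₂ ^ 2 := by
      rcases hne with h | h <;> positivity
    have h1 : g ^ 2 < μ ^ 2 := by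
      rw [← sq_abs μ]; exact pow_lt_pow_left₀ hgμ (by linarith) two_ne_zero
    calc _ < μ ^ 2 * (l₀ ^ 2 * e₁ ^ 2 + e₂ ^ 2) := mul_lt_mul_of_pos_right h1 hN
      _ = _ := by ring
  refine ⟨Real.log g, e₁, e₂, Real.log_pos hg1, hne, ?_⟩
  have ev1 : ∀ᶠ l in 𝓝 l₀, g + g⁻¹ < |D l| := (cD.abs.continuousAt).eventually_const_lt hgD
  have ev2 : ∀ᶠ l in 𝓝 l₀, g ^ 2 * (l ^ 2 * e₁ ^ 2 + e₂ ^ 2) <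
      l ^ 2 * (C l * e₁ + S l * e₂) ^ 2 + (C' l * e₁ + S' l * e₂) ^ 2 :=
    ContinuousAt.eventually_lt (by fun_prop) (by fun_prop) hstart
  filter_upwards [ev1, ev2, lt_mem_nhds hl₀] with l h1 h2 h3
  refine ⟨h3, fun x y hx hy n hxn hyn => ?_⟩
  -- extend the finite orbit to an infinite one
  set p : ℕ → ℝ × ℝ := fun j => (fun q : ℝ × ℝ =>
    (q.1 * C l + q.2 * S l, q.1 * C' l + q.2 * S' l))^[j] (e₁, e₂) with hp
  have hps : ∀ j, p (j + 1) = ((p j).1 * C l + (p j).2 * S l, (p j).1 * C' l + (p j).2 * S' l) :=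
    fun j => Function.iterate_succ_apply' _ _ _
  have hxy : ∀ j ≤ n, x j = (p j).1 ∧ y j = (p j).2 := by
    intro j
    induction j with
    | zero => intro _; exact ⟨hx, hy⟩
    | succ j ih =>
      intro hj
      obtain ⟨i1, i2⟩ := ih (by omega)
      have hlin := odeSol_eq_linear hA hK (x j) (y j) (-l ^ 2) zero_le_one
      rw [hps, hxn j (by omega), hyn j (by omega), hlin.1, hlin.2, i1, i2]
      exact ⟨rfl, rfl⟩
  -- The state is coded as a complex number whose squared modulus is the energy `l² x² + y²`.
  set X : ℕ → ℂ := fun j => ⟨l * (p j).1, (p j).2⟩ with hX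
  have hnorm : ∀ j, ‖X j‖ ^ 2 = l ^ 2 * (p j).1 ^ 2 + (p j).2 ^ 2 := fun j => by
    rw [← Complex.normSq_eq_norm_sq, Complex.normSq_apply]; simp only [hX]; ring
  -- Cayley–Hamilton for a matrix of trace `D l` and determinant `1`.
  have hrec : ∀ j, X (j + 2) = (D l : ℂ) * X (j + 1) - X j := by
    intro j
    have hd := hdet l
    have e1 := hps (j + 1)
    have e2 := hps j
    have q1 : (p (j + 2)).1 = D l * (p (j + 1)).1 - (p j).1 := by
      rw [e1, e2, hDCS]; simp only; linear_combination (-(p j).1) * hd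
    have q2 : (p (j + 2)).2 = D l * (p (j + 1)).2 - (p j).2 := by
      rw [e1, e2, hDCS]; simp only; linear_combination (-(p j).2) * hd
    apply Complex.ext
    · simp [hX, q1]; ring
    · simp [hX, q2]
  have h0 : g * ‖X 0‖ ≤ ‖X 1‖ := by
    refine (sq_le_sq₀ (by positivity) (norm_nonneg _)).1 ?_
    rw [mul_pow, hnorm, hnorm, hps 0]
    have : p 0 = (e₁, e₂) := rfl
    rw [this]
    refine h2.le.trans (le_of_eq ?_)
    ring
  have hfin := pow_mul_norm_le_of_recurrence hg1.le h1.le hrec h0 n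
  have hfin2 := pow_le_pow_left₀ (by positivity) hfin 2
  rw [mul_pow, hnorm, hnorm] at hfin2
  rw [(hxy n le_rfl).1, (hxy n le_rfl).2]
  refine le_trans (le_of_eq ?_) hfin2
  rw [← pow_mul, mul_comm n 2, ← hexp, ← Real.exp_nat_mul, Real.log_exp]
  push_cast
  have : p 0 = (e₁, e₂) := rfl
  rw [this]
  congr 2
  ring

/-! ### Curves and series in the Schwartz space -/

/-- In a topological vector space the derivative of a curve is characterised by difference
quotients. -/
theorem hasDerivWithinAt_iff_tendsto_inv_smul {F : Type*} [AddCommGroup F] [Module ℝ F]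
    [TopologicalSpace F] [ContinuousSMul ℝ F] {f : ℝ → F} {f' : F} {s : Set ℝ} {x : ℝ} :
    HasDerivWithinAt f f' s x ↔
      Tendsto (fun y => (y - x)⁻¹ • (f y - f x - (y - x) • f')) (𝓝[s] x) (𝓝 0) := by
  rw [hasDerivWithinAt_iff_hasFDerivWithinAt, hasFDerivWithinAt_iff_isLittleOTVS,
    Asymptotics.isLittleOTVS_iff_tendsto_inv_smul]
  · simp
  · refine Filter.Eventually.of_forall fun y hy => ?_
    rw [sub_eq_zero] at hy
    simp [hy]

theorem HasDerivWithinAt.map_continuousLinearMap {F G : Type*} [AddCommGroup F] [Module ℝ F]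
    [TopologicalSpace F] [ContinuousSMul ℝ F] [AddCommGroup G] [Module ℝ G]
    [TopologicalSpace G] [ContinuousSMul ℝ G] (L : F →L[ℝ] G) {f : ℝ → F} {f' : F} {s : Set ℝ}
    {x : ℝ} (h : HasDerivWithinAt f f' s x) :
    HasDerivWithinAt (fun t => L (f t)) (L f') s x := by
  rw [hasDerivWithinAt_iff_tendsto_inv_smul] at h ⊢
  have := (L.continuous.tendsto 0).comp h
  simpa [Function.comp_def] using this

namespace SchwartzMap

variable {E : Type*} [NormedAddCommGroup E] [NormedSpace ℝ E]

theorem summable_iteratedFDeriv {f : ℕ → 𝓢(E, ℂ)}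
    (h : ∀ k l, Summable fun n => SchwartzMap.seminorm ℝ k l (f n)) (k l : ℕ) (x : E) :
    Summable fun n => ‖x‖ ^ k * ‖iteratedFDeriv ℝ l (f n) x‖ :=
  Summable.of_nonneg_of_le (fun n => by positivity) (fun n => le_seminorm ℝ k l (f n) x) (h k l)

theorem iteratedFDeriv_tsum_eq {f : ℕ → 𝓢(E, ℂ)}
    (h : ∀ k l, Summable fun n => SchwartzMap.seminorm ℝ k l (f n)) (l : ℕ) (x : E) :
    iteratedFDeriv ℝ l (fun y => ∑' n, f n y) x = ∑' n, iteratedFDeriv ℝ l (f n) x :=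
  iteratedFDeriv_tsum_apply (N := ⊤) (v := fun l n => SchwartzMap.seminorm ℝ 0 l (f n))
    (fun n => (f n).smooth ⊤) (fun l _ => h 0 l)
    (fun l n x _ => norm_iteratedFDeriv_le_seminorm ℝ (f n) l x) le_top x

theorem pow_mul_norm_iteratedFDeriv_tsum_le {f : ℕ → 𝓢(E, ℂ)}
    (h : ∀ k l, Summable fun n => SchwartzMap.seminorm ℝ k l (f n)) (k l : ℕ) (x : E) :
    ‖x‖ ^ k * ‖iteratedFDeriv ℝ l (fun y => ∑' n, f n y) x‖ ≤
      ∑' n, SchwartzMap.seminorm ℝ k l (f n) := by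
  have h0 : Summable fun n => ‖iteratedFDeriv ℝ l (f n) x‖ := by
    simpa using summable_iteratedFDeriv h 0 l x
  rw [iteratedFDeriv_tsum_eq h]
  calc ‖x‖ ^ k * ‖∑' n, iteratedFDeriv ℝ l (f n) x‖
      ≤ ‖x‖ ^ k * ∑' n, ‖iteratedFDeriv ℝ l (f n) x‖ := by
        gcongr
        exact norm_tsum_le_tsum_norm h0
    _ = ∑' n, ‖x‖ ^ k * ‖iteratedFDeriv ℝ l (f n) x‖ := tsum_mul_left.symm
    _ ≤ _ := (summable_iteratedFDeriv h k l x).tsum_le_tsum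
        (fun n => le_seminorm ℝ k l (f n) x) (h k l)

/-- The sum of a series of Schwartz functions which is absolutely summable for every seminorm. -/
noncomputable def absTsum (f : ℕ → 𝓢(E, ℂ))
    (h : ∀ k l, Summable fun n => SchwartzMap.seminorm ℝ k l (f n)) : 𝓢(E, ℂ) where
  toFun x := ∑' n, f n x
  smooth' := contDiff_tsum (N := ⊤) (v := fun l n => SchwartzMap.seminorm ℝ 0 l (f n))
    (fun n => (f n).smooth ⊤) (fun l _ => h 0 l)
    (fun l n x _ => norm_iteratedFDeriv_le_seminorm ℝ (f n) l x)
  decay' k l := ⟨_, pow_mul_norm_iteratedFDeriv_tsum_le h k l⟩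

theorem absTsum_apply {f : ℕ → 𝓢(E, ℂ)}
    (h : ∀ k l, Summable fun n => SchwartzMap.seminorm ℝ k l (f n)) (x : E) :
    absTsum f h x = ∑' n, f n x := rfl

theorem summable_apply {f : ℕ → 𝓢(E, ℂ)}
    (h : ∀ k l, Summable fun n => SchwartzMap.seminorm ℝ k l (f n)) (x : E) :
    Summable fun n => f n x :=
  Summable.of_norm_bounded (h 0 0) fun n => norm_le_seminorm ℝ (f n) x

theorem seminorm_absTsum_le {f : ℕ → 𝓢(E, ℂ)}
    (h : ∀ k l, Summable fun n => SchwartzMap.seminorm ℝ k l (f n)) (k l : ℕ) :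
    SchwartzMap.seminorm ℝ k l (absTsum f h) ≤ ∑' n, SchwartzMap.seminorm ℝ k l (f n) :=
  seminorm_le_bound ℝ k l _ (tsum_nonneg fun _ => apply_nonneg _ _)
    (pow_mul_norm_iteratedFDeriv_tsum_le h k l)

/-- `c n t` and the seminorms of `f n` decay so that `∑ c n t • f n` converges. -/
theorem summable_seminorm_smul {f : ℕ → 𝓢(E, ℂ)}
    (hf : ∀ k l, ∃ B R : ℝ, ∀ n, SchwartzMap.seminorm ℝ k l (f n) ≤ B * R ^ n)
    {c : ℕ → ℝ} {C M : ℝ} (hc : ∀ n, |c n| ≤ C * (M ^ n / n.factorial)) (k l : ℕ) :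
    Summable fun n => SchwartzMap.seminorm ℝ k l (c n • f n) := by
  obtain ⟨B, R, hB⟩ := hf k l
  refine Summable.of_nonneg_of_le (fun n => apply_nonneg _ _) (fun n => ?_)
    (summable_const_mul_pow_div_factorial (C * B) (M * R))
  rw [map_smul_eq_mul, Real.norm_eq_abs]
  calc |c n| * SchwartzMap.seminorm ℝ k l (f n)
      ≤ C * (M ^ n / n.factorial) * (B * R ^ n) :=
        mul_le_mul (hc n) (hB n) (apply_nonneg _ _) ((abs_nonneg _).trans (hc n))
    _ = _ := by rw [mul_pow]; ring

/-- The remainder of the difference quotient is again a series `∑ r n y • f n`. The mean value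
inequality dominates `r n y` by a factorially decaying bound uniformly for `y` near `t`, so every
seminorm tends to `0` by dominated convergence. -/
theorem hasDerivWithinAt_absTsum {f : ℕ → 𝓢(E, ℂ)}
    (hf : ∀ k l, ∃ B R : ℝ, ∀ n, SchwartzMap.seminorm ℝ k l (f n) ≤ B * R ^ n)
    {c c' : ℕ → ℝ → ℝ} (hc : ∀ n t, HasDerivAt (c n) (c' n t) t) {t₀ : ℝ}
    (hbd : ∀ T, ∃ C M : ℝ, ∀ n t, |t - t₀| ≤ T → |c' n t| ≤ C * (M ^ n / n.factorial))
    (hU : ∀ t k l, Summable fun n => SchwartzMap.seminorm ℝ k l (c n t • f n))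
    (hV : ∀ t k l, Summable fun n => SchwartzMap.seminorm ℝ k l (c' n t • f n))
    (s : Set ℝ) (t : ℝ) :
    HasDerivWithinAt (fun t => absTsum (fun n => c n t • f n) (hU t))
      (absTsum (fun n => c' n t • f n) (hV t)) s t := by
  rw [hasDerivWithinAt_iff_tendsto_inv_smul]
  refine Tendsto.mono_left ?_ nhdsWithin_le_nhds
  rw [(schwartz_withSeminorms ℝ E ℂ).tendsto_nhds]
  rintro ⟨k, l⟩ ε hε
  obtain ⟨C, M, hCM⟩ := hbd (|t - t₀| + 1)
  obtain ⟨B, R, hB⟩ := hf k l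
  set p := SchwartzMap.seminorm ℝ k l (E := E) (F := ℂ) with hp
  set r : ℕ → ℝ → ℝ := fun n y => (y - t)⁻¹ * (c n y - c n t - (y - t) * c' n t) with hr
  have hball : ∀ y ∈ Metric.ball t 1, |y - t₀| ≤ |t - t₀| + 1 := fun y hy => by
    rw [Metric.mem_ball, Real.dist_eq] at hy
    have := abs_sub_le y t t₀
    linarith
  have hrbd : ∀ n, ∀ y ∈ Metric.ball t 1, |r n y| ≤ 2 * C * (M ^ n / n.factorial) := by
    intro n y hy
    have ht : t ∈ Metric.ball t (1 : ℝ) := Metric.mem_ball_self one_pos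
    have h1 : |c n y - c n t| ≤ C * (M ^ n / n.factorial) * |y - t| :=
      (convex_ball t 1).norm_image_sub_le_of_norm_hasDerivWithin_le
        (fun x _ => (hc n x).hasDerivWithinAt) (fun x hx => hCM n x (hball x hx)) ht hy
    have h2 : |c' n t| ≤ C * (M ^ n / n.factorial) := hCM n t (hball t ht)
    rcases eq_or_ne y t with rfl | hyt
    · simp only [hr, sub_self, inv_zero, zero_mul, abs_zero]
      have := (abs_nonneg _).trans h2
      linarith
    · have hpos : 0 < |y - t| := abs_pos.2 (sub_ne_zero.2 hyt)
      simp only [hr]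
      rw [abs_mul, abs_inv, inv_mul_le_iff₀ hpos]
      refine (abs_sub _ _).trans ?_
      rw [abs_mul]
      nlinarith [mul_le_mul_of_nonneg_left h2 hpos.le]
  have hpr : ∀ n y, p (r n y • f n) = |r n y| * p (f n) := fun n y => by
    rw [map_smul_eq_mul, Real.norm_eq_abs]
  have hsum : Summable fun n : ℕ => 2 * C * B * ((M * R) ^ n / n.factorial) :=
    summable_const_mul_pow_div_factorial _ _
  have hterm : ∀ n, ∀ y ∈ Metric.ball t 1,
      p (r n y • f n) ≤ 2 * C * B * ((M * R) ^ n / n.factorial) := by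
    intro n y hy
    rw [hpr]
    calc |r n y| * p (f n) ≤ 2 * C * (M ^ n / n.factorial) * (B * R ^ n) :=
          mul_le_mul (hrbd n y hy) (hB n) (apply_nonneg _ _)
            ((abs_nonneg _).trans (hrbd n y hy))
      _ = _ := by rw [mul_pow]; ring
  have hlim : Tendsto (fun y => ∑' n, p (r n y • f n)) (𝓝 t) (𝓝 (∑' _ : ℕ, 0)) := by
    refine tendsto_tsum_of_dominated_convergence hsum (fun n => ?_) ?_
    · have h1 : Tendsto (r n) (𝓝 t) (𝓝 0) := by
        have := (hasDerivWithinAt_iff_tendsto_inv_smul (s := univ)).1 (hc n t).hasDerivWithinAt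
        rwa [nhdsWithin_univ] at this
      have h2 := h1.abs.mul_const (p (f n))
      simp only [abs_zero, zero_mul] at h2
      simpa only [hpr] using h2
    · filter_upwards [Metric.ball_mem_nhds t one_pos] with y hy n
      rw [Real.norm_of_nonneg (apply_nonneg _ _)]
      exact hterm n y hy
  rw [tsum_zero] at hlim
  filter_upwards [hlim.eventually (gt_mem_nhds hε), Metric.ball_mem_nhds t one_pos] with y hy hyb
  have hW : ∀ k' l', Summable fun n => SchwartzMap.seminorm ℝ k' l' (r n y • f n) := fun k' l' =>
    summable_seminorm_smul hf (fun n => hrbd n y hyb) k' l'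
  have heq : (y - t)⁻¹ • (absTsum (fun n => c n y • f n) (hU y) -
      absTsum (fun n => c n t • f n) (hU t) - (y - t) • absTsum (fun n => c' n t • f n) (hV t)) =
      absTsum (fun n => r n y • f n) hW := by
    ext x
    have s1 := summable_apply (hU y) x
    have s2 := summable_apply (hU t) x
    have s3 := summable_apply (hV t) x
    simp only [_root_.smul_apply, _root_.sub_apply, absTsum_apply] at s1 s2 s3 ⊢
    rw [← s1.tsum_sub s2, ← s3.tsum_const_smul (y - t),
      ← (s1.sub s2).tsum_sub (s3.const_smul (y - t)),
      ← ((s1.sub s2).sub (s3.const_smul (y - t))).tsum_const_smul (y - t)⁻¹]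
    refine tsum_congr fun n => ?_
    simp only [hr, Complex.real_smul]
    push_cast
    ring
  rw [sub_zero, heq]
  exact (seminorm_absTsum_le hW k l).trans_lt hy

/-- Multiplication by powers of a smooth function increases the seminorms of a compactly supported
function at most geometrically. -/
theorem exists_seminorm_le_geometric {P : E → ℝ} (hP : ContDiff ℝ ∞ P) {f : ℕ → 𝓢(E, ℂ)}
    (hf : ∀ n x, f (n + 1) x = P x • f n x) (hsupp : HasCompactSupport (f 0)) (k l : ℕ) :
    ∃ B R : ℝ, ∀ n, SchwartzMap.seminorm ℝ k l (f n) ≤ B * R ^ n := by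
  obtain ⟨ρ, hρ⟩ := hsupp.isCompact.isBounded.exists_norm_le
  -- All `f n` live on the compact support of `f 0`, where the derivatives of `P` are bounded; the
  -- Leibniz rule then costs at most `2 ^ l * G'` per multiplication. Geometric growth is beaten by
  -- the `1 / n!` of the time coefficients.
  have hcont : ∀ i, ∃ G, ∀ x ∈ tsupport (f 0), ‖iteratedFDeriv ℝ i P x‖ ≤ G := fun i =>
    hsupp.isCompact.exists_bound_of_continuousOn
      (hP.continuous_iteratedFDeriv (m := i) (by exact_mod_cast le_top)).continuousOn
  choose G hG using hcont
  set G' : ℝ := ∑ i ∈ Finset.range (l + 1), |G i| with hG'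
  have hG'0 : 0 ≤ G' := Finset.sum_nonneg fun i _ => abs_nonneg _
  have hGle : ∀ i ≤ l, ∀ x ∈ tsupport (f 0), ‖iteratedFDeriv ℝ i P x‖ ≤ G' := fun i hi x hx =>
    (hG i x hx).trans ((le_abs_self _).trans
      (Finset.single_le_sum (f := fun i => |G i|) (fun i _ => abs_nonneg _)
        (Finset.mem_range.2 (by omega))))
  set B : ℝ := ∑ j ∈ Finset.range (l + 1), SchwartzMap.seminorm ℝ 0 j (f 0) with hB
  have hB0 : 0 ≤ B := Finset.sum_nonneg fun i _ => apply_nonneg _ _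
  set R : ℝ := 2 ^ l * G' with hR
  have hR0 : 0 ≤ R := by positivity
  have hts : ∀ n, tsupport (f n) ⊆ tsupport (f 0) := by
    intro n
    induction n with
    | zero => exact subset_rfl
    | succ n ih =>
      refine subset_trans (closure_mono fun x hx => ?_) ih
      rw [Function.mem_support, hf] at hx
      exact fun h => hx (by rw [h, smul_zero])
  have hmain : ∀ n, ∀ j ≤ l, ∀ x ∈ tsupport (f 0), ‖iteratedFDeriv ℝ j (f n) x‖ ≤ B * R ^ n := by
    intro n
    induction n with
    | zero =>
      intro j hj x _
      rw [pow_zero, mul_one]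
      exact (norm_iteratedFDeriv_le_seminorm ℝ (f 0) j x).trans
        (Finset.single_le_sum (f := fun j => SchwartzMap.seminorm ℝ 0 j (f 0))
          (fun i _ => apply_nonneg _ _) (Finset.mem_range.2 (by omega)))
    | succ n ih =>
      intro j hj x hx
      have hfun : (f (n + 1) : E → ℂ) = fun y => P y • f n y := funext (hf n)
      rw [hfun]
      refine (norm_iteratedFDeriv_smul_le hP ((f n).smooth ⊤) x
        (n := j) (by exact_mod_cast le_top)).trans ?_
      calc ∑ i ∈ Finset.range (j + 1), (j.choose i : ℝ) * ‖iteratedFDeriv ℝ i P x‖ *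
            ‖iteratedFDeriv ℝ (j - i) (f n) x‖
          ≤ ∑ i ∈ Finset.range (j + 1), (j.choose i : ℝ) * G' * (B * R ^ n) := by
            refine Finset.sum_le_sum fun i hi => ?_
            have hi' := Finset.mem_range.1 hi
            exact mul_le_mul (mul_le_mul_of_nonneg_left (hGle i (by omega) x hx) (by positivity))
              (ih (j - i) (by omega) x hx) (norm_nonneg _) (by positivity)
        _ = 2 ^ j * G' * (B * R ^ n) := by
            rw [← Finset.sum_mul, ← Finset.sum_mul, ← Nat.cast_sum, Nat.sum_range_choose]
            push_cast; rfl
        _ ≤ 2 ^ l * G' * (B * R ^ n) := by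
            gcongr
            exact one_le_two
        _ = _ := by rw [hR]; ring
  refine ⟨|ρ| ^ k * B, R, fun n => seminorm_le_bound ℝ k l _ (by positivity) fun x => ?_⟩
  by_cases hx : x ∈ tsupport (f 0)
  · calc ‖x‖ ^ k * ‖iteratedFDeriv ℝ l (f n) x‖ ≤ |ρ| ^ k * (B * R ^ n) :=
          mul_le_mul (pow_le_pow_left₀ (norm_nonneg _) ((hρ x hx).trans (le_abs_self _)) k)
            (hmain n l le_rfl x hx) (norm_nonneg _) (by positivity)
      _ = _ := by ring
  · have : iteratedFDeriv ℝ l (f n) x = 0 := by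
      by_contra hne
      exact hx (hts n (support_iteratedFDeriv_subset l hne))
    rw [this, norm_zero, mul_zero]
    positivity

end SchwartzMap

/-! ### The wave equation and its energy on the Fourier side -/

open FourierTransform in
theorem fourier_laplacian_apply {d : ℕ} (f : 𝓢(Space d, ℂ)) (ξ : Space d) :
    𝓕 (Δ f) ξ = (-(2 * Real.pi * ‖ξ‖) ^ 2) • 𝓕 f ξ := by
  rw [SchwartzMap.laplacian_eq_fourierMultiplierCLM, SchwartzMap.fourierMultiplierCLM_apply,
    FourierTransform.fourier_smul, FourierTransform.fourier_fourierInv_eq, smul_apply,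
    SchwartzMap.smulLeftCLM_apply_apply (by fun_prop)]
  simp only [smul_smul]
  congr 1
  ring

open FourierTransform in
theorem fourier_lineDeriv_single_apply {d : ℕ} (f : 𝓢(Space d, ℂ)) (j : Fin d) (ξ : Space d) :
    ‖𝓕 (∂_{(EuclideanSpace.single j 1 : Space d)} f) ξ‖ ^ 2 =
      (2 * Real.pi) ^ 2 * (ξ j ^ 2 * ‖𝓕 f ξ‖ ^ 2) := by
  rw [SchwartzMap.fourier_lineDerivOp_eq, smul_apply,
    SchwartzMap.smulLeftCLM_apply_apply (by fun_prop)]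
  simp [mul_pow, EuclideanSpace.inner_single_right]

theorem SchwartzMap.integrable_norm_sq {d : ℕ} (f : 𝓢(Space d, ℂ)) :
    MeasureTheory.Integrable fun x => ‖f x‖ ^ 2 :=
  (f.memLp 2).integrable_norm_pow two_ne_zero

open FourierTransform in
/-- The energy on the Fourier side. -/
theorem energy_eq_fourier {d : ℕ} (f g : 𝓢(Space d, ℂ)) :
    energy f g = (1 / 2) * ∫ ξ, ((2 * Real.pi * ‖ξ‖) ^ 2 * ‖𝓕 f ξ‖ ^ 2 + ‖𝓕 g ξ‖ ^ 2) := by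
  have h1 : ∀ j : Fin d, MeasureTheory.Integrable fun x =>
      ‖(∂_{(EuclideanSpace.single j 1 : Space d)} f) x‖ ^ 2 := fun j =>
    SchwartzMap.integrable_norm_sq _
  have h2 : ∀ j : Fin d, MeasureTheory.Integrable fun x =>
      ‖𝓕 (∂_{(EuclideanSpace.single j 1 : Space d)} f) x‖ ^ 2 := fun j =>
    SchwartzMap.integrable_norm_sq _
  have h3 : ∀ ξ : Space d, (2 * Real.pi * ‖ξ‖) ^ 2 * ‖𝓕 f ξ‖ ^ 2 =
      ∑ j, ‖𝓕 (∂_{(EuclideanSpace.single j 1 : Space d)} f) ξ‖ ^ 2 := fun ξ => by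
    simp only [fourier_lineDeriv_single_apply, ← Finset.mul_sum, ← Finset.sum_mul]
    rw [mul_pow, EuclideanSpace.norm_sq_eq]
    simp only [Real.norm_eq_abs, sq_abs]
    ring
  simp only [h3]
  rw [energy, MeasureTheory.integral_add (MeasureTheory.integrable_finsetSum _ fun j _ => h1 j)
    (SchwartzMap.integrable_norm_sq _), MeasureTheory.integral_add
    (MeasureTheory.integrable_finsetSum _ fun j _ => h2 j) (SchwartzMap.integrable_norm_sq _),
    MeasureTheory.integral_finsetSum _ fun j _ => h1 j,
    MeasureTheory.integral_finsetSum _ fun j _ => h2 j]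
  simp only [SchwartzMap.integral_norm_sq_fourier]

open FourierTransform in
/-- Band-limited data with a common Fourier profile launched at time `t₀` give a Schwartz-valued
solution, which is computed frequency by frequency. -/
theorem exists_wave_curve {d : ℕ} {a : ℝ → ℝ} (hA : Continuous fun t => a t ^ 2) {K : ℝ}
    (hK : ∀ t, |a t ^ 2| ≤ K) (t₀ x y : ℝ) (χ : 𝓢(Space d, ℂ)) (hχ : HasCompactSupport χ) :
    ∃ u v : ℝ → 𝓢(Space d, ℂ), (∀ t s, HasDerivWithinAt u (v t) s t) ∧
      (∀ t s, HasDerivWithinAt v ((a t ^ 2) • Δ (u t)) s t) ∧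
      (∀ t ξ, 𝓕 (u t) ξ =
        odeSol (fun t => a t ^ 2) t₀ x y (-(2 * Real.pi * ‖ξ‖) ^ 2) t • χ ξ) ∧
      ∀ t ξ, 𝓕 (v t) ξ =
        odeSolDeriv (fun t => a t ^ 2) t₀ x y (-(2 * Real.pi * ‖ξ‖) ^ 2) t • χ ξ := by
  set A : ℝ → ℝ := fun t => a t ^ 2
  set P : Space d → ℝ := fun ξ => -(2 * Real.pi * ‖ξ‖) ^ 2 with hPdef
  have hPt : P.HasTemperateGrowth := by
    have : P = fun ξ => -(2 * Real.pi) ^ 2 * ‖ξ‖ ^ 2 := by ext ξ; simp only [hPdef]; ring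
    rw [this]
    fun_prop
  -- The parameter of the power series is `z = P ξ = -(2π‖ξ‖)²`, so the series for the solution at
  -- all frequencies at once is `∑ (odeTerm n)(t) • Pⁿ χ`.
  set f : ℕ → 𝓢(Space d, ℂ) := fun n => (SchwartzMap.smulLeftCLM ℂ P)^[n] χ with hf
  have hfs : ∀ n ξ, f (n + 1) ξ = P ξ • f n ξ := fun n ξ => by
    simp only [hf, Function.iterate_succ_apply']
    rw [SchwartzMap.smulLeftCLM_apply_apply hPt]
  have hfn : ∀ n ξ, f n ξ = P ξ ^ n • χ ξ := by
    intro n ξ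
    induction n with
    | zero => simp [hf]
    | succ n ih => rw [hfs, ih, smul_smul, pow_succ']
  have hfb : ∀ k l, ∃ B R : ℝ, ∀ n, SchwartzMap.seminorm ℝ k l (f n) ≤ B * R ^ n :=
    SchwartzMap.exists_seminorm_le_geometric hPt.1 hfs hχ
  have hbd := exists_odeTerm_bound hA hK x y t₀
  have hS0 : ∀ t k l, Summable fun n =>
      SchwartzMap.seminorm ℝ k l ((odeTerm A t₀ x y n).1 t • f n) := fun t => by
    obtain ⟨C, M, -, -, h⟩ := hbd |t - t₀|
    exact SchwartzMap.summable_seminorm_smul hfb fun n => (h n t le_rfl).1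
  have hS1 : ∀ t k l, Summable fun n =>
      SchwartzMap.seminorm ℝ k l ((odeTerm A t₀ x y n).2 t • f n) := fun t => by
    obtain ⟨C, M, -, -, h⟩ := hbd |t - t₀|
    exact SchwartzMap.summable_seminorm_smul hfb fun n => (h n t le_rfl).2.1
  have hS2 : ∀ t k l, Summable fun n =>
      SchwartzMap.seminorm ℝ k l (odeTermDeriv A t₀ x y n t • f n) := fun t => by
    obtain ⟨C, M, -, -, h⟩ := hbd |t - t₀|
    exact SchwartzMap.summable_seminorm_smul hfb fun n => (h n t le_rfl).2.2
  set U : ℝ → 𝓢(Space d, ℂ) := fun t => SchwartzMap.absTsum _ (hS0 t) with hU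
  set V : ℝ → 𝓢(Space d, ℂ) := fun t => SchwartzMap.absTsum _ (hS1 t) with hV
  set W : ℝ → 𝓢(Space d, ℂ) := fun t => SchwartzMap.absTsum _ (hS2 t) with hW
  have hUd : ∀ t s, HasDerivWithinAt U (V t) s t := fun t s =>
    SchwartzMap.hasDerivWithinAt_absTsum hfb (fun n t => hasDerivAt_odeTerm_fst hA n t)
      (fun T => (hbd T).imp fun C h => h.imp fun M h n t ht => (h.2.2 n t ht).2.1) hS0 hS1 s t
  have hVd : ∀ t s, HasDerivWithinAt V (W t) s t := fun t s =>
    SchwartzMap.hasDerivWithinAt_absTsum hfb (fun n t => hasDerivAt_odeTerm_snd hA n t)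
      (fun T => (hbd T).imp fun C h => h.imp fun M h n t ht => (h.2.2 n t ht).2.2) hS1 hS2 s t
  have hUx : ∀ t ξ, U t ξ = odeSol A t₀ x y (P ξ) t • χ ξ := fun t ξ => by
    have hs := summable_odeTerm_fst (𝕜 := ℝ) (t₀ := t₀) (x := x) (y := y) hA hK (P ξ) t
    simp only [RCLike.ofReal_real_eq_id, id] at hs
    simp only [hU, SchwartzMap.absTsum_apply, smul_apply, hfn, odeSol, RCLike.ofReal_real_eq_id, id]
    rw [← hs.tsum_smul_const]
    simp only [smul_smul]
  have hVx : ∀ t ξ, V t ξ = odeSolDeriv A t₀ x y (P ξ) t • χ ξ := fun t ξ => by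
    have hs := summable_odeTerm_snd (𝕜 := ℝ) (t₀ := t₀) (x := x) (y := y) hA hK (P ξ) t
    simp only [RCLike.ofReal_real_eq_id, id] at hs
    simp only [hV, SchwartzMap.absTsum_apply, smul_apply, hfn, odeSolDeriv,
      RCLike.ofReal_real_eq_id, id]
    rw [← hs.tsum_smul_const]
    simp only [smul_smul]
  have hWx : ∀ t ξ, W t ξ = (A t * P ξ) • U t ξ := fun t ξ => by
    have hs := SchwartzMap.summable_apply (hS2 t) ξ
    have hs0 := SchwartzMap.summable_apply (hS0 t) ξ
    simp only [smul_apply] at hs hs0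
    simp only [hU, hW, SchwartzMap.absTsum_apply, smul_apply]
    rw [hs.tsum_eq_zero_add, ← hs0.tsum_const_smul]
    simp only [odeTermDeriv, zero_smul, zero_add]
    refine tsum_congr fun n => ?_
    rw [hfs, smul_smul, smul_smul]
    congr 1
    ring
  set L : 𝓢(Space d, ℂ) →L[ℝ] 𝓢(Space d, ℂ) := fourierInvCLM ℝ 𝓢(Space d, ℂ)
  have hL : ∀ g, L g = 𝓕⁻ g := fun g => rfl
  have hLW : ∀ t, L (W t) = (a t ^ 2) • Δ (L (U t)) := fun t => by
    have h1 : 𝓕 (L (W t)) = 𝓕 ((a t ^ 2) • Δ (L (U t))) := by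
      ext ξ
      rw [FourierTransform.fourier_smul, smul_apply, fourier_laplacian_apply, hL, hL,
        FourierTransform.fourier_fourierInv_eq, FourierTransform.fourier_fourierInv_eq, hWx,
        smul_smul]
    have h2 := congrArg (fun g : 𝓢(Space d, ℂ) => (𝓕⁻ g : 𝓢(Space d, ℂ))) h1
    simpa using h2
  refine ⟨fun t => L (U t), fun t => L (V t), fun t s => (hUd t s).map_continuousLinearMap L,
    fun t s => ?_, fun t ξ => ?_, fun t ξ => ?_⟩
  · rw [← hLW]
    exact (hVd t s).map_continuousLinearMap L
  · simp only [hL]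
    rw [FourierTransform.fourier_fourierInv_eq, hUx]
  · simp only [hL]
    rw [FourierTransform.fourier_fourierInv_eq, hVx]

open FourierTransform in
/-- Schwartz solutions are determined by their data. -/
theorem IsWaveSolution.unique {d : ℕ} {a : ℝ → ℝ} {K : ℝ} (hK : ∀ t, |a t ^ 2| ≤ K)
    {u₀ u₁ : 𝓢(Space d, ℂ)} {u v u' v' : ℝ → 𝓢(Space d, ℂ)} (h : IsWaveSolution a u₀ u₁ u v)
    (h' : IsWaveSolution a u₀ u₁ u' v') {T : ℝ} (hT : 0 ≤ T) : u T = u' T ∧ v T = v' T := by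
  have key : ∀ ξ : Space d, 𝓕 (u T) ξ = 𝓕 (u' T) ξ ∧ 𝓕 (v T) ξ = 𝓕 (v' T) ξ := by
    intro ξ
    -- Evaluating the Fourier transform at `ξ` is continuous on the Schwartz space, hence commutes
    -- with time derivatives and reduces uniqueness to the scalar equation.
    set L : 𝓢(Space d, ℂ) →L[ℝ] ℂ :=
      ((BoundedContinuousFunction.evalCLM ℝ ξ).comp
        (SchwartzMap.toBoundedContinuousFunctionCLM ℝ (Space d) ℂ)).comp
        (fourierCLM ℝ 𝓢(Space d, ℂ)) with hLdef
    have hL : ∀ g, L g = 𝓕 g ξ := fun g => rfl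
    have hsub : Icc 0 T ⊆ Ici (0 : ℝ) := Icc_subset_Ici_self
    have dpos : ∀ {u v : ℝ → 𝓢(Space d, ℂ)}, IsWaveSolution a u₀ u₁ u v → ∀ t ∈ Icc 0 T,
        HasDerivWithinAt (fun t => L (u t)) (L (v t)) (Icc 0 T) t := fun h t ht =>
      ((h.deriv_pos t ht.1).map_continuousLinearMap L).mono hsub
    have dvel : ∀ {u v : ℝ → 𝓢(Space d, ℂ)}, IsWaveSolution a u₀ u₁ u v → ∀ t ∈ Icc 0 T,
        HasDerivWithinAt (fun t => L (v t)) ((a t ^ 2 * -(2 * Real.pi * ‖ξ‖) ^ 2) • L (u t))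
          (Icc 0 T) t := fun h t ht => by
      have := ((h.deriv_vel t ht.1).map_continuousLinearMap L).mono hsub
      rwa [map_smul, hL (Δ _), fourier_laplacian_apply, ← hL, smul_smul] at this
    have := second_order_ode_unique (c := fun t => a t ^ 2 * -(2 * Real.pi * ‖ξ‖) ^ 2)
      (K := K * |-(2 * Real.pi * ‖ξ‖) ^ 2|) (fun t => by
        rw [abs_mul]; exact mul_le_mul_of_nonneg_right (hK t) (abs_nonneg _))
      (dpos h) (dvel h) (dpos h') (dvel h') (by rw [h.init_pos, h'.init_pos])
      (by rw [h.init_vel, h'.init_vel]) (right_mem_Icc.2 hT)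
    exact this
  have inj : ∀ f g : 𝓢(Space d, ℂ), (∀ ξ, 𝓕 f ξ = 𝓕 g ξ) → f = g := fun f g hfg => by
    have h1 : 𝓕 f = 𝓕 g := SchwartzMap.ext hfg
    have h2 := congrArg (fun g : 𝓢(Space d, ℂ) => (𝓕⁻ g : 𝓢(Space d, ℂ))) h1
    simpa using h2
  exact ⟨inj _ _ fun ξ => (key ξ).1, inj _ _ fun ξ => (key ξ).2⟩

/-- Serves for sums of pulses with disjoint supports: at each point the bound for a single pulse
bounds the sum. -/
theorem abs_sum_le_of_subsingleton {ι : Type*} {s : Finset ι} {f : ι → ℝ} {B : ℝ} (hB : 0 ≤ B)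
    (hle : ∀ i ∈ s, |f i| ≤ B) (hu : ∀ i ∈ s, ∀ j ∈ s, f i ≠ 0 → f j ≠ 0 → i = j) :
    |∑ i ∈ s, f i| ≤ B := by
  by_cases h : ∃ i ∈ s, f i ≠ 0
  · obtain ⟨i, hi, hne⟩ := h
    rw [Finset.sum_eq_single_of_mem i hi fun j hj hji => by
      by_contra hne'
      exact hji (hu j hj i hi hne' hne)]
    exact hle i hi
  · push Not at h
    rwa [Finset.sum_eq_zero h, abs_zero]

/-! ### The profile, its periodisation and finite pulse trains -/

section Profile

variable {φ : ℝ → ℝ}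

theorem IsProfile.iteratedDeriv_eq_zero (hφ : IsProfile φ) (l : ℕ) {x : ℝ}
    (hx : x ∉ Ioo (0 : ℝ) 1) : iteratedDeriv l φ x = 0 := by
  have h : φ =ᶠ[𝓝 x] fun _ => 0 :=
    notMem_tsupport_iff_eventuallyEq.1 fun h => hx (hφ.support h)
  rw [h.iteratedDeriv_eq]
  simp

theorem IsProfile.eq_zero (hφ : IsProfile φ) {x : ℝ} (hx : x ∉ Ioo (0 : ℝ) 1) : φ x = 0 := by
  simpa using hφ.iteratedDeriv_eq_zero 0 hx

theorem IsProfile.deriv_eq_zero (hφ : IsProfile φ) {x : ℝ} (hx : x ∉ Ioo (0 : ℝ) 1) :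
    deriv φ x = 0 := by
  simpa using hφ.iteratedDeriv_eq_zero 1 hx

theorem IsProfile.exists_iteratedDeriv_bound (hφ : IsProfile φ) (l : ℕ) :
    ∃ C : ℝ, 0 ≤ C ∧ ∀ x, |iteratedDeriv l φ x| ≤ C := by
  obtain ⟨C, hC⟩ := isCompact_Icc.exists_bound_of_continuousOn (s := Icc (0 : ℝ) 1)
    (hφ.smooth.continuous_iteratedDeriv l (by exact_mod_cast le_top)).continuousOn
  refine ⟨C, (norm_nonneg _).trans (hC 0 (by simp)), fun x => ?_⟩
  by_cases hx : x ∈ Icc (0 : ℝ) 1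
  · exact hC x hx
  · rw [hφ.iteratedDeriv_eq_zero l fun h => hx (Ioo_subset_Icc_self h), abs_zero]
    exact (norm_nonneg _).trans (hC 0 (by simp))

theorem IsProfile.exists_lower_bound (hφ : IsProfile φ) : ∃ m : ℝ, 0 < m ∧ ∀ x, m ≤ 1 + φ x := by
  obtain ⟨x₀, -, hx₀⟩ := isCompact_Icc.exists_isMinOn (s := Icc (0 : ℝ) 1) (by simp)
    hφ.smooth.continuous.continuousOn
  have h1 := (abs_lt.1 (hφ.abs_lt_one x₀)).1
  have h0 : φ x₀ ≤ 0 := (hx₀ (show (0 : ℝ) ∈ Icc (0 : ℝ) 1 by simp)).trans_eq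
    (hφ.eq_zero (by simp))
  refine ⟨1 + φ x₀, by linarith, fun x => ?_⟩
  by_cases hx : x ∈ Icc (0 : ℝ) 1
  · have : φ x₀ ≤ φ x := hx₀ hx
    linarith
  · rw [hφ.eq_zero fun h => hx (Ioo_subset_Icc_self h)]
    linarith

/-- The right endpoint may be included, although the floor jumps there, because `φ` vanishes at both
`0` and `1`. -/
theorem periodisation_of_mem (hφ : IsProfile φ) {j : ℤ} {s : ℝ} (hs : s ∈ Icc (j : ℝ) (j + 1)) :
    periodisation φ s = φ (s - j) := by
  rcases hs.2.lt_or_eq with h | h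
  · rw [periodisation, Int.floor_eq_iff.2 ⟨hs.1, h⟩]
  · have h1 : ⌊s⌋ = j + 1 := by rw [h]; exact_mod_cast Int.floor_intCast (j + 1)
    rw [periodisation, h1, h]
    push_cast
    rw [hφ.eq_zero (x := (j : ℝ) + 1 - (j + 1)) (by simp), hφ.eq_zero (by simp)]

theorem hasDerivAt_periodisation (hφ : IsProfile φ) (s : ℝ) :
    HasDerivAt (periodisation φ) (deriv φ (s - ⌊s⌋)) s := by
  set m : ℤ := ⌊s⌋ with hm
  have h1 : (m : ℝ) ≤ s := Int.floor_le s
  have h2 : s < m + 1 := Int.lt_floor_add_one s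
  -- When `s` is an integer a neighbourhood meets two cells; the sum of the two adjacent translates
  -- covers this case as well as the interior one.
  have hev : periodisation φ =ᶠ[𝓝 s] fun t => φ (t - m) + φ (t - (m - 1)) := by
    filter_upwards [Ioo_mem_nhds (by linarith : (m : ℝ) - 1 < s) h2] with t ht
    rcases le_total (m : ℝ) t with h | h
    · rw [periodisation_of_mem hφ ⟨h, ht.2.le⟩, hφ.eq_zero (x := t - (m - 1)), add_zero]
      simp only [mem_Ioo, not_and, not_lt]
      intro _; linarith
    · rw [periodisation_of_mem hφ (j := m - 1) (by push_cast; exact ⟨ht.1.le, by linarith⟩),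
        hφ.eq_zero (x := t - m), zero_add]
      · push_cast; rfl
      · simp only [mem_Ioo, not_and, not_lt]
        intro h'; linarith
  have hd : ∀ x, HasDerivAt φ (deriv φ x) x := fun x =>
    ((hφ.smooth.differentiable (by simp)) x).hasDerivAt
  have h3 := ((hd (s - m)).comp_sub_const s m).add ((hd (s - (m - 1))).comp_sub_const s (m - 1))
  have h4 : deriv φ (s - (m - 1)) = 0 := by
    refine hφ.deriv_eq_zero ?_
    simp only [mem_Ioo, not_and, not_lt]
    intro _; linarith
  rw [h4, add_zero] at h3
  exact h3.congr_of_eventuallyEq hev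

theorem exists_isLUB_logDeriv (hφ : IsProfile φ) : ∃ c : ℝ, 0 < c ∧
    IsLUB (Set.range fun s : ℝ => |deriv (periodisation φ) s| / (1 + periodisation φ s)) c := by
  obtain ⟨m, hm, hmφ⟩ := hφ.exists_lower_bound
  obtain ⟨C, hC0, hC⟩ := hφ.exists_iteratedDeriv_bound 1
  simp only [iteratedDeriv_one] at hC
  have hpos : ∀ s, 0 < 1 + periodisation φ s := fun s => hm.trans_le (hmφ _)
  have hlub := isLUB_csSup (s := Set.range fun s : ℝ =>
    |deriv (periodisation φ) s| / (1 + periodisation φ s)) (range_nonempty _) ⟨C / m, by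
      rintro _ ⟨s, rfl⟩
      simp only
      rw [(hasDerivAt_periodisation hφ s).deriv]
      exact div_le_div₀ hC0 (hC _) hm (hmφ _)⟩
  refine ⟨_, ?_, hlub⟩
  obtain ⟨x, hx⟩ : ∃ x, deriv φ x ≠ 0 := by
    by_contra! h
    refine hφ.ne_zero (funext fun x => ?_)
    rw [is_const_of_deriv_eq_zero (hφ.smooth.differentiable (by simp)) h x 0,
      hφ.eq_zero (by simp)]
    rfl
  have hx1 : x ∈ Ioo (0 : ℝ) 1 := by
    by_contra h
    exact hx (hφ.deriv_eq_zero h)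
  have hfl : ⌊x⌋ = 0 := Int.floor_eq_iff.2 ⟨by simpa using hx1.1.le, by simpa using hx1.2⟩
  have h1 : deriv (periodisation φ) x = deriv φ x := by
    rw [(hasDerivAt_periodisation hφ x).deriv, hfl]; simp
  refine lt_of_lt_of_le ?_ (hlub.1 ⟨x, rfl⟩)
  simp only [h1]
  exact div_pos (abs_pos.2 hx) (hpos x)

/-- The sum of `n` consecutive translates of `φ`. -/
noncomputable def pulseTrain (φ : ℝ → ℝ) (n : ℕ) (s : ℝ) : ℝ := ∑ j ∈ Finset.range n, φ (s - j)

theorem sub_natCast_mem_Ioo_unique {s : ℝ} {i j : ℕ} (hi : s - i ∈ Ioo (0 : ℝ) 1)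
    (hj : s - j ∈ Ioo (0 : ℝ) 1) : i = j := by
  have h1 : (i : ℝ) < j + 1 := by linarith [hi.1, hj.2]
  have h2 : (j : ℝ) < i + 1 := by linarith [hj.1, hi.2]
  have h3 : i < j + 1 := by exact_mod_cast h1
  have h4 : j < i + 1 := by exact_mod_cast h2
  omega

theorem contDiff_pulseTrain (hφ : IsProfile φ) (n : ℕ) : ContDiff ℝ ∞ (pulseTrain φ n) :=
  ContDiff.sum fun _ _ => hφ.smooth.comp (contDiff_id.sub contDiff_const)

theorem iteratedDeriv_pulseTrain (hφ : IsProfile φ) (n l : ℕ) (s : ℝ) :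
    iteratedDeriv l (pulseTrain φ n) s = ∑ j ∈ Finset.range n, iteratedDeriv l φ (s - j) := by
  have h : pulseTrain φ n = fun s => ∑ j ∈ Finset.range n, φ (s - j) := rfl
  have h2 : ∀ j ∈ Finset.range n, ContDiffAt ℝ l (fun s => φ (s - (j : ℝ))) s := fun j _ =>
    ((hφ.smooth.of_le (by exact_mod_cast le_top)).comp
      (contDiff_id.sub contDiff_const)).contDiffAt
  rw [h, iteratedDeriv_fun_sum (f := fun (j : ℕ) s => φ (s - (j : ℝ))) h2]
  exact Finset.sum_congr rfl fun j _ => congrFun (iteratedDeriv_comp_sub_const l φ (j : ℝ)) s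

theorem abs_iteratedDeriv_pulseTrain_le (hφ : IsProfile φ) {l : ℕ} {C : ℝ} (hC0 : 0 ≤ C)
    (hC : ∀ x, |iteratedDeriv l φ x| ≤ C) (n : ℕ) (s : ℝ) :
    |iteratedDeriv l (pulseTrain φ n) s| ≤ C := by
  rw [iteratedDeriv_pulseTrain hφ]
  refine abs_sum_le_of_subsingleton hC0 (fun j _ => hC _) fun i _ j _ hi hj => ?_
  refine sub_natCast_mem_Ioo_unique (s := s) ?_ ?_
  · by_contra h; exact hi (hφ.iteratedDeriv_eq_zero l h)
  · by_contra h; exact hj (hφ.iteratedDeriv_eq_zero l h)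

theorem iteratedDeriv_pulseTrain_eq_zero (hφ : IsProfile φ) (n l : ℕ) {s : ℝ}
    (hs : s ∉ Icc (0 : ℝ) n) : iteratedDeriv l (pulseTrain φ n) s = 0 := by
  rw [iteratedDeriv_pulseTrain hφ]
  refine Finset.sum_eq_zero fun j hj => hφ.iteratedDeriv_eq_zero l fun h => hs ?_
  have hj' : (j : ℝ) + 1 ≤ n := by exact_mod_cast Finset.mem_range.1 hj
  have := Nat.cast_nonneg (α := ℝ) j
  exact ⟨by linarith [h.1], by linarith [h.2]⟩

theorem pulseTrain_of_mem (hφ : IsProfile φ) {n : ℕ} {s : ℝ} (hs : s ∈ Icc (0 : ℝ) n) :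
    pulseTrain φ n s = periodisation φ s := by
  have h0 : 0 ≤ ⌊s⌋ := Int.floor_nonneg.2 hs.1
  obtain ⟨m, hm⟩ := Int.eq_ofNat_of_zero_le h0
  have hm' : (⌊s⌋ : ℝ) = m := by rw [hm]; simp
  have h1 : (m : ℝ) ≤ s := hm' ▸ Int.floor_le s
  have h2 : s < m + 1 := hm' ▸ Int.lt_floor_add_one s
  rw [pulseTrain, periodisation, hm']
  refine Finset.sum_eq_single m (fun j _ hjm => ?_) fun hmn => ?_
  · by_contra hne
    by_cases hms : s - m ∈ Ioo (0 : ℝ) 1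
    · refine hjm (sub_natCast_mem_Ioo_unique (s := s) ?_ hms)
      by_contra h; exact hne (hφ.eq_zero h)
    · have hsm : s = m := by
        by_contra h
        exact hms ⟨sub_pos.2 (lt_of_le_of_ne h1 (Ne.symm h)), by linarith⟩
      refine hne (hφ.eq_zero ?_)
      rw [hsm]
      rintro ⟨h3, h4⟩
      have h5 : (j : ℝ) < m := by linarith
      have h6 : (m : ℝ) < j + 1 := by linarith
      have h7 : j < m := by exact_mod_cast h5
      have h8 : m < j + 1 := by exact_mod_cast h6
      omega
  · have hnm : (n : ℝ) ≤ m := by exact_mod_cast not_lt.1 fun h => hmn (Finset.mem_range.2 h)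
    refine hφ.eq_zero ?_
    rintro ⟨h3, -⟩
    linarith [hs.2]

end Profile

/-! ### Smoothness and bounds of the coefficient -/

section Coefficient

variable {φ : ℝ → ℝ} {τ δ : ℕ → ℝ} {n : ℕ → ℕ}

theorem IsAdmissible.add_lt (h : IsAdmissible τ δ n) {i j : ℕ} (hi : 1 ≤ i) (hij : i < j) :
    τ i + δ i < τ j := by
  induction j, hij using Nat.le_induction with
  | base => exact h.separated i hi
  | succ j hj ih =>
    have h1 := h.separated j (by omega)
    have h2 := h.length_pos j (by omega)
    linarith

theorem IsAdmissible.mem_unique (h : IsAdmissible τ δ n) {i j : ℕ} (hi : 1 ≤ i) (hj : 1 ≤ j)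
    {t : ℝ} (hti : t ∈ Icc (τ i) (τ i + δ i)) (htj : t ∈ Icc (τ j) (τ j + δ j)) : i = j := by
  rcases lt_trichotomy i j with hij | hij | hij
  · linarith [h.add_lt hi hij, hti.2, htj.1]
  · exact hij
  · linarith [h.add_lt hj hij, htj.2, hti.1]

theorem coefficient_of_notMem {t : ℝ} (ht : ∀ k, 1 ≤ k → t ∉ Icc (τ k) (τ k + δ k)) :
    coefficient φ τ δ n t = 1 := by
  unfold coefficient
  rw [dif_neg]
  rintro ⟨k, hk, htk⟩
  exact ht k hk htk

/-- The contribution of the `k`-th interval to the coefficient. -/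
noncomputable def coefficientPulse (φ : ℝ → ℝ) (τ δ : ℕ → ℝ) (n : ℕ → ℕ) (k : ℕ) (t : ℝ) : ℝ :=
  pulseTrain φ (n k) ((n k : ℝ) / δ k * (t - τ k))

theorem IsAdmissible.scale_mem_iff (h : IsAdmissible τ δ n) {k : ℕ} (hk : 1 ≤ k) (t : ℝ) :
    (n k : ℝ) / δ k * (t - τ k) ∈ Icc (0 : ℝ) (n k) ↔ t ∈ Icc (τ k) (τ k + δ k) := by
  have hδ := h.length_pos k hk
  have hn : (0 : ℝ) < n k := by exact_mod_cast h.count_pos k hk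
  have hr : 0 < (n k : ℝ) / δ k := div_pos hn hδ
  simp only [mem_Icc]
  constructor
  · rintro ⟨h1, h2⟩
    have h3 := nonneg_of_mul_nonneg_right h1 hr
    rw [div_mul_eq_mul_div, div_le_iff₀ hδ] at h2
    have h4 := le_of_mul_le_mul_left h2 hn
    exact ⟨by linarith, by linarith⟩
  · rintro ⟨h1, h2⟩
    refine ⟨mul_nonneg hr.le (by linarith), ?_⟩
    rw [div_mul_eq_mul_div, div_le_iff₀ hδ]
    exact mul_le_mul_of_nonneg_left (by linarith) hn.le

theorem contDiff_coefficientPulse (hφ : IsProfile φ) (k : ℕ) :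
    ContDiff ℝ ∞ (coefficientPulse φ τ δ n k) :=
  (contDiff_pulseTrain hφ (n k)).comp (contDiff_const.mul (contDiff_id.sub contDiff_const))

theorem iteratedDeriv_coefficientPulse (hφ : IsProfile φ) (k l : ℕ) (t : ℝ) :
    iteratedDeriv l (coefficientPulse φ τ δ n k) t =
      ((n k : ℝ) / δ k) ^ l * iteratedDeriv l (pulseTrain φ (n k))
        ((n k : ℝ) / δ k * (t - τ k)) := by
  have h1 := iteratedDeriv_comp_sub_const l
    (fun s => pulseTrain φ (n k) ((n k : ℝ) / δ k * s)) (τ k)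
  have h2 := iteratedDeriv_comp_const_mul (n := l)
    ((contDiff_pulseTrain hφ (n k)).of_le (by exact_mod_cast le_top)) ((n k : ℝ) / δ k)
  have h3 := congrFun h1 t
  rw [h2] at h3
  exact h3

theorem iteratedDeriv_coefficientPulse_eq_zero (hφ : IsProfile φ) (h : IsAdmissible τ δ n)
    {k : ℕ} (hk : 1 ≤ k) (l : ℕ) {t : ℝ} (ht : t ∉ Icc (τ k) (τ k + δ k)) :
    iteratedDeriv l (coefficientPulse φ τ δ n k) t = 0 := by
  rw [iteratedDeriv_coefficientPulse hφ, iteratedDeriv_pulseTrain_eq_zero hφ, mul_zero]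
  rwa [h.scale_mem_iff hk]

theorem coefficientPulse_of_mem (hφ : IsProfile φ) (h : IsAdmissible τ δ n)
    {k : ℕ} (hk : 1 ≤ k) {t : ℝ} (ht : t ∈ Icc (τ k) (τ k + δ k)) :
    coefficientPulse φ τ δ n k t = periodisation φ ((n k : ℝ) / δ k * (t - τ k)) :=
  pulseTrain_of_mem hφ ((h.scale_mem_iff hk t).2 ht)

/-- As `τ` tends to infinity, only finitely many intervals meet a left half-line. There the
piecewise definition becomes a finite sum of globally smooth pulses, which yields smoothness across
the interval endpoints. -/
theorem coefficient_eq_sum (hφ : IsProfile φ) (h : IsAdmissible τ δ n) (T : ℝ) :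
    ∃ N : ℕ, ∀ t < T, coefficient φ τ δ n t =
      1 + ∑ k ∈ Finset.Ico 1 N, coefficientPulse φ τ δ n k t := by
  obtain ⟨N, hN⟩ := (h.tendsto.eventually_ge_atTop T).exists_forall_of_atTop
  refine ⟨N, fun t ht => ?_⟩
  have hz : ∀ k, 1 ≤ k → t ∉ Icc (τ k) (τ k + δ k) → coefficientPulse φ τ δ n k t = 0 :=
    fun k hk hkt => by
      simpa using iteratedDeriv_coefficientPulse_eq_zero hφ h hk 0 hkt
  by_cases hex : ∃ k, 1 ≤ k ∧ t ∈ Icc (τ k) (τ k + δ k)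
  · obtain ⟨k, hk, hkt⟩ := hex
    have hkN : k < N := by
      by_contra! hle
      linarith [hN k hle, hkt.1]
    rw [coefficient_of_mem h hk hkt, Finset.sum_eq_single_of_mem k (Finset.mem_Ico.2 ⟨hk, hkN⟩),
      coefficientPulse_of_mem hφ h hk hkt]
    intro j hj hjk
    refine hz j (Finset.mem_Ico.1 hj).1 fun hjt => hjk ?_
    exact h.mem_unique (Finset.mem_Ico.1 hj).1 hk hjt hkt
  · push Not at hex
    rw [coefficient_of_notMem hex, Finset.sum_eq_zero, add_zero]
    exact fun k hk => hz k (Finset.mem_Ico.1 hk).1 (hex k (Finset.mem_Ico.1 hk).1)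

theorem contDiff_coefficient (hφ : IsProfile φ) (h : IsAdmissible τ δ n) :
    ContDiff ℝ ∞ (coefficient φ τ δ n) := by
  refine contDiff_iff_contDiffAt.2 fun t => ?_
  obtain ⟨N, hN⟩ := coefficient_eq_sum hφ h (t + 1)
  have hev : coefficient φ τ δ n =ᶠ[𝓝 t]
      fun t => 1 + ∑ k ∈ Finset.Ico 1 N, coefficientPulse φ τ δ n k t := by
    filter_upwards [Iio_mem_nhds (lt_add_one t)] with s hs using hN s hs
  refine ContDiffAt.congr_of_eventuallyEq ?_ hev
  exact (contDiff_const.add (ContDiff.sum fun k _ => contDiff_coefficientPulse hφ k)).contDiffAt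

/-- At most one pulse contributes at a given time, and the chain rule gives it the factor `(n k / δ
k) ^ l`. Positive order removes the constant `1`. -/
theorem abs_iteratedDeriv_coefficient_le (hφ : IsProfile φ) (h : IsAdmissible τ δ n) {l : ℕ}
    (hl : 0 < l) {C : ℝ} (hC0 : 0 ≤ C) (hC : ∀ x, |iteratedDeriv l φ x| ≤ C) {t B : ℝ}
    (hB0 : 0 ≤ B)
    (hB : ∀ k, 1 ≤ k → t ∈ Icc (τ k) (τ k + δ k) → ((n k : ℝ) / δ k) ^ l * C ≤ B) :
    |iteratedDeriv l (coefficient φ τ δ n) t| ≤ B := by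
  obtain ⟨N, hN⟩ := coefficient_eq_sum hφ h (t + 1)
  have hev : coefficient φ τ δ n =ᶠ[𝓝 t]
      fun t => 1 + ∑ k ∈ Finset.Ico 1 N, coefficientPulse φ τ δ n k t := by
    filter_upwards [Iio_mem_nhds (lt_add_one t)] with s hs using hN s hs
  have hmem : ∀ k ∈ Finset.Ico 1 N, iteratedDeriv l (coefficientPulse φ τ δ n k) t ≠ 0 →
      1 ≤ k ∧ t ∈ Icc (τ k) (τ k + δ k) := fun k hk hne => by
    refine ⟨(Finset.mem_Ico.1 hk).1, ?_⟩
    by_contra hkt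
    exact hne (iteratedDeriv_coefficientPulse_eq_zero hφ h (Finset.mem_Ico.1 hk).1 l hkt)
  rw [hev.iteratedDeriv_eq, iteratedDeriv_const_add hl, iteratedDeriv_fun_sum fun k _ =>
    ((contDiff_coefficientPulse hφ k).of_le (by exact_mod_cast le_top)).contDiffAt]
  refine abs_sum_le_of_subsingleton hB0 (fun k hk => ?_) fun i hi j hj hi' hj' =>
    h.mem_unique (hmem i hi hi').1 (hmem j hj hj').1 (hmem i hi hi').2 (hmem j hj hj').2
  by_cases hne : iteratedDeriv l (coefficientPulse φ τ δ n k) t = 0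
  · rwa [hne, abs_zero]
  · obtain ⟨hk1, hkt⟩ := hmem k hk hne
    refine le_trans ?_ (hB k hk1 hkt)
    have hr : 0 ≤ (n k : ℝ) / δ k := div_nonneg (Nat.cast_nonneg _) (h.length_pos k hk1).le
    rw [iteratedDeriv_coefficientPulse hφ, abs_mul, abs_of_nonneg (pow_nonneg hr l)]
    exact mul_le_mul_of_nonneg_left (abs_iteratedDeriv_pulseTrain_le hφ hC0 hC _ _)
      (pow_nonneg hr l)

theorem exists_coefficient_bounds (hφ : IsProfile φ) (h : IsAdmissible τ δ n) :
    ∃ m : ℝ, 0 < m ∧ ∀ t, m ≤ coefficient φ τ δ n t ∧ coefficient φ τ δ n t < 2 := by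
  obtain ⟨m, hm, hmφ⟩ := hφ.exists_lower_bound
  refine ⟨m, hm, fun t => ?_⟩
  by_cases hex : ∃ k, 1 ≤ k ∧ t ∈ Icc (τ k) (τ k + δ k)
  · obtain ⟨k, hk, hkt⟩ := hex
    rw [coefficient_of_mem h hk hkt]
    refine ⟨hmφ _, ?_⟩
    have := (abs_lt.1 (hφ.abs_lt_one ((n k : ℝ) / δ k * (t - τ k) -
      (⌊(n k : ℝ) / δ k * (t - τ k)⌋ : ℝ)))).2
    rw [periodisation]
    linarith
  · push Not at hex
    rw [coefficient_of_notMem hex]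
    refine ⟨?_, by norm_num⟩
    have := hmφ 0
    rwa [hφ.eq_zero (by simp), add_zero] at this

end Coefficient

/-! ### Energy loss before, and gain on, the resonant interval -/

/-- An energy estimate for `w'' = -ρ² a² w` between two points where `a = 1`. -/
theorem oscillator_energy_le {a w v : ℝ → ℝ} {ρ C s t : ℝ} (hst : s ≤ t) (hC : 0 ≤ C)
    (ha : Differentiable ℝ a) (hpos : ∀ r, 0 < a r) (hlog : ∀ r ∈ Ioo s t, |deriv a r| ≤ C * a r)
    (hw : ∀ r, HasDerivAt w (v r) r) (hv : ∀ r, HasDerivAt v (-ρ ^ 2 * a r ^ 2 * w r) r)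
    (has : a s = 1) (hat : a t = 1) :
    ρ ^ 2 * w s ^ 2 + v s ^ 2 ≤ Real.exp (2 * (C * (t - s))) * (ρ ^ 2 * w t ^ 2 + v t ^ 2) := by
  -- In the derivative of `ρ² a² w² + v²` the cross terms cancel, leaving `2 ρ² a a' w²`, at least
  -- `-2C` times the energy. The exponential weight makes the product nondecreasing; since `a = 1`
  -- at both ends, the weighted energy equals the plain one there.
  set g : ℝ → ℝ := fun r => (ρ ^ 2 * (a r ^ 2 * w r ^ 2) + v r ^ 2) * Real.exp (2 * C * (r - s))
    with hg
  have hd : ∀ r, HasDerivAt g ((2 * ρ ^ 2 * w r ^ 2 * (a r * (deriv a r + C * a r)) +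
      2 * C * v r ^ 2) * Real.exp (2 * C * (r - s))) r := fun r => by
    have h1 := (ha r).hasDerivAt
    have h2 := ((((h1.pow 2).mul ((hw r).pow 2)).const_mul (ρ ^ 2)).add ((hv r).pow 2)).mul
      ((((hasDerivAt_id r).sub_const s).const_mul (2 * C)).exp)
    refine (h2.congr_deriv ?_)
    simp
    ring
  have hmono : MonotoneOn g (Icc s t) := by
    refine monotoneOn_of_deriv_nonneg (convex_Icc s t)
      (fun r _ => (hd r).continuousAt.continuousWithinAt)
      (fun r _ => (hd r).differentiableAt.differentiableWithinAt) fun r hr => ?_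
    rw [interior_Icc] at hr
    rw [(hd r).deriv]
    have h1 : 0 ≤ deriv a r + C * a r := by linarith [(abs_le.1 (hlog r hr)).1]
    have h2 := hpos r
    positivity
  have h := hmono (left_mem_Icc.2 hst) (right_mem_Icc.2 hst) hst
  simp only [hg, has, hat, sub_self, mul_zero, Real.exp_zero] at h
  rw [← mul_assoc 2 C (t - s), mul_comm (Real.exp _)]
  linarith

section CoefficientEnergy

variable {φ : ℝ → ℝ} {τ δ : ℕ → ℝ} {n : ℕ → ℕ}

theorem periodisation_natCast (hφ : IsProfile φ) (m : ℕ) : periodisation φ m = 0 := by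
  have := periodisation_of_mem hφ (j := m) (s := m) (by simp)
  rw [this]
  simp [hφ.eq_zero (x := 0) (by simp)]

theorem coefficient_left (hφ : IsProfile φ) (h : IsAdmissible τ δ n) {k : ℕ} (hk : 1 ≤ k) :
    coefficient φ τ δ n (τ k) = 1 := by
  have hδ := h.length_pos k hk
  rw [coefficient_of_mem h hk ⟨le_rfl, by linarith⟩, sub_self, mul_zero]
  simpa using periodisation_natCast hφ 0

theorem coefficient_right (hφ : IsProfile φ) (h : IsAdmissible τ δ n) {k : ℕ} (hk : 1 ≤ k) :
    coefficient φ τ δ n (τ k + δ k) = 1 := by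
  have hδ := h.length_pos k hk
  rw [coefficient_of_mem h hk ⟨by linarith, le_rfl⟩, add_sub_cancel_left, div_mul_cancel₀ _ hδ.ne',
    periodisation_natCast hφ, add_zero]

theorem coefficient_pos (hφ : IsProfile φ) (h : IsAdmissible τ δ n) (t : ℝ) :
    0 < coefficient φ τ δ n t := by
  obtain ⟨m, hm, hb⟩ := exists_coefficient_bounds hφ h
  exact hm.trans_le (hb t).1

theorem abs_coefficient_sq_le (hφ : IsProfile φ) (h : IsAdmissible τ δ n) (t : ℝ) :
    |coefficient φ τ δ n t ^ 2| ≤ 4 := by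
  obtain ⟨m, hm, hb⟩ := exists_coefficient_bounds hφ h
  have h0 := coefficient_pos hφ h t
  rw [abs_of_nonneg (sq_nonneg _)]
  nlinarith [(hb t).2]

theorem deriv_coefficient_of_gap {s t : ℝ} (hgap : ∀ r ∈ Ioo s t, ∀ k, 1 ≤ k →
    r ∉ Icc (τ k) (τ k + δ k)) {r : ℝ} (hr : r ∈ Ioo s t) :
    deriv (coefficient φ τ δ n) r = 0 := by
  have h : coefficient φ τ δ n =ᶠ[𝓝 r] fun _ => 1 := by
    filter_upwards [Ioo_mem_nhds hr.1 hr.2] with x hx using coefficient_of_notMem (hgap x hx)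
  rw [h.deriv_eq, deriv_const]

theorem abs_deriv_coefficient_le (hφ : IsProfile φ) (h : IsAdmissible τ δ n) {c : ℝ}
    (hc : ∀ s, |deriv (periodisation φ) s| ≤ c * (1 + periodisation φ s)) {k : ℕ} (hk : 1 ≤ k)
    {r : ℝ} (hr : r ∈ Ioo (τ k) (τ k + δ k)) :
    |deriv (coefficient φ τ δ n) r| ≤ c * (n k / δ k) * coefficient φ τ δ n r := by
  have hev : coefficient φ τ δ n =ᶠ[𝓝 r]
      fun t => 1 + periodisation φ ((n k : ℝ) / δ k * (t - τ k)) := by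
    filter_upwards [Ioo_mem_nhds hr.1 hr.2] with x hx
      using coefficient_of_mem h hk (Ioo_subset_Icc_self hx)
  set x : ℝ := (n k : ℝ) / δ k * (r - τ k) with hx
  have hd : HasDerivAt (fun t => 1 + periodisation φ ((n k : ℝ) / δ k * (t - τ k)))
      (deriv (periodisation φ) x * ((n k : ℝ) / δ k * 1)) r :=
    (HasDerivAt.comp (h₂ := periodisation φ) r
      ((hasDerivAt_periodisation hφ x).differentiableAt.hasDerivAt)
      (((hasDerivAt_id r).sub_const (τ k)).const_mul _)).const_add 1
  have hr0 : 0 ≤ (n k : ℝ) / δ k := div_nonneg (Nat.cast_nonneg _) (h.length_pos k hk).le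
  rw [hev.deriv_eq, hd.deriv, hev.eq_of_nhds, abs_mul, mul_one, abs_of_nonneg hr0]
  calc _ ≤ c * (1 + periodisation φ x) * (n k / δ k) := mul_le_mul_of_nonneg_right (hc x) hr0
    _ = _ := by ring

/-- The energy at time `0` is controlled by the energy at the start of the `k`-th interval. -/
theorem energy_zero_le (hφ : IsProfile φ) (h : IsAdmissible τ δ n) {c : ℝ} (hc0 : 0 ≤ c)
    (hc : ∀ s, |deriv (periodisation φ) s| ≤ c * (1 + periodisation φ s)) {ρ : ℝ} {w v : ℝ → ℝ}
    (hw : ∀ r, HasDerivAt w (v r) r)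
    (hv : ∀ r, HasDerivAt v (-ρ ^ 2 * coefficient φ τ δ n r ^ 2 * w r) r) {k : ℕ} (hk : 1 ≤ k) :
    ρ ^ 2 * w 0 ^ 2 + v 0 ^ 2 ≤ Real.exp (2 * c * ∑ l ∈ Finset.Ico 1 k, (n l : ℝ)) *
      (ρ ^ 2 * w (τ k) ^ 2 + v (τ k) ^ 2) := by
  have hdiff : Differentiable ℝ (coefficient φ τ δ n) :=
    (contDiff_coefficient hφ h).differentiable (by simp)
  have hpos := coefficient_pos hφ h
  have hgap : ∀ {s t : ℝ}, s ≤ t →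
      (∀ r ∈ Ioo s t, ∀ k, 1 ≤ k → r ∉ Icc (τ k) (τ k + δ k)) →
      coefficient φ τ δ n s = 1 → coefficient φ τ δ n t = 1 →
      ρ ^ 2 * w s ^ 2 + v s ^ 2 ≤ ρ ^ 2 * w t ^ 2 + v t ^ 2 := fun hst hg hs ht => by
    have := oscillator_energy_le hst le_rfl hdiff hpos (fun r hr => by
      rw [deriv_coefficient_of_gap hg hr]; simp) hw hv hs ht
    simpa using this
  induction k, hk using Nat.le_induction with
  | base =>
    simp only [Finset.Ico_self, Finset.sum_empty, mul_zero, Real.exp_zero, one_mul]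
    have hlt : ∀ r < τ 1, ∀ k, 1 ≤ k → r ∉ Icc (τ k) (τ k + δ k) := fun r hr k hk hrk => by
      rcases hk.eq_or_lt with rfl | hk1
      · linarith [hrk.1]
      · linarith [hrk.1, h.add_lt le_rfl hk1, h.length_pos 1 le_rfl]
    refine hgap h.start_nonneg (fun r hr => hlt r hr.2) ?_ (coefficient_left hφ h le_rfl)
    rcases h.start_nonneg.eq_or_lt with h0 | h0
    · rw [h0]; exact coefficient_left hφ h le_rfl
    · exact coefficient_of_notMem (hlt 0 h0)
  | succ k hk ih =>
    have hδ := h.length_pos k hk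
    have h1 := oscillator_energy_le (C := c * (n k / δ k)) (by linarith : τ k ≤ τ k + δ k)
      (by positivity) hdiff hpos (fun r hr => abs_deriv_coefficient_le hφ h hc hk hr) hw hv
      (coefficient_left hφ h hk) (coefficient_right hφ h hk)
    have h2 := hgap (h.separated k hk).le (fun r hr j hj hrj => by
      rcases lt_trichotomy j k with hjk | rfl | hjk
      · linarith [h.add_lt hj hjk, hrj.2, hr.1]
      · linarith [hrj.2, hr.1]
      · rcases (Nat.succ_le_of_lt hjk).eq_or_lt with he | hl
        · rw [← he] at hrj
          exact absurd hrj.1 (not_le.2 hr.2)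
        · have := h.add_lt (Nat.succ_le_succ (Nat.zero_le k)) hl
          have h3 := h.length_pos (k + 1) (by omega)
          simp only [Nat.succ_eq_add_one] at this
          linarith [hrj.1, hr.2]) (coefficient_right hφ h hk) (coefficient_left hφ h (by omega))
    -- Rate times length: the loss depends on the number of periods only, not on `δ k`.
    have h3 : c * (n k / δ k) * (τ k + δ k - τ k) = c * n k := by field_simp; ring
    rw [h3] at h1
    rw [Finset.sum_Ico_succ_top hk, mul_add (2 * c), Real.exp_add, mul_assoc]
    refine ih.trans (mul_le_mul_of_nonneg_left (h1.trans ?_) (Real.exp_pos _).le)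
    rw [mul_assoc 2 c]
    exact mul_le_mul_of_nonneg_left h2 (Real.exp_pos _).le

/-- On the `k`-th interval the rescaled oscillator runs through `n k` periods. -/
theorem resonant_growth (hφ : IsProfile φ) (h : IsAdmissible τ δ n) {k : ℕ} (hk : 1 ≤ k)
    {κ e₁ e₂ l ρ : ℝ} (hρ : ρ = l * (n k / δ k))
    (hgrow : ∀ x y : ℕ → ℝ, x 0 = e₁ → y 0 = e₂ → ∀ n : ℕ,
      (∀ j < n, x (j + 1) = odeSol (fun s => (1 + φ s) ^ 2) 0 (x j) (y j) (-l ^ 2) 1) →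
      (∀ j < n, y (j + 1) = odeSolDeriv (fun s => (1 + φ s) ^ 2) 0 (x j) (y j) (-l ^ 2) 1) →
      Real.exp (2 * κ * n) * (l ^ 2 * e₁ ^ 2 + e₂ ^ 2) ≤ l ^ 2 * x n ^ 2 + y n ^ 2)
    {w v : ℝ → ℝ} (hw : ∀ r, HasDerivAt w (v r) r)
    (hv : ∀ r, HasDerivAt v (-ρ ^ 2 * coefficient φ τ δ n r ^ 2 * w r) r)
    (hw0 : w (τ k) = e₁) (hv0 : v (τ k) = n k / δ k * e₂) :
    Real.exp (2 * κ * n k) * (ρ ^ 2 * w (τ k) ^ 2 + v (τ k) ^ 2) ≤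
      ρ ^ 2 * w (τ k + δ k) ^ 2 + v (τ k + δ k) ^ 2 := by
  have hδ := h.length_pos k hk
  have hn : (0 : ℝ) < n k := by exact_mod_cast h.count_pos k hk
  set r : ℝ := n k / δ k with hr
  have hr0 : 0 < r := div_pos hn hδ
  set B : ℝ → ℝ := fun s => (1 + φ s) ^ 2 with hB
  have hBc : Continuous B := (continuous_const.add hφ.smooth.continuous).pow 2
  have hBK : ∀ s, |B s| ≤ 4 := fun s => by
    have := abs_lt.1 (hφ.abs_lt_one s)
    rw [abs_of_nonneg (sq_nonneg _)]
    nlinarith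
  -- One period in rescaled time `s = r (t - τ k) - j`. Velocities are divided by `r`, and `ρ = l r`
  -- turns the frequency into `l`.
  have hstep : ∀ j < n k,
      w (τ k + (j + 1) / r) = odeSol B 0 (w (τ k + j / r)) (v (τ k + j / r) / r) (-l ^ 2) 1 ∧
      v (τ k + (j + 1) / r) / r =
        odeSolDeriv B 0 (w (τ k + j / r)) (v (τ k + j / r) / r) (-l ^ 2) 1 := by
    intro j hj
    have hj' : (j : ℝ) + 1 ≤ n k := by exact_mod_cast hj
    have hj0 : (0 : ℝ) ≤ j := Nat.cast_nonneg j
    set x := w (τ k + j / r)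
    set y := v (τ k + j / r) / r with hy
    have hin : ∀ t, HasDerivAt (fun t => r * (t - τ k) - j) r t := fun t => by
      simpa using (((hasDerivAt_id t).sub_const (τ k)).const_mul r).sub_const (j : ℝ)
    have hW : ∀ t, HasDerivAt (fun t => odeSol B 0 x y (-l ^ 2) (r * (t - τ k) - j))
        (odeSolDeriv B 0 x y (-l ^ 2) (r * (t - τ k) - j) * r) t := fun t =>
      (hasDerivAt_odeSol (𝕜 := ℝ) hBc hBK (-l ^ 2) _).comp t (hin t)
    have hV : ∀ t, HasDerivAt (fun t => odeSolDeriv B 0 x y (-l ^ 2) (r * (t - τ k) - j) * r)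
        (-l ^ 2 * B (r * (t - τ k) - j) * odeSol B 0 x y (-l ^ 2) (r * (t - τ k) - j) * r * r)
        t := fun t =>
      ((hasDerivAt_odeSolDeriv (𝕜 := ℝ) hBc hBK (-l ^ 2) _).comp t (hin t)).mul_const r
    have hle : τ k + j / r ≤ τ k + (j + 1) / r := by
      have : (j : ℝ) / r ≤ (j + 1) / r := div_le_div_of_nonneg_right (by linarith) hr0.le
      linarith
    have hcoef : ∀ t ∈ Icc (τ k + j / r) (τ k + (j + 1) / r),
        coefficient φ τ δ n t ^ 2 = B (r * (t - τ k) - j) := by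
      intro t ht
      have h1 : (j : ℝ) ≤ r * (t - τ k) := by
        have := (div_le_iff₀' hr0).1 (by linarith [ht.1] : (j : ℝ) / r ≤ t - τ k)
        linarith
      have h2 : r * (t - τ k) ≤ j + 1 := by
        have := (le_div_iff₀' hr0).1 (by linarith [ht.2] : t - τ k ≤ ((j : ℝ) + 1) / r)
        linarith
      have h3 : t ∈ Icc (τ k) (τ k + δ k) :=
        (h.scale_mem_iff hk t).1 ⟨by linarith, by linarith⟩
      rw [coefficient_of_mem h hk h3,
        periodisation_of_mem hφ (j := j) (s := r * (t - τ k)) ⟨by exact_mod_cast h1,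
          by exact_mod_cast h2⟩]
      simp [hB]
    have hleft : r * (τ k + j / r - τ k) - j = 0 := by field_simp; ring
    have hright : r * (τ k + (j + 1) / r - τ k) - j = 1 := by field_simp; ring
    have := second_order_ode_unique (c := fun t => -ρ ^ 2 * coefficient φ τ δ n t ^ 2)
      (K := ρ ^ 2 * 4) (fun t => by
        rw [abs_mul, abs_neg, abs_of_nonneg (sq_nonneg ρ)]
        exact mul_le_mul_of_nonneg_left (abs_coefficient_sq_le hφ h t) (sq_nonneg ρ))
      (a := τ k + j / r) (b := τ k + (j + 1) / r)
      (fun t _ => (hw t).hasDerivWithinAt)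
      (fun t _ => (hv t).hasDerivWithinAt)
      (fun t _ => (hW t).hasDerivWithinAt)
      (fun t ht => ((hV t).congr_deriv (by
        rw [smul_eq_mul, hcoef t ht, hρ]; ring)).hasDerivWithinAt)
      (by simp only [hleft]; rw [odeSol_self]; rfl)
      (by simp only [hleft]; rw [odeSolDeriv_self, hy]; simp; field_simp)
      (right_mem_Icc.2 hle)
    simp only [hright] at this
    refine ⟨this.1, ?_⟩
    rw [this.2]
    field_simp
  have h0 : τ k + ((0 : ℕ) : ℝ) / r = τ k := by simp
  have hN : τ k + (n k : ℝ) / r = τ k + δ k := by rw [hr]; field_simp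
  have := hgrow (fun j => w (τ k + j / r)) (fun j => v (τ k + j / r) / r)
    (by simp only [h0]; exact hw0) (by simp only [h0]; rw [hv0]; field_simp) (n k)
    (fun j hj => by simpa using (hstep j hj).1) (fun j hj => by simpa using (hstep j hj).2)
  simp only [hN] at this
  have h2 := mul_le_mul_of_nonneg_left this (sq_nonneg r)
  calc _ = r ^ 2 * (Real.exp (2 * κ * n k) * (l ^ 2 * e₁ ^ 2 + e₂ ^ 2)) := by
        rw [hw0, hv0, hρ]; ring
    _ ≤ _ := h2
    _ = _ := by rw [hρ]; field_simp

end CoefficientEnergy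

/-! ### Construction of the amplified data -/

/-- Only one period matters for the monodromy, so the smooth function `1 + φ` replaces the periodic
one. It is nonconstant on `[0, 1]` since `φ` is nonzero and vanishes outside. -/
theorem IsProfile.exists_resonance {φ : ℝ → ℝ} (hφ : IsProfile φ) :
    ∃ κ e₁ e₂ l₀ : ℝ, 0 < κ ∧ (e₁ ≠ 0 ∨ e₂ ≠ 0) ∧ 0 < l₀ ∧ ∀ᶠ l in 𝓝 l₀, 0 < l ∧
      ∀ x y : ℕ → ℝ, x 0 = e₁ → y 0 = e₂ → ∀ n : ℕ,
        (∀ j < n, x (j + 1) = odeSol (fun s => (1 + φ s) ^ 2) 0 (x j) (y j) (-l ^ 2) 1) →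
        (∀ j < n, y (j + 1) = odeSolDeriv (fun s => (1 + φ s) ^ 2) 0 (x j) (y j) (-l ^ 2) 1) →
        Real.exp (2 * κ * n) * (l ^ 2 * e₁ ^ 2 + e₂ ^ 2) ≤ l ^ 2 * x n ^ 2 + y n ^ 2 := by
  obtain ⟨m, hm, hmφ⟩ := hφ.exists_lower_bound
  obtain ⟨C, hC0, hC⟩ := hφ.exists_iteratedDeriv_bound 1
  simp only [iteratedDeriv_one] at hC
  have hK : ∀ s, |(1 + φ s) ^ 2| ≤ 4 := fun s => by
    have := abs_lt.1 (hφ.abs_lt_one s)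
    rw [abs_of_nonneg (sq_nonneg _)]
    nlinarith
  have hd : ∀ t, HasDerivAt (fun t => 1 + φ t) (deriv φ t) t := fun t =>
    ((hφ.smooth.differentiable (by simp)) t).hasDerivAt.const_add 1
  obtain ⟨l₀, hl₀, hD⟩ := exists_two_lt_abs_hillDiscriminant hd (fun t => hm.trans_le (hmφ t)) hK
    (c := C / m) (fun t => by
      refine (hC t).trans ?_
      rw [div_mul_eq_mul_div, le_div_iff₀ hm]
      exact mul_le_mul_of_nonneg_left (hmφ t) hC0)
    (by simp [hφ.eq_zero (x := 0)]) (by simp [hφ.eq_zero (x := 1)]) (by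
      by_contra! hcon
      refine hφ.ne_zero (funext fun x => ?_)
      by_cases hx : x ∈ Icc (0 : ℝ) 1
      · simpa using hcon x hx
      · exact hφ.eq_zero fun h => hx (Ioo_subset_Icc_self h))
  obtain ⟨κ, e₁, e₂, hκ, he, hev⟩ := exists_uniform_growth
    ((continuous_const.add hφ.smooth.continuous).pow 2) hK hl₀ hD
  exact ⟨κ, e₁, e₂, l₀, hκ, he, hl₀, hev⟩

open FourierTransform in
/-- The energy of a state whose Fourier transform has compactly supported profile `χ`. -/
theorem energy_eq_of_fourier_eq_smul {d : ℕ} {f g χ : 𝓢(Space d, ℂ)} (hχ : HasCompactSupport χ)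
    {w v : Space d → ℝ} (hf : ∀ ξ, 𝓕 f ξ = w ξ • χ ξ) (hg : ∀ ξ, 𝓕 g ξ = v ξ • χ ξ) :
    energy f g = (1 / 2) * ∫ ξ, ((2 * Real.pi * ‖ξ‖) ^ 2 * w ξ ^ 2 + v ξ ^ 2) * ‖χ ξ‖ ^ 2 ∧
    (Continuous fun ξ => ((2 * Real.pi * ‖ξ‖) ^ 2 * w ξ ^ 2 + v ξ ^ 2) * ‖χ ξ‖ ^ 2) ∧
    HasCompactSupport fun ξ => ((2 * Real.pi * ‖ξ‖) ^ 2 * w ξ ^ 2 + v ξ ^ 2) * ‖χ ξ‖ ^ 2 := by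
  have key : (fun ξ => (2 * Real.pi * ‖ξ‖) ^ 2 * ‖𝓕 f ξ‖ ^ 2 + ‖𝓕 g ξ‖ ^ 2) =
      fun ξ => ((2 * Real.pi * ‖ξ‖) ^ 2 * w ξ ^ 2 + v ξ ^ 2) * ‖χ ξ‖ ^ 2 := by
    ext ξ
    rw [hf, hg, norm_smul, norm_smul, mul_pow (‖w ξ‖), mul_pow (‖v ξ‖), Real.norm_eq_abs,
      Real.norm_eq_abs, sq_abs, sq_abs]
    ring
  refine ⟨by rw [energy_eq_fourier, key], ?_, ?_⟩
  · rw [← key]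
    have h1 := (𝓕 f : 𝓢(Space d, ℂ)).continuous
    have h2 := (𝓕 g : 𝓢(Space d, ℂ)).continuous
    fun_prop
  · have : HasCompactSupport fun ξ => ‖χ ξ‖ ^ 2 := hχ.comp_left (g := fun z : ℂ => ‖z‖ ^ 2) (by simp)
    exact this.mul_left

theorem exists_bump {d : ℕ} {s : Set (Space d)} {ξ₀ : Space d} (hs : s ∈ 𝓝 ξ₀) :
    ∃ χ : 𝓢(Space d, ℂ), HasCompactSupport χ ∧ χ ξ₀ ≠ 0 ∧ ∀ ξ ∉ s, χ ξ = 0 := by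
  obtain ⟨f, hfs, hfc, hf, -, hf1⟩ := exists_contDiff_tsupport_subset (n := ⊤) hs
  have h1 : HasCompactSupport fun ξ => (f ξ : ℂ) :=
    hfc.comp_left (g := fun x : ℝ => (x : ℂ)) Complex.ofReal_zero
  have h2 : ContDiff ℝ ∞ fun ξ => (f ξ : ℂ) := Complex.ofRealCLM.contDiff.comp hf
  refine ⟨h1.toSchwartzMap h2, h1, ?_, fun ξ hξ => ?_⟩
  · change (f ξ₀ : ℂ) ≠ 0
    simp [hf1]
  · change (f ξ : ℂ) = 0
    rw [image_eq_zero_of_notMem_tsupport fun h => hξ (hfs h), Complex.ofReal_zero]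

/-- A solution of `w'' = -ρ² a² w` with nontrivial data at time `T ≥ 0` has positive energy at
time `0`. -/
theorem oscillator_energy_zero_pos {a w v : ℝ → ℝ} {ρ T K : ℝ} (hT : 0 ≤ T) (hρ : ρ ≠ 0)
    (hK : ∀ t, |a t ^ 2| ≤ K) (hw : ∀ r, HasDerivAt w (v r) r)
    (hv : ∀ r, HasDerivAt v (-ρ ^ 2 * a r ^ 2 * w r) r) (hne : w T ≠ 0 ∨ v T ≠ 0) :
    0 < ρ ^ 2 * w 0 ^ 2 + v 0 ^ 2 := by
  by_contra! hcon
  have hρ2 : 0 < ρ ^ 2 := by positivity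
  have hv0 : v 0 = 0 := by
    have : 0 ≤ ρ ^ 2 * w 0 ^ 2 := by positivity
    exact pow_eq_zero_iff two_ne_zero |>.1 (le_antisymm (by linarith) (sq_nonneg _))
  have hw0 : w 0 = 0 := by
    rw [hv0] at hcon
    have h1 : w 0 ^ 2 ≤ 0 := by
      by_contra! h
      nlinarith [mul_pos hρ2 h]
    exact pow_eq_zero_iff two_ne_zero |>.1 (le_antisymm h1 (sq_nonneg _))
  have := second_order_ode_unique (c := fun t => -ρ ^ 2 * a t ^ 2) (K := ρ ^ 2 * K) (fun t => by
      rw [abs_mul, abs_neg, abs_of_nonneg (sq_nonneg ρ)]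
      exact mul_le_mul_of_nonneg_left (hK t) (sq_nonneg ρ))
    (a := 0) (b := T) (fun t _ => (hw t).hasDerivWithinAt) (fun t _ => (hv t).hasDerivWithinAt)
    (w₂ := fun _ => 0) (v₂ := fun _ => 0) (fun t _ => hasDerivWithinAt_const _ _ _)
    (fun t _ => by simpa using hasDerivWithinAt_const t (Icc 0 T) (0 : ℝ)) hw0 hv0
    (right_mem_Icc.2 hT)
  exact hne.elim (fun h => h this.1) fun h => h this.2

/-- Data for which the energy grows at least by the factor by which it grows at every frequency in
the support of `χ`. -/
theorem exists_amplified_data {d : ℕ} {a : ℝ → ℝ} (hA : Continuous fun t => a t ^ 2) {K : ℝ}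
    (hK : ∀ t, |a t ^ 2| ≤ K) {t₀ x y : ℝ} {χ : 𝓢(Space d, ℂ)} (hχ : HasCompactSupport χ)
    {E : Space d → ℝ → ℝ} (hE : ∀ ξ t, E ξ t = (2 * Real.pi * ‖ξ‖) ^ 2 *
        odeSol (fun t => a t ^ 2) t₀ x y (-(2 * Real.pi * ‖ξ‖) ^ 2) t ^ 2 +
        odeSolDeriv (fun t => a t ^ 2) t₀ x y (-(2 * Real.pi * ‖ξ‖) ^ 2) t ^ 2)
    {T G : ℝ} (hT : 0 ≤ T) (hgrow : ∀ ξ, χ ξ ≠ 0 → G * E ξ 0 ≤ E ξ T)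
    {ξ₀ : Space d} (hχ₀ : χ ξ₀ ≠ 0) (hE₀ : 0 < E ξ₀ 0) :
    ∃ u₀ u₁ : 𝓢(Space d, ℂ), energy u₀ u₁ = 1 ∧ (∃ u v, IsWaveSolution a u₀ u₁ u v) ∧
      ∀ u v, IsWaveSolution a u₀ u₁ u v → G ≤ energy (u T) (v T) := by
  have hen : ∀ ψ : 𝓢(Space d, ℂ), HasCompactSupport ψ → ∃ u v : ℝ → 𝓢(Space d, ℂ),
      IsWaveSolution a (u 0) (v 0) u v ∧ ∀ t,
        energy (u t) (v t) = (1 / 2) * ∫ ξ, E ξ t * ‖ψ ξ‖ ^ 2 ∧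
        (Continuous fun ξ => E ξ t * ‖ψ ξ‖ ^ 2) ∧
        HasCompactSupport fun ξ => E ξ t * ‖ψ ξ‖ ^ 2 := fun ψ hψ => by
    obtain ⟨u, v, hud, hvd, hu, hv⟩ := exists_wave_curve hA hK t₀ x y ψ hψ
    refine ⟨u, v, ⟨rfl, rfl, fun t _ => hud t _, fun t _ => hvd t _⟩, fun t => ?_⟩
    simp only [hE]
    exact energy_eq_of_fourier_eq_smul hψ (hu t) (hv t)
  have hEnn : ∀ ξ t, 0 ≤ E ξ t := fun ξ t => by rw [hE]; positivity
  -- The energy is quadratic in the profile, so rescaling `χ` by `√(2 / I)` normalises it without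
  -- changing the growth factor.
  obtain ⟨s, hs⟩ : ∃ s : ℝ, (1 / 2) * ∫ ξ, E ξ 0 * ‖(s • χ) ξ‖ ^ 2 = 1 := by
    obtain ⟨u, v, -, huv⟩ := hen χ hχ
    obtain ⟨-, hc1, hc2⟩ := huv 0
    have hI : 0 < ∫ ξ, E ξ 0 * ‖χ ξ‖ ^ 2 :=
      hc1.integral_pos_of_hasCompactSupport_nonneg_nonzero hc2
        (fun ξ => mul_nonneg (hEnn ξ 0) (sq_nonneg _))
        (mul_pos hE₀ (pow_pos (norm_pos_iff.2 hχ₀) 2)).ne'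
    set I := ∫ ξ, E ξ 0 * ‖χ ξ‖ ^ 2 with hIdef
    refine ⟨√(2 / I), ?_⟩
    have : ∀ ξ, E ξ 0 * ‖(√(2 / I) • χ) ξ‖ ^ 2 = (2 / I) * (E ξ 0 * ‖χ ξ‖ ^ 2) := fun ξ => by
      rw [smul_apply, norm_smul, mul_pow, Real.norm_eq_abs, sq_abs, Real.sq_sqrt (by positivity)]
      ring
    simp only [this]
    rw [MeasureTheory.integral_const_mul, ← hIdef]
    field_simp
  have hsc : HasCompactSupport (s • χ : 𝓢(Space d, ℂ)) := hχ.smul_left (f := fun _ => s)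
  obtain ⟨u, v, hsol, huv⟩ := hen _ hsc
  obtain ⟨hE1, hE2, hE3⟩ := huv 0
  obtain ⟨hF1, hF2, hF3⟩ := huv T
  refine ⟨u 0, v 0, hE1.trans hs, ⟨u, v, hsol⟩, fun u' v' h' => ?_⟩
  obtain ⟨h1, h2⟩ := h'.unique hK hsol hT
  rw [h1, h2, hF1]
  have hle : G * ∫ ξ, E ξ 0 * ‖(s • χ) ξ‖ ^ 2 ≤ ∫ ξ, E ξ T * ‖(s • χ) ξ‖ ^ 2 := by
    rw [← MeasureTheory.integral_const_mul]
    refine MeasureTheory.integral_mono ((hE2.integrable_of_hasCompactSupport hE3).const_mul _)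
      (hF2.integrable_of_hasCompactSupport hF3) fun ξ => ?_
    simp only
    by_cases hξ : χ ξ = 0
    · simp [hξ]
    · rw [← mul_assoc]
      exact mul_le_mul_of_nonneg_right (hgrow ξ hξ) (sq_nonneg _)
  have h2 : ∫ ξ, E ξ 0 * ‖(s • χ) ξ‖ ^ 2 = 2 := by linarith
  rw [h2] at hle
  linarith

/-- Data that are amplified by resonance on the `k`-th interval. -/
theorem exists_resonant_data {d : ℕ} (hd : 1 ≤ d) {φ : ℝ → ℝ} (hφ : IsProfile φ) :
    ∃ κ : ℝ, 0 < κ ∧ ∀ c : ℝ, 0 ≤ c →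
      (∀ s, |deriv (periodisation φ) s| ≤ c * (1 + periodisation φ s)) →
      ∀ (τ δ : ℕ → ℝ) (n : ℕ → ℕ), IsAdmissible τ δ n → ∀ k, 1 ≤ k →
        ∃ u₀ u₁ : 𝓢(Space d, ℂ), energy u₀ u₁ = 1 ∧
          (∃ u v, IsWaveSolution (coefficient φ τ δ n) u₀ u₁ u v) ∧
          ∀ u v, IsWaveSolution (coefficient φ τ δ n) u₀ u₁ u v →
            Real.exp (2 * κ * n k - 2 * c * ∑ l ∈ Finset.Ico 1 k, (n l : ℝ)) ≤
              energy (u (τ k + δ k)) (v (τ k + δ k)) := by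
  obtain ⟨κ, e₁, e₂, l₀, hκ, he, hl₀, hev⟩ := hφ.exists_resonance
  refine ⟨κ, hκ, fun c hc0 hc τ δ n h k hk => ?_⟩
  have hδ := h.length_pos k hk
  have hn : (0 : ℝ) < n k := by exact_mod_cast h.count_pos k hk
  have hr0 : 0 < (n k : ℝ) / δ k := div_pos hn hδ
  have hτ : 0 ≤ τ k := by
    rcases hk.eq_or_lt with rfl | hk1
    · exact h.start_nonneg
    · linarith [h.add_lt le_rfl hk1, h.length_pos 1 le_rfl, h.start_nonneg]
  set a := coefficient φ τ δ n with ha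
  have hA : Continuous fun t => a t ^ 2 := (contDiff_coefficient hφ h).continuous.pow 2
  have hK := abs_coefficient_sq_le hφ h
  -- The resonant vector is imposed at time `τ k`, the same for all frequencies; its velocity is
  -- scaled by `n k / δ k` to undo the change of time.
  set W : Space d → ℝ → ℝ := fun ξ =>
    odeSol (fun t => a t ^ 2) (τ k) e₁ (n k / δ k * e₂) (-(2 * Real.pi * ‖ξ‖) ^ 2) with hW
  set V : Space d → ℝ → ℝ := fun ξ =>
    odeSolDeriv (fun t => a t ^ 2) (τ k) e₁ (n k / δ k * e₂) (-(2 * Real.pi * ‖ξ‖) ^ 2) with hV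
  have hWd : ∀ ξ t, HasDerivAt (W ξ) (V ξ t) t := fun ξ t => hasDerivAt_odeSol (𝕜 := ℝ) hA hK _ t
  have hVd : ∀ ξ t, HasDerivAt (V ξ) (-(2 * Real.pi * ‖ξ‖) ^ 2 * a t ^ 2 * W ξ t) t := fun ξ t =>
    hasDerivAt_odeSolDeriv (𝕜 := ℝ) hA hK _ t
  have hW0 : ∀ ξ, W ξ (τ k) = e₁ := fun ξ => odeSol_self _
  have hV0 : ∀ ξ, V ξ (τ k) = n k / δ k * e₂ := fun ξ => odeSolDeriv_self _
  set E : Space d → ℝ → ℝ := fun ξ t => (2 * Real.pi * ‖ξ‖) ^ 2 * W ξ t ^ 2 + V ξ t ^ 2 with hE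
  set S : ℝ := 2 * κ * n k - 2 * c * ∑ l ∈ Finset.Ico 1 k, (n l : ℝ) with hS
  -- A frequency whose rescaled value is the unstable parameter; a coordinate direction is available
  -- because `1 ≤ d`.
  obtain ⟨ξ₀, hξ₀⟩ : ∃ ξ₀ : Space d, 2 * Real.pi * ‖ξ₀‖ / (n k / δ k) = l₀ := by
    refine ⟨EuclideanSpace.single ⟨0, hd⟩ (l₀ * (n k / δ k) / (2 * Real.pi)), ?_⟩
    have hpi := Real.pi_pos
    rw [PiLp.norm_single, Real.norm_of_nonneg (by positivity)]
    field_simp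
  have hcont : Continuous fun ξ : Space d => 2 * Real.pi * ‖ξ‖ / (n k / δ k) := by fun_prop
  rw [← hξ₀] at hev hl₀
  obtain ⟨χ, hχc, hχ0, hχs⟩ := exists_bump (hcont.continuousAt.eventually hev)
  refine exists_amplified_data hA hK hχc (E := E) (fun ξ t => rfl) (add_nonneg hτ hδ.le)
    (fun ξ hξ => ?_) hχ0 ?_
  · have hl := not_imp_comm.1 (hχs ξ) hξ
    have h1 := energy_zero_le hφ h hc0 hc (hWd ξ) (hVd ξ) hk
    have h2 := resonant_growth hφ h hk (ρ := 2 * Real.pi * ‖ξ‖)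
      (by field_simp) hl.2 (hWd ξ) (hVd ξ) (hW0 ξ) (hV0 ξ)
    calc Real.exp S * E ξ 0 ≤ Real.exp S * (Real.exp (2 * c * ∑ l ∈ Finset.Ico 1 k, (n l : ℝ)) *
          E ξ (τ k)) := mul_le_mul_of_nonneg_left h1 (Real.exp_pos _).le
      _ = Real.exp (2 * κ * n k) * E ξ (τ k) := by
          rw [← mul_assoc, ← Real.exp_add, hS, sub_add_cancel]
      _ ≤ _ := h2
  · refine oscillator_energy_zero_pos hτ (fun h0 => ?_) hK (hWd ξ₀) (hVd ξ₀) ?_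
    · rw [h0, zero_div] at hl₀
      exact lt_irrefl _ hl₀
    · rw [hW0, hV0]
      exact he.imp_right fun h2 => mul_ne_zero hr0.ne' h2

/-! ### Geometric sequences -/

/-- Allows `σ ^ k` to be exchanged for `1 + t` on the `k`-th interval whatever the sign of the
exponent, that is for `q` on either side of `1`. -/
theorem rpow_le_three_rpow_abs_mul {x y : ℝ} (hx : 0 < x) (hxy : x ≤ y) (hyx : y ≤ 3 * x) (p : ℝ) :
    x ^ p ≤ 3 ^ |p| * y ^ p := by
  have hy : 0 < y := hx.trans_le hxy
  rcases le_total 0 p with hp | hp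
  · calc x ^ p ≤ y ^ p := Real.rpow_le_rpow hx.le hxy hp
      _ ≤ 3 ^ |p| * y ^ p := le_mul_of_one_le_left (Real.rpow_nonneg hy.le _)
        (Real.one_le_rpow (by norm_num) (abs_nonneg p))
  · calc x ^ p = 3 ^ |p| * (3 * x) ^ p := by
          rw [Real.mul_rpow (by norm_num) hx.le, ← mul_assoc, ← Real.rpow_add (by norm_num),
            abs_of_nonpos hp, neg_add_cancel, Real.rpow_zero, one_mul]
      _ ≤ 3 ^ |p| * y ^ p := mul_le_mul_of_nonneg_left
        (Real.rpow_le_rpow_of_nonpos hy hyx hp) (by positivity)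

section Geometric

variable {σ q : ℝ} {τ δ : ℕ → ℝ} {n : ℕ → ℕ}

theorem le_natCeil_rpow_le (hσ : 2 ≤ σ) (hq : 0 < q) (k : ℕ) :
    (σ ^ q) ^ k ≤ (⌈σ ^ (q * (k : ℝ))⌉₊ : ℝ) ∧ (⌈σ ^ (q * (k : ℝ))⌉₊ : ℝ) ≤ 2 * (σ ^ q) ^ k := by
  have h0 : 0 ≤ σ := by linarith
  rw [Real.rpow_mul h0, Real.rpow_natCast]
  have h1 : 1 ≤ (σ ^ q) ^ k := one_le_pow₀ (Real.one_le_rpow (by linarith) hq.le)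
  refine ⟨Nat.le_ceil _, ?_⟩
  have := Nat.ceil_lt_add_one (zero_le_one.trans h1)
  linarith

theorem isAdmissible_geometric (hσ : 2 ≤ σ)
    (h : ∀ k, 1 ≤ k → τ k = σ ^ k ∧ δ k = σ ^ (k - 1) ∧ n k = ⌈σ ^ (q * (k : ℝ))⌉₊) :
    IsAdmissible τ δ n := by
  have h0 : 0 < σ := by linarith
  refine ⟨?_, fun k hk => ?_, fun k hk => ?_, fun k hk => ?_, ?_⟩
  · rw [(h 1 le_rfl).1]; positivity
  · rw [(h k hk).2.1]; positivity
  · rw [(h k hk).2.2]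
    exact Nat.ceil_pos.2 (Real.rpow_pos_of_pos h0 _)
  · obtain ⟨j, rfl⟩ := Nat.exists_eq_add_of_le' hk
    rw [(h _ hk).1, (h _ hk).2.1, (h _ (by omega)).1, Nat.add_sub_cancel]
    have : 0 < σ ^ j := by positivity
    have h1 : σ ^ (j + 1) = σ * σ ^ j := pow_succ' _ _
    have h2 : σ ^ (j + 1 + 1) = σ * (σ * σ ^ j) := by rw [pow_succ', h1]
    rw [h1, h2]
    nlinarith [mul_pos h0 this]
  · refine (tendsto_pow_atTop_atTop_of_one_lt (by linarith : 1 < σ)).congr' ?_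
    filter_upwards [eventually_ge_atTop 1] with k hk using ((h k hk).1).symm

theorem frequency_le_geometric (hσ : 2 ≤ σ) (hq : 0 < q)
    (h : ∀ k, 1 ≤ k → τ k = σ ^ k ∧ δ k = σ ^ (k - 1) ∧ n k = ⌈σ ^ (q * (k : ℝ))⌉₊)
    {k : ℕ} (hk : 1 ≤ k) {t : ℝ} (ht : t ∈ Icc (τ k) (τ k + δ k)) (l : ℕ) :
    ((n k : ℝ) / δ k) ^ l ≤
      (2 * σ) ^ l * 3 ^ |(q - 1) * l| * (1 + t) ^ (-((1 - q) * (l : ℝ))) := by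
  have h0 : 0 < σ := by linarith
  obtain ⟨h1, h2, h3⟩ := h k hk
  rw [h1, h2] at ht
  have hpk : 1 ≤ σ ^ k := one_le_pow₀ (by linarith)
  have hpk' : σ ^ k = σ * σ ^ (k - 1) := by rw [← pow_succ', Nat.sub_add_cancel hk]
  have hp1 : 0 < σ ^ (k - 1) := by positivity
  have hle : σ ^ (k - 1) ≤ σ ^ k := by rw [hpk']; nlinarith
  have hr : (n k : ℝ) / δ k ≤ 2 * σ * (σ ^ k) ^ (q - 1) := by
    rw [h2, h3, div_le_iff₀ hp1]
    refine (le_natCeil_rpow_le hσ hq k).2.trans_eq ?_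
    rw [Real.rpow_sub_one (by positivity), ← Real.rpow_natCast, ← Real.rpow_natCast,
      ← Real.rpow_mul h0.le, ← Real.rpow_mul h0.le, mul_comm (k : ℝ) q]
    rw [Real.rpow_natCast, hpk']
    field_simp
  have hr0 : 0 ≤ (n k : ℝ) / δ k := by rw [h2]; positivity
  calc ((n k : ℝ) / δ k) ^ l ≤ (2 * σ * (σ ^ k) ^ (q - 1)) ^ l := pow_le_pow_left₀ hr0 hr l
    _ = (2 * σ) ^ l * (σ ^ k) ^ ((q - 1) * l) := by
      rw [mul_pow, Real.rpow_mul (by positivity), Real.rpow_natCast]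
    _ ≤ (2 * σ) ^ l * (3 ^ |(q - 1) * l| * (1 + t) ^ ((q - 1) * l)) :=
      mul_le_mul_of_nonneg_left (rpow_le_three_rpow_abs_mul (by positivity) (by linarith [ht.1])
        (by linarith [ht.2]) _) (by positivity)
    _ = _ := by rw [← mul_assoc]; congr 2; ring

theorem exists_symbol_estimate_geometric {φ : ℝ → ℝ} (hφ : IsProfile φ) (hσ : 2 ≤ σ) (hq : 0 < q)
    (h : ∀ k, 1 ≤ k → τ k = σ ^ k ∧ δ k = σ ^ (k - 1) ∧ n k = ⌈σ ^ (q * (k : ℝ))⌉₊) (l : ℕ) :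
    ∃ C : ℝ, ∀ t : ℝ, 0 ≤ t →
      |iteratedDeriv l (coefficient φ τ δ n) t| ≤ C * (1 + t) ^ (-((1 - q) * (l : ℝ))) := by
  have had := isAdmissible_geometric hσ h
  rcases Nat.eq_zero_or_pos l with rfl | hl
  · obtain ⟨m, hm, hb⟩ := exists_coefficient_bounds hφ had
    refine ⟨2, fun t _ => ?_⟩
    simp only [iteratedDeriv_zero, Nat.cast_zero, mul_zero, neg_zero, Real.rpow_zero, mul_one]
    exact abs_le.2 ⟨by linarith [(hb t).1], (hb t).2.le⟩
  · obtain ⟨C, hC0, hC⟩ := hφ.exists_iteratedDeriv_bound l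
    refine ⟨(2 * σ) ^ l * 3 ^ |(q - 1) * l| * C, fun t ht => ?_⟩
    have h1 : 0 ≤ (1 + t) ^ (-((1 - q) * (l : ℝ))) := Real.rpow_nonneg (by linarith) _
    refine abs_iteratedDeriv_coefficient_le hφ had hl hC0 hC (by positivity) fun k hk hkt => ?_
    refine (mul_le_mul_of_nonneg_right (frequency_le_geometric hσ hq h hk hkt l) hC0).trans_eq ?_
    ring

/-- Since `n l ≤ 2 X ^ l`, the earlier losses total at most `4c (X ^ k - 1) / (X - 1)`. The
hypothesis `4c ≤ κ (X - 1)` makes this at most `κ X ^ k`, half of the guaranteed gain. -/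
theorem growth_exponent_ge_geometric (hσ : 2 ≤ σ) (hq : 0 < q)
    (h : ∀ k, 1 ≤ k → τ k = σ ^ k ∧ δ k = σ ^ (k - 1) ∧ n k = ⌈σ ^ (q * (k : ℝ))⌉₊)
    {κ c : ℝ} (hκ : 0 < κ) (hc : 0 ≤ c) (hσκ : 1 + 4 * c / κ ≤ σ ^ q) {k : ℕ} (hk : 1 ≤ k) :
    κ * (σ ^ q) ^ k ≤ 2 * κ * n k - 2 * c * ∑ l ∈ Finset.Ico 1 k, (n l : ℝ) := by
  set X := σ ^ q with hX
  have hX1 : 1 < X := Real.one_lt_rpow (by linarith) hq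
  have h1 : X ^ k ≤ n k := by rw [(h k hk).2.2]; exact (le_natCeil_rpow_le hσ hq k).1
  have h2 : ∑ l ∈ Finset.Ico 1 k, (n l : ℝ) ≤ 2 * ∑ l ∈ Finset.range k, X ^ l := by
    rw [Finset.mul_sum, Finset.range_eq_Ico]
    refine (Finset.sum_le_sum fun l hl => ?_).trans
      (Finset.sum_le_sum_of_subset_of_nonneg (Finset.Ico_subset_Ico_left zero_le_one)
        fun l _ _ => by positivity)
    rw [(h l (Finset.mem_Ico.1 hl).1).2.2]
    exact (le_natCeil_rpow_le hσ hq l).2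
  have h3 : (X - 1) * ∑ l ∈ Finset.range k, X ^ l = X ^ k - 1 := mul_geom_sum X k
  have h4 : 4 * c ≤ κ * (X - 1) := by
    have : 4 * c / κ ≤ X - 1 := by linarith
    rwa [div_le_iff₀' hκ] at this
  have hG : 0 ≤ ∑ l ∈ Finset.range k, X ^ l := Finset.sum_nonneg fun l _ => by positivity
  have h5 : 4 * c * ∑ l ∈ Finset.range k, X ^ l ≤ κ * (X ^ k - 1) := by
    rw [← h3, ← mul_assoc]
    exact mul_le_mul_of_nonneg_right h4 hG
  have h6 := mul_le_mul_of_nonneg_left h2 (by positivity : 0 ≤ 2 * c)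
  have h7 := mul_le_mul_of_nonneg_left h1 (by positivity : 0 ≤ 2 * κ)
  nlinarith

end Geometric

theorem mainTheorem10 (d : ℕ) (hd : 1 ≤ d) (φ : ℝ → ℝ) (hφ : IsProfile φ) :
    -- the lower energy bound, with constants depending only on the oscillation profile
    (∃ κ c : ℝ, 0 < κ ∧ 0 < c ∧
      IsLUB (Set.range fun s : ℝ => |deriv (periodisation φ) s| / (1 + periodisation φ s)) c ∧
      ∀ (τ δ : ℕ → ℝ) (n : ℕ → ℕ), IsAdmissible τ δ n →
        ∃ u₀ u₁ : ℕ → 𝓢(Space d, ℂ), ∀ k, 1 ≤ k →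
          energy (u₀ k) (u₁ k) = 1 ∧
          (∃ u v, IsWaveSolution (coefficient φ τ δ n) (u₀ k) (u₁ k) u v) ∧
          ∀ u v, IsWaveSolution (coefficient φ τ δ n) (u₀ k) (u₁ k) u v →
            0 < energy (u (τ k + δ k)) (v (τ k + δ k)) ∧
            Real.log (energy (u (τ k + δ k)) (v (τ k + δ k))) ≥
              2 * κ * (n k : ℝ) - 2 * c * ∑ l ∈ Finset.Ico 1 k, (n l : ℝ)) ∧
    -- the failure of uniform energy bounds in the weaker coefficient classes
    (∀ q : ℝ, 0 < q → ∃ σ₀ : ℝ, 1 < σ₀ ∧ ∀ σ : ℝ, σ₀ ≤ σ →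
      ∀ (τ δ : ℕ → ℝ) (n : ℕ → ℕ),
        (∀ k, 1 ≤ k → τ k = σ ^ k ∧ δ k = σ ^ (k - 1) ∧ n k = ⌈σ ^ (q * (k : ℝ))⌉₊) →
        IsAdmissible τ δ n ∧
        ContDiff ℝ ∞ (coefficient φ τ δ n) ∧
        (∃ m : ℝ, 0 < m ∧ ∀ t, m ≤ coefficient φ τ δ n t ∧ coefficient φ τ δ n t < 2) ∧
        (∀ l : ℕ, ∃ C : ℝ, ∀ t : ℝ, 0 ≤ t →
          |iteratedDeriv l (coefficient φ τ δ n) t| ≤ C * (1 + t) ^ (-((1 - q) * (l : ℝ)))) ∧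
        ¬ ∃ C : ℝ, ∀ (u₀ u₁ : 𝓢(Space d, ℂ)) (u v : ℝ → 𝓢(Space d, ℂ)),
          IsWaveSolution (coefficient φ τ δ n) u₀ u₁ u v →
            ∀ t : ℝ, 0 ≤ t → energy (u t) (v t) ≤ C * energy u₀ u₁) := by
  obtain ⟨c, hc, hlub⟩ := exists_isLUB_logDeriv hφ
  obtain ⟨m, hm, hmφ⟩ := hφ.exists_lower_bound
  have hlog : ∀ s, |deriv (periodisation φ) s| ≤ c * (1 + periodisation φ s) := fun s =>
    (div_le_iff₀ (hm.trans_le (hmφ _))).1 (hlub.1 ⟨s, rfl⟩)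
  obtain ⟨κ, hκ, hdata⟩ := exists_resonant_data hd hφ
  refine ⟨⟨κ, c, hκ, hc, hlub, fun τ δ n h => ?_⟩, fun q hq => ?_⟩
  · choose! u₀ u₁ h1 h2 h3 using hdata c hc.le hlog τ δ n h
    refine ⟨u₀, u₁, fun k hk => ⟨h1 k hk, h2 k hk, fun u v huv => ?_⟩⟩
    have hE := h3 k hk u v huv
    have hpos := (Real.exp_pos _).trans_le hE
    exact ⟨hpos, (Real.le_log_iff_exp_le hpos).2 hE⟩
  -- The `2` gives admissibility, as well as `1 + t ≤ 3 σ ^ k` on the intervals; the power makes `σ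
  -- ^ q` large enough for the gain to absorb the losses.
  · refine ⟨max 2 ((1 + 4 * c / κ) ^ q⁻¹), lt_max_of_lt_left one_lt_two,
      fun σ hσ₀ τ δ n hgeo => ?_⟩
    have hσ : 2 ≤ σ := (le_max_left _ _).trans hσ₀
    have hσκ : 1 + 4 * c / κ ≤ σ ^ q := by
      have h1 := Real.rpow_le_rpow (by positivity) ((le_max_right _ _).trans hσ₀) hq.le
      rwa [Real.rpow_inv_rpow (by positivity) hq.ne'] at h1
    have had := isAdmissible_geometric hσ hgeo
    refine ⟨had, contDiff_coefficient hφ had, exists_coefficient_bounds hφ had,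
      exists_symbol_estimate_geometric hφ hσ hq hgeo, ?_⟩
    rintro ⟨C, hC⟩
    have hX1 : 1 < σ ^ q := Real.one_lt_rpow (by linarith) hq
    -- Choosing `κ (σ ^ q) ^ k > C` contradicts the assumed bound for data of energy `1`, as `exp S
    -- ≥ S + 1 > C` for the growth exponent `S`.
    obtain ⟨k, hk1, hk⟩ := ((eventually_ge_atTop 1).and
      (((tendsto_pow_atTop_atTop_of_one_lt hX1).const_mul_atTop hκ).eventually_gt_atTop C)).exists
    obtain ⟨u₀, u₁, hE, ⟨u, v, huv⟩, hgrow⟩ := hdata c hc.le hlog τ δ n had k hk1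
    have h1 := hgrow u v huv
    have h2 := hC u₀ u₁ u v huv (τ k + δ k) (by
      rw [(hgeo k hk1).1, (hgeo k hk1).2.1]; positivity)
    have h3 := growth_exponent_ge_geometric hσ hq hgeo hκ hc.le hσκ hk1
    have h4 := Real.add_one_le_exp
      (2 * κ * n k - 2 * c * ∑ l ∈ Finset.Ico 1 k, (n l : ℝ))
    rw [hE] at h2
    linarith
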